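/- **The quadrangle $Q$.** Let $F=\mathbb F_4$ and, for $x,y,z\in F$, let $$M(x,y,z)=\begin{pmatrix}1&-x&y&z\\0&1&0&y\\0&0&1&x\\0&0&0&1\end{pmatrix}\in \mathrm{SL}_4(F).$$ Let $S=\{M(x,y,z)\mid x,y,z\in F\}$, a group, let $X_0=\{M(0,0,\mu)\mid \mu\in F\}$ and, for each point $[a:b]$ of the projective line over $F$, let $X_{[a:b]}=\{M(\mu a,\mu b,0)\mid\mu\in F\}$. Let $Q$ be the generalized quadrangle of order $(3,5)$, realized as the slanted symplectic quadrangle over $F$: its points are the elements of $S$, its lines are the left cosets in $S$ of $X_0$ and of the subgroups $X_{[a:b]}$, and incidence is membership. We identify $Q$ with its incidence graph, the bipartite graph on points and lines whose edges (the chambers of $Q$) are the incident point-line pairs. **Actions.** A group of automorphisms of $Q$ is *regular on the edges* if for any two edges exactly one element of the group maps the first to the second. Two actions of groups $G$, $H$ on graphs $X$, $Y$ are *isomorphic* if there are a group isomorphism $\varphi:G\to H$ and a graph isomorphism $\psi:X\to Y$ with $\psi(gx)=\varphi(g)\psi(x)$ for all $g\in G$ and all vertices $x$ of $X$. For subgroups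 $E\neq F'$ of a group $V$, the *coset graph* of $V$ with respect to $E$ and $F'$ has vertex set $V/E\cup V/F'$ (left cosets) and edges $\{vE,vF'\}$, $v\in V$; the group $V$ acts on it by left multiplication. **The groups.** - $L_{1} = \langle a, b \mid a^4, b^6, a b^{-1} a^{-1} b^2 a^{-1} b a^{-2} b, a b a^{-2} b^{-1} a^{-1} b a^{-2} b^{-1}, a b a b^{-1} a b^{-2} a^{-1} b^2 \rangle$ - $L_{2} = \langle a_1, a_2, b_1, b_2 \mid a_1^2, a_2^2, (a_1a_2)^2, b_1^2, b_2^3, (b_1b_2)^2, a_2 b_2 a_1 b_2^{-1} a_2 b_2^{-1} a_1 b_2, (a_1 b_2^{-1} a_1 b_2)^2, a_2 b_2 a_2 b_1 a_1 b_2^{-1} a_1 b_1, a_1 a_2 b_2 a_1 b_2 b_1 a_2 b_2 a_1 b_1, a_1 b_2 b_1 (a_1b_1b_2^{-1})^3 \rangle$ - $L_{3} = \langle a_1, a_2, b \mid a_1^2, a_2^2, (a_1 a_2)^2, b^6, a_1 b a_2 b a_2 b^{-1} a_2 b^{-1}, a_2 b^{-1} a_2 b a_2 b a_1 b^{-1},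 (a_1 b)^4, a_1 b a_2 b^{-2} a_1 b^{-2} a_2 b \rangle$ - $L_{4} = \langle a_1, a_2, b_1, b_2 \mid a_1^2, a_2^2, (a_1 a_2)^2, b_1^2, b_2^3, (b_1 b_2)^2, (a_2 b_1 a_1 b_1)^2, (a_1 b_1)^4, a_2 b_2 a_2 b_1 a_1 b_2^{-1} a_1 b_1, (a_1 b_2^{-1} a_1 b_2)^2, a_2 b_2 a_1 b_2^{-1} a_2 a_1 b_2 a_1 b_2^{-1}, a_1 b_2^{-1} a_2 b_1 b_2 a_2 b_2 a_1 b_1 b_2, a_1 b_2 a_2 b_1 b_2^{-1} a_2 b_2^{-1} a_1 b_2 b_1 \rangle$ - $L_{5} = \langle a_1, a_2, b \mid a_1^2, a_2^2, (a_1 a_2)^2, b^6, (a_2 b)^4, (a_2 b a_1 b)^2, (a_1 b)^4, a_2 b^{-1} a_1 b^2 a_2 b a_1 b^{-2}, a_2 b^2 a_1 b^{-2} a_2 b a_2 b^{-1} \rangle$ - $L_{6} = \langle a, b_1, b_2 \mid a^4, b_1^2, b_2^3, (b_1 b_2^{-1})^2, (a b_2^{-1} a b_1)^2, a b_1 a^{-1}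 b_1 a b_1 a^{-1} b_1 b_2^{-1}, a^{-1} b_2^{-1} a b_2^{-1} a^{-1} b_1 a^{-1} b_1 b_2 \rangle$ - $L_{7} = \langle a_1, a_2, b \mid a_1^2, a_2^2, (a_1 a_2)^2, b^6, (a_2 b a_2 b^{-1})^2, (a_1 b a_2 b^{-1})^2, (a_2 b a_1 b^{-1})^2, (a_1 b a_1 b^{-1})^2, a_1 b a_2 b a_1 b^2 a_2 b^2, (a_1 b a_1 b^2)^2, a_2 b a_2 b a_1 a_2 b a_1 b^3 \rangle$ - $L_{8} = \langle a_1, a_2, b \mid a_1^2, a_2^2, (a_1 a_2)^2, b^6, (b a_1 b^{-1} a_2)^2, a_2 b a_1 a_2 b a_2 b^{-1} a_2 b^{-1}, a_1 b^2 a_2 b a_2 b^2 a_1 b \rangle$ - $L_{9} = \langle a, b_1, b_2 \mid a^4, b_1^2, b_2^3, (b_1 b_2)^2, (a b_2)^4, a b_2^{-1} a b_1 a^{-1} b_2 a^{-1} b_1 b_2, a b_1 a b_1 b_2 a b_2^{-1} a^{-1} b_2^{-1}, a b_1 b_2 a b_1 a b_2 a^{-1} b_2, a b_2 a b_1 a b_1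 a^2 b_2 b_1 \rangle$ - $L_{10} = \langle a_1, a_2, b_1, b_2 \mid a_1^2, a_2^2, (a_1 a_2)^2, b_1^2, b_2^3, (b_1 b_2)^2, (a_1 b_2^{-1} a_1 b_2)^2, a_2 b_2^{-1} a_1 b_1 a_1 b_2 a_2 b_2 b_1, a_2 a_1 b_2^{-1} a_1 b_1 a_2 b_2 a_1 b_1 b_2^{-1}, a_2 b_2^{-1} a_1 b_2 b_1 a_2 b_1 b_2^{-1} a_1 b_2 \rangle$ - $L_{11} = \langle a_1, a_2, b_1, b_2 \mid a_2^2, a_1^2, (a_1 a_2)^2, b_1^2, b_2^3, (b_1 b_2)^2, (a_1 b_1)^4, (a_2 b_2^{-1} a_1 b_2)^2, (a_1 b_2^{-1} a_1 b_1)^2, (a_1 b_2^{-1} a_1 b_2)^2, a_1 b_2 a_2 b_2 a_2 b_2 b_1 a_2 b_1, a_1 b_2 a_2 b_1 a_2 b_2^{-1} a_1 b_1 b_2 \rangle$ For each $i$, let $A_i\le L_i$ be the subgroup generated by the generators $a$ (respectively $a_1,a_2$) and $B_i\le L_i$ the subgroup generated by the generators $b$ (respectively $b_1,b_2$). We let $L_i$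 act on its coset graph with respect to $A_i$ and $B_i$. **Lemma 5.1.** Let $G$ be a group of automorphisms of $Q$ that is regular on the edges. Then the action of $G$ on $Q$ is isomorphic to the action of one of the groups $L_1,\dots,L_{11}$ on its coset graph. Conversely, each of these eleven actions is isomorphic to the action on $Q$ of a group of automorphisms of $Q$ that is regular on the edges. Furthermore, these eleven actions are pairwise non-isomorphic. -/

import Mathlib

/-- The bipartite graph on points `P` and lines `L` of an incidence relation. -/
def incidenceGraph {P L : Type*} (I : P → L → Prop) : SimpleGraph (P ⊕ L) where
  Adj
    | Sum.inl p, Sum.inr l => I p l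
    | Sum.inr l, Sum.inl p => I p l
    | _, _ => False
  symm := ⟨by rintro (p | l) (q | m) h <;> exact h⟩
  loopless := ⟨by rintro (p | l) h <;> exact h⟩

/-- An action of `G` on a graph, i.e. a homomorphism from `G` to its automorphism group, is
regular on edges: for any two edges exactly one group element maps the first to the second. -/
def IsEdgeRegular {G X : Type*} [Group G] {Γ : SimpleGraph X} (ρ : G →* (Γ ≃g Γ)) : Prop :=
  ∀ e f : Γ.edgeSet, ∃! g : G, (ρ g).mapEdgeSet e = f

/-- Isomorphism of two group actions on graphs: a group isomorphism together with an equivariant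
graph isomorphism. -/
def ActionIso {G H X Y : Type*} [Group G] [Group H] {Γ : SimpleGraph X} {Δ : SimpleGraph Y}
    (ρ : G →* (Γ ≃g Γ)) (σ : H →* (Δ ≃g Δ)) : Prop :=
  ∃ (φ : G ≃* H) (ψ : Γ ≃g Δ), ∀ (g : G) (x : X), ψ (ρ g x) = σ (φ g) (ψ x)

/-- The coset graph of a group `V` with respect to subgroups `E` and `F`: its vertices are the
left cosets of `E` and of `F`, its edges are the pairs `{vE, vF}` with `v ∈ V`. -/
def cosetGraph {V : Type*} [Group V] (E F : Subgroup V) : SimpleGraph ((V ⧸ E) ⊕ (V ⧸ F)) :=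
  incidenceGraph fun (x : V ⧸ E) (y : V ⧸ F) =>
    ∃ v : V, (QuotientGroup.mk v : V ⧸ E) = x ∧ (QuotientGroup.mk v : V ⧸ F) = y

theorem coset_incident_smul {V : Type*} [Group V] {E F : Subgroup V} (v : V) (x : V ⧸ E)
    (y : V ⧸ F)
    (h : ∃ w : V, (QuotientGroup.mk w : V ⧸ E) = x ∧ (QuotientGroup.mk w : V ⧸ F) = y) :
    ∃ w : V, (QuotientGroup.mk w : V ⧸ E) = v • x ∧ (QuotientGroup.mk w : V ⧸ F) = v • y := by
  obtain ⟨w, rfl, rfl⟩ := h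
  exact ⟨v * w, rfl, rfl⟩

theorem coset_incident_smul_iff {V : Type*} [Group V] {E F : Subgroup V} (v : V) (x : V ⧸ E)
    (y : V ⧸ F) :
    (∃ w : V, (QuotientGroup.mk w : V ⧸ E) = v • x ∧ (QuotientGroup.mk w : V ⧸ F) = v • y) ↔
    ∃ w : V, (QuotientGroup.mk w : V ⧸ E) = x ∧ (QuotientGroup.mk w : V ⧸ F) = y := by
  refine ⟨fun h => ?_, coset_incident_smul v x y⟩
  have h' := coset_incident_smul v⁻¹ _ _ h
  rwa [inv_smul_smul, inv_smul_smul] at h'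

/-- The action of `V` on its coset graph by left multiplication. -/
def cosetAction {V : Type*} [Group V] (E F : Subgroup V) :
    V →* (cosetGraph E F ≃g cosetGraph E F) where
  toFun v :=
    { toEquiv := Equiv.sumCongr (MulAction.toPerm v) (MulAction.toPerm v)
      map_rel_iff' := by
        rintro (x | x) (y | y)
        · exact Iff.rfl
        · exact coset_incident_smul_iff v x y
        · exact coset_incident_smul_iff v y x
        · exact Iff.rfl }
  map_one' := by
    apply RelIso.ext
    rintro (x | x)
    · exact congrArg Sum.inl (one_smul V x)
    · exact congrArg Sum.inr (one_smul V x)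
  map_mul' v w := by
    apply RelIso.ext
    rintro (x | x)
    · exact congrArg Sum.inl (mul_smul v w x)
    · exact congrArg Sum.inr (mul_smul v w x)

/-- The matrix `M(x, y, z)`. -/
def slantedMatrix {F : Type*} [Field F] (x y z : F) :
    Matrix.SpecialLinearGroup (Fin 4) F :=
  ⟨!![1, -x, y, z; 0, 1, 0, y; 0, 0, 1, x; 0, 0, 0, 1], by
    simp [Matrix.det_succ_row_zero, Fin.sum_univ_succ]⟩

theorem slantedMatrix_mul {F : Type*} [Field F] (x y z x' y' z' : F) :
    slantedMatrix x y z * slantedMatrix x' y' z' =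
      slantedMatrix (x + x') (y + y') (z + z' - x * y' + y * x') := by
  apply Subtype.ext
  rw [Matrix.SpecialLinearGroup.coe_mul]
  change !![1, -x, y, z; 0, 1, 0, y; 0, 0, 1, x; 0, 0, 0, 1] *
    !![1, -x', y', z'; 0, 1, 0, y'; 0, 0, 1, x'; 0, 0, 0, 1] =
    !![1, -(x + x'), y + y', z + z' - x * y' + y * x'; 0, 1, 0, y + y'; 0, 0, 1, x + x';
      0, 0, 0, 1]
  ext i j
  fin_cases i <;> fin_cases j <;> simp [Matrix.mul_apply, Fin.sum_univ_succ] <;> ring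

theorem slantedMatrix_zero {F : Type*} [Field F] :
    slantedMatrix (0 : F) 0 0 = 1 := by
  ext i j
  fin_cases i <;> fin_cases j <;> simp [slantedMatrix]

/-- The group `S` of all matrices `M(x, y, z)`. -/
def slantedGroup (F : Type*) [Field F] : Subgroup (Matrix.SpecialLinearGroup (Fin 4) F) where
  carrier := {A | ∃ x y z : F, A = slantedMatrix x y z}
  mul_mem' := by
    rintro _ _ ⟨x, y, z, rfl⟩ ⟨x', y', z', rfl⟩
    exact ⟨_, _, _, slantedMatrix_mul x y z x' y' z'⟩
  one_mem' := ⟨0, 0, 0, slantedMatrix_zero.symm⟩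
  inv_mem' := by
    rintro _ ⟨x, y, z, rfl⟩
    refine ⟨-x, -y, -z, inv_eq_of_mul_eq_one_right ?_⟩
    rw [slantedMatrix_mul, ← slantedMatrix_zero]
    congr 1 <;> ring

/-- The subgroup `X₀` of `S`, as a set of matrices. -/
def slantedX0 (F : Type*) [Field F] : Set (Matrix.SpecialLinearGroup (Fin 4) F) :=
  {A | ∃ μ : F, A = slantedMatrix 0 0 μ}

/-- The subgroup `X_[a:b]` of `S`, as a set of matrices. -/
def slantedX {F : Type*} [Field F] (a b : F) : Set (Matrix.SpecialLinearGroup (Fin 4) F) :=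
  {A | ∃ μ : F, A = slantedMatrix (μ * a) (μ * b) 0}

/-- A set of matrices is a line of the slanted symplectic quadrangle over `F` if it is a left
coset in `S` of `X₀` or of some `X_[a:b]`, where `[a:b]` is a point of the projective line. -/
def IsSlantedLine {F : Type*} [Field F] (l : Set (Matrix.SpecialLinearGroup (Fin 4) F)) : Prop :=
  ∃ g ∈ slantedGroup F, l = (fun A => g * A) '' slantedX0 F ∨
    ∃ a b : F, (a, b) ≠ (0, 0) ∧ l = (fun A => g * A) '' slantedX a b

/-- The incidence graph of the slanted symplectic quadrangle over `F`: points are the elements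
of `S`, lines are the cosets above, incidence is membership. -/
def slantedQuadrangle (F : Type*) [Field F] :
    SimpleGraph (slantedGroup F ⊕
      {l : Set (Matrix.SpecialLinearGroup (Fin 4) F) // IsSlantedLine l}) :=
  incidenceGraph fun p l => (p : Matrix.SpecialLinearGroup (Fin 4) F) ∈ l.1

/-- The generalized quadrangle `Q` of order `(3, 5)`, as its incidence graph: the slanted
symplectic quadrangle over the field with four elements. -/
noncomputable abbrev quadrangleQ := slantedQuadrangle (GaloisField 2 2)

/-- A group presentation whose generators are split into two families: `numA` generators
`a₁, a₂, …` (written `a` if there is only one) and `numB` generators `b₁, b₂, …`. -/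
structure EdgePresentation where
  numA : ℕ
  numB : ℕ
  rels : Set (FreeGroup (Fin numA ⊕ Fin numB))

/-- The presented group. -/
abbrev EdgePresentation.Grp (P : EdgePresentation) : Type := PresentedGroup P.rels

/-- The subgroup generated by the generators `aⱼ`. -/
def EdgePresentation.subA (P : EdgePresentation) : Subgroup P.Grp :=
  Subgroup.closure (Set.range fun j => PresentedGroup.of (Sum.inl j))

/-- The subgroup generated by the generators `bⱼ`. -/
def EdgePresentation.subB (P : EdgePresentation) : Subgroup P.Grp :=
  Subgroup.closure (Set.range fun j => PresentedGroup.of (Sum.inr j))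

/-- The action of the presented group on its coset graph with respect to the subgroups generated
by the `aⱼ` and by the `bⱼ`. -/
def EdgePresentation.action (P : EdgePresentation) :
    P.Grp →* (cosetGraph P.subA P.subB ≃g cosetGraph P.subA P.subB) :=
  cosetAction P.subA P.subB

def presL1 : EdgePresentation where
  numA := 1
  numB := 1
  rels :=
    let a : FreeGroup (Fin 1 ⊕ Fin 1) := FreeGroup.of (Sum.inl 0)
    let b : FreeGroup (Fin 1 ⊕ Fin 1) := FreeGroup.of (Sum.inr 0)
    { a^4,
      b^6,
      a * b⁻¹ * a⁻¹ * b^2 * a⁻¹ * b * a^(-2 : ℤ) * b,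
      a * b * a^(-2 : ℤ) * b⁻¹ * a⁻¹ * b * a^(-2 : ℤ) * b⁻¹,
      a * b * a * b⁻¹ * a * b^(-2 : ℤ) * a⁻¹ * b^2 }

def presL2 : EdgePresentation where
  numA := 2
  numB := 2
  rels :=
    let a₁ : FreeGroup (Fin 2 ⊕ Fin 2) := FreeGroup.of (Sum.inl 0)
    let a₂ : FreeGroup (Fin 2 ⊕ Fin 2) := FreeGroup.of (Sum.inl 1)
    let b₁ : FreeGroup (Fin 2 ⊕ Fin 2) := FreeGroup.of (Sum.inr 0)
    let b₂ : FreeGroup (Fin 2 ⊕ Fin 2) := FreeGroup.of (Sum.inr 1)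
    { a₁^2,
      a₂^2,
      (a₁ * a₂)^2,
      b₁^2,
      b₂^3,
      (b₁ * b₂)^2,
      a₂ * b₂ * a₁ * b₂⁻¹ * a₂ * b₂⁻¹ * a₁ * b₂,
      (a₁ * b₂⁻¹ * a₁ * b₂)^2,
      a₂ * b₂ * a₂ * b₁ * a₁ * b₂⁻¹ * a₁ * b₁,
      a₁ * a₂ * b₂ * a₁ * b₂ * b₁ * a₂ * b₂ * a₁ * b₁,
      a₁ * b₂ * b₁ * (a₁ * b₁ * b₂⁻¹)^3 }

def presL3 : EdgePresentation where
  numA := 2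
  numB := 1
  rels :=
    let a₁ : FreeGroup (Fin 2 ⊕ Fin 1) := FreeGroup.of (Sum.inl 0)
    let a₂ : FreeGroup (Fin 2 ⊕ Fin 1) := FreeGroup.of (Sum.inl 1)
    let b : FreeGroup (Fin 2 ⊕ Fin 1) := FreeGroup.of (Sum.inr 0)
    { a₁^2,
      a₂^2,
      (a₁ * a₂)^2,
      b^6,
      a₁ * b * a₂ * b * a₂ * b⁻¹ * a₂ * b⁻¹,
      a₂ * b⁻¹ * a₂ * b * a₂ * b * a₁ * b⁻¹,
      (a₁ * b)^4,
      a₁ * b * a₂ * b^(-2 : ℤ) * a₁ * b^(-2 : ℤ) * a₂ * b }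

def presL4 : EdgePresentation where
  numA := 2
  numB := 2
  rels :=
    let a₁ : FreeGroup (Fin 2 ⊕ Fin 2) := FreeGroup.of (Sum.inl 0)
    let a₂ : FreeGroup (Fin 2 ⊕ Fin 2) := FreeGroup.of (Sum.inl 1)
    let b₁ : FreeGroup (Fin 2 ⊕ Fin 2) := FreeGroup.of (Sum.inr 0)
    let b₂ : FreeGroup (Fin 2 ⊕ Fin 2) := FreeGroup.of (Sum.inr 1)
    { a₁^2,
      a₂^2,
      (a₁ * a₂)^2,
      b₁^2,
      b₂^3,
      (b₁ * b₂)^2,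
      (a₂ * b₁ * a₁ * b₁)^2,
      (a₁ * b₁)^4,
      a₂ * b₂ * a₂ * b₁ * a₁ * b₂⁻¹ * a₁ * b₁,
      (a₁ * b₂⁻¹ * a₁ * b₂)^2,
      a₂ * b₂ * a₁ * b₂⁻¹ * a₂ * a₁ * b₂ * a₁ * b₂⁻¹,
      a₁ * b₂⁻¹ * a₂ * b₁ * b₂ * a₂ * b₂ * a₁ * b₁ * b₂,
      a₁ * b₂ * a₂ * b₁ * b₂⁻¹ * a₂ * b₂⁻¹ * a₁ * b₂ * b₁ }

def presL5 : EdgePresentation where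
  numA := 2
  numB := 1
  rels :=
    let a₁ : FreeGroup (Fin 2 ⊕ Fin 1) := FreeGroup.of (Sum.inl 0)
    let a₂ : FreeGroup (Fin 2 ⊕ Fin 1) := FreeGroup.of (Sum.inl 1)
    let b : FreeGroup (Fin 2 ⊕ Fin 1) := FreeGroup.of (Sum.inr 0)
    { a₁^2,
      a₂^2,
      (a₁ * a₂)^2,
      b^6,
      (a₂ * b)^4,
      (a₂ * b * a₁ * b)^2,
      (a₁ * b)^4,
      a₂ * b⁻¹ * a₁ * b^2 * a₂ * b * a₁ * b^(-2 : ℤ),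
      a₂ * b^2 * a₁ * b^(-2 : ℤ) * a₂ * b * a₂ * b⁻¹ }

def presL6 : EdgePresentation where
  numA := 1
  numB := 2
  rels :=
    let a : FreeGroup (Fin 1 ⊕ Fin 2) := FreeGroup.of (Sum.inl 0)
    let b₁ : FreeGroup (Fin 1 ⊕ Fin 2) := FreeGroup.of (Sum.inr 0)
    let b₂ : FreeGroup (Fin 1 ⊕ Fin 2) := FreeGroup.of (Sum.inr 1)
    { a^4,
      b₁^2,
      b₂^3,
      (b₁ * b₂⁻¹)^2,
      (a * b₂⁻¹ * a * b₁)^2,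
      a * b₁ * a⁻¹ * b₁ * a * b₁ * a⁻¹ * b₁ * b₂⁻¹,
      a⁻¹ * b₂⁻¹ * a * b₂⁻¹ * a⁻¹ * b₁ * a⁻¹ * b₁ * b₂ }

def presL7 : EdgePresentation where
  numA := 2
  numB := 1
  rels :=
    let a₁ : FreeGroup (Fin 2 ⊕ Fin 1) := FreeGroup.of (Sum.inl 0)
    let a₂ : FreeGroup (Fin 2 ⊕ Fin 1) := FreeGroup.of (Sum.inl 1)
    let b : FreeGroup (Fin 2 ⊕ Fin 1) := FreeGroup.of (Sum.inr 0)
    { a₁^2,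
      a₂^2,
      (a₁ * a₂)^2,
      b^6,
      (a₂ * b * a₂ * b⁻¹)^2,
      (a₁ * b * a₂ * b⁻¹)^2,
      (a₂ * b * a₁ * b⁻¹)^2,
      (a₁ * b * a₁ * b⁻¹)^2,
      a₁ * b * a₂ * b * a₁ * b^2 * a₂ * b^2,
      (a₁ * b * a₁ * b^2)^2,
      a₂ * b * a₂ * b * a₁ * a₂ * b * a₁ * b^3 }

def presL8 : EdgePresentation where
  numA := 2
  numB := 1
  rels :=
    let a₁ : FreeGroup (Fin 2 ⊕ Fin 1) := FreeGroup.of (Sum.inl 0)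
    let a₂ : FreeGroup (Fin 2 ⊕ Fin 1) := FreeGroup.of (Sum.inl 1)
    let b : FreeGroup (Fin 2 ⊕ Fin 1) := FreeGroup.of (Sum.inr 0)
    { a₁^2,
      a₂^2,
      (a₁ * a₂)^2,
      b^6,
      (b * a₁ * b⁻¹ * a₂)^2,
      a₂ * b * a₁ * a₂ * b * a₂ * b⁻¹ * a₂ * b⁻¹,
      a₁ * b^2 * a₂ * b * a₂ * b^2 * a₁ * b }

def presL9 : EdgePresentation where
  numA := 1
  numB := 2
  rels :=
    let a : FreeGroup (Fin 1 ⊕ Fin 2) := FreeGroup.of (Sum.inl 0)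
    let b₁ : FreeGroup (Fin 1 ⊕ Fin 2) := FreeGroup.of (Sum.inr 0)
    let b₂ : FreeGroup (Fin 1 ⊕ Fin 2) := FreeGroup.of (Sum.inr 1)
    { a^4,
      b₁^2,
      b₂^3,
      (b₁ * b₂)^2,
      (a * b₂)^4,
      a * b₂⁻¹ * a * b₁ * a⁻¹ * b₂ * a⁻¹ * b₁ * b₂,
      a * b₁ * a * b₁ * b₂ * a * b₂⁻¹ * a⁻¹ * b₂⁻¹,
      a * b₁ * b₂ * a * b₁ * a * b₂ * a⁻¹ * b₂,
      a * b₂ * a * b₁ * a * b₁ * a^2 * b₂ * b₁ }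

def presL10 : EdgePresentation where
  numA := 2
  numB := 2
  rels :=
    let a₁ : FreeGroup (Fin 2 ⊕ Fin 2) := FreeGroup.of (Sum.inl 0)
    let a₂ : FreeGroup (Fin 2 ⊕ Fin 2) := FreeGroup.of (Sum.inl 1)
    let b₁ : FreeGroup (Fin 2 ⊕ Fin 2) := FreeGroup.of (Sum.inr 0)
    let b₂ : FreeGroup (Fin 2 ⊕ Fin 2) := FreeGroup.of (Sum.inr 1)
    { a₁^2,
      a₂^2,
      (a₁ * a₂)^2,
      b₁^2,
      b₂^3,
      (b₁ * b₂)^2,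
      (a₁ * b₂⁻¹ * a₁ * b₂)^2,
      a₂ * b₂⁻¹ * a₁ * b₁ * a₁ * b₂ * a₂ * b₂ * b₁,
      a₂ * a₁ * b₂⁻¹ * a₁ * b₁ * a₂ * b₂ * a₁ * b₁ * b₂⁻¹,
      a₂ * b₂⁻¹ * a₁ * b₂ * b₁ * a₂ * b₁ * b₂⁻¹ * a₁ * b₂ }

def presL11 : EdgePresentation where
  numA := 2
  numB := 2
  rels :=
    let a₁ : FreeGroup (Fin 2 ⊕ Fin 2) := FreeGroup.of (Sum.inl 0)
    let a₂ : FreeGroup (Fin 2 ⊕ Fin 2) := FreeGroup.of (Sum.inl 1)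
    let b₁ : FreeGroup (Fin 2 ⊕ Fin 2) := FreeGroup.of (Sum.inr 0)
    let b₂ : FreeGroup (Fin 2 ⊕ Fin 2) := FreeGroup.of (Sum.inr 1)
    { a₂^2,
      a₁^2,
      (a₁ * a₂)^2,
      b₁^2,
      b₂^3,
      (b₁ * b₂)^2,
      (a₁ * b₁)^4,
      (a₂ * b₂⁻¹ * a₁ * b₂)^2,
      (a₁ * b₂⁻¹ * a₁ * b₁)^2,
      (a₁ * b₂⁻¹ * a₁ * b₂)^2,
      a₁ * b₂ * a₂ * b₂ * a₂ * b₂ * b₁ * a₂ * b₁,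
      a₁ * b₂ * a₂ * b₁ * a₂ * b₂⁻¹ * a₁ * b₁ * b₂ }

/-- The family `L₁, …, L₁₁`; the index `i : Fin 11` stands for `L_{i+1}`. -/
def presL : Fin 11 → EdgePresentation :=
  ![presL1, presL2, presL3, presL4, presL5, presL6, presL7, presL8, presL9, presL10, presL11]

/-! In characteristic 2 the substitution `z = t + x * y` turns the group `S` into an elementary
abelian group of order 64. Thus `Q` has the vectors of `𝔽₂⁶` as points and the cosets of six
subgroups of order four, pairwise meeting trivially, as lines. All work is done in this model;
`nonempty_iso_quadrangleQ` carries the result over to `Q`. Points lie on six lines and lines have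
four points, so automorphisms do not mix the two types, and there are 64 · 6 = 384 edges. In an
edge-regular group the stabilizer of a point has order six and the stabilizer of a line has order
four.

Control over all automorphisms comes from rigidity (`eq_one_of_fixes`): an automorphism that fixes
the point `0`, the six lines through it and one further point is trivial. Hence the stabilizer of
`0` maps onto the symmetric group of the six lines (`exists_acts_perm`), with a kernel of three
"scalars" (`Acts.exists_scalar`).

Every `Lᵢ` occurs: explicit automorphisms satisfy its relators, so `Lᵢ` acts on the model, and its
subgroups `Aᵢ` and `Bᵢ` act transitively on the points of a base line and on the lines through the
base point `0`. As collinearity connects all points, the action is transitive on edges. A certified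
Todd–Coxeter enumeration bounds the order of `Lᵢ` by 64 · 6 = 384 (`finite_card_le`), so the action
is regular, `Aᵢ` and `Bᵢ` are the full stabilizers, and the action is the one on the coset graph
(`regular_of_card_le`).

The eleven actions differ: an isomorphism between two of them can be adjusted to an automorphism of
the model that fixes the base edge. It conjugates the generators of `Lᵢ` into the small stabilizers
`Aⱼ` and `Bⱼ`, and for `i ≠ j` no choice of elements there satisfies the relators of `Lᵢ`
(`eq_of_actionIso`).

There are no other groups: the stabilizer of `0` in a regular group is cyclic or symmetric of order
six and permutes the six lines regularly. Up to conjugation its generators are therefore known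
automorphisms, with one case for each isomorphism type (`exists_conj_stabPoint`). The stabilizer of
the base line is regular on four points, hence it is generated by an element of order four or by two
involutions, taken from finite lists of candidates. For each candidate a certificate gives either a
nontrivial word that fixes the base edge, which contradicts regularity, or elements of the group
that satisfy the relators of some `Lᵢ` (`exists_actionIso`).

The numerical tables and certificates are data without any assumed meaning; what is used about them
is verified by evaluation. -/

namespace Quadrangle

/-! ### A binary model of the quadrangle

Points are the numbers below `64`, i.e. the vectors of `𝔽₂⁶`, with addition `^^^`. There are six
directions `D₀, …, D₅`, subgroups of order four which intersect pairwise trivially, and the lines are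
their cosets. Tables are stored as digits of natural numbers so that the kernel can evaluate them
quickly. -/

/-- The entry at position `p` of a table with entries below `64`. -/
def ap (T p : ℕ) : ℕ := (T >>> (6 * p)) &&& 63

/-- The direction of a nonzero vector, `6` for vectors that lie in no direction, and `7` for `0`. -/
def dirOf (v : ℕ) : ℕ :=
  (5368041022454074213145287080801988704937828378470770221647 >>> (3 * v)) &&& 7

/-- The index of the line through the point `p` in direction `d` among the lines of this
direction. -/
def lineIdx (d p : ℕ) : ℕ :=
  (329586517244524075630232581239456220704169303648300001538636362480024741585537530971436925818289195641079443929524880780047560902468254077723035558094394043676005088352519771338920209331186458262373076071283943157214403512235545090597157033241661525274761768130822297788751267727365598998243601273379251249761452583588906777291310690347594275948868918251839091858160551607453127693811275740671649398232696785684611901220597791540021246666834138182099079628337680 >>> (256 * d + 4 * p)) &&& 15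

/-- A point on the line of direction `d` and index `k`. -/
def linePt (d k : ℕ) : ℕ := ap
  58825875281081048161530455995387671940509577657036187172221404336138960207462421466683619755790223754602289263275561040156501307367731753856662415685627872891065635449872448 (16 * d + k)

/-- Incidence of points and lines in the model. -/
def ModelInc (p : Fin 64) (l : Fin 6 × Fin 16) : Prop := lineIdx l.1 p = l.2

/-- The incidence graph of the model. -/
abbrev model : SimpleGraph (Fin 64 ⊕ Fin 6 × Fin 16) := incidenceGraph ModelInc

/-- The automorphism group of the model. -/
abbrev ModelAut := model ≃g model

theorem ap_lt (T p : ℕ) : ap T p < 64 := by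
  unfold ap
  exact lt_of_le_of_lt Nat.and_le_right (by norm_num)

theorem lineIdx_lt (d p : ℕ) : lineIdx d p < 16 := by
  unfold lineIdx
  exact lt_of_le_of_lt Nat.and_le_right (by norm_num)

/-- Checking a property of all numbers below `n`. -/
theorem forall_lt_of_all {n : ℕ} {f : ℕ → Bool} (h : (List.range n).all f = true) :
    ∀ i < n, f i = true := fun i hi => List.all_eq_true.1 h i (List.mem_range.2 hi)

/-- This single evaluation ties `lineIdx` to `dirOf`: it certifies that the fibres of `lineIdx d`
are the cosets of one subgroup, so neither table has to be trusted. -/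
theorem lineIdx_check : (List.range 6).all (fun d => (List.range 64).all fun p =>
    (List.range 64).all fun q =>
      Nat.beq (lineIdx d p) (lineIdx d q) == (Nat.beq p q || Nat.beq (dirOf (p ^^^ q)) d)) = true := by
  decide +kernel

theorem lineIdx_eq_iff {d p q : ℕ} (hd : d < 6) (hp : p < 64) (hq : q < 64) :
    lineIdx d p = lineIdx d q ↔ p = q ∨ dirOf (p ^^^ q) = d := by
  have h := forall_lt_of_all (forall_lt_of_all (forall_lt_of_all lineIdx_check d hd) p hp) q hq
  simp only [beq_iff_eq] at h
  rw [← Nat.beq_eq, h, Bool.or_eq_true, Nat.beq_eq, Nat.beq_eq]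

/-- The line through `p` in direction `d`. -/
def lineThrough (d : Fin 6) (p : Fin 64) : Fin 6 × Fin 16 := (d, ⟨lineIdx d p, lineIdx_lt _ _⟩)

theorem modelInc_iff {p : Fin 64} {l : Fin 6 × Fin 16} :
    ModelInc p l ↔ l = lineThrough l.1 p := by
  obtain ⟨d, k⟩ := l
  simp [ModelInc, lineThrough, Fin.ext_iff, eq_comm]

theorem modelInc_lineThrough (d : Fin 6) (p : Fin 64) : ModelInc p (lineThrough d p) := rfl

theorem lineThrough_eq_iff {d : Fin 6} {p q : Fin 64} :
    lineThrough d p = lineThrough d q ↔ p = q ∨ dirOf (p ^^^ q) = d := by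
  rw [← Fin.val_inj (a := p), ← lineIdx_eq_iff d.2 p.2 q.2]
  simp [lineThrough]

/-- A nonzero difference `p ^^^ q` has only one direction, and direction and point determine the
line. -/
theorem modelInc_line_unique {p q : Fin 64} (h : p ≠ q) {l m : Fin 6 × Fin 16} (h1 : ModelInc p l)
    (h2 : ModelInc q l) (h3 : ModelInc p m) (h4 : ModelInc q m) : l = m := by
  rw [modelInc_iff] at h1 h2 h3 h4
  have a := lineThrough_eq_iff.1 (h1.symm.trans h2)
  have b := lineThrough_eq_iff.1 (h3.symm.trans h4)
  simp only [h, false_or] at a b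
  have : l.1 = m.1 := Fin.ext (a.symm.trans b)
  rw [h1, h3, this]

theorem card_points_check : (List.range 6).all (fun d => (List.range 16).all fun k =>
    Nat.beq ((List.range 64).countP fun p => Nat.beq (lineIdx d p) k) 4) = true := by
  decide +kernel

instance (p : Fin 64) (l : Fin 6 × Fin 16) : Decidable (ModelInc p l) :=
  inferInstanceAs (Decidable (_ = _))

theorem card_points (l : Fin 6 × Fin 16) : Fintype.card {p : Fin 64 // ModelInc p l} = 4 := by
  obtain ⟨d, k⟩ := l
  have h := Nat.eq_of_beq_eq_true
    (forall_lt_of_all (forall_lt_of_all card_points_check d d.2) k k.2)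
  rw [Fintype.card_subtype, ← h, List.countP_eq_length_filter, ← List.toFinset_card_of_nodup
    (List.nodup_range.filter _)]
  refine Finset.card_bij (fun (p : Fin 64) _ => (p : ℕ)) ?_ ?_ ?_
  · intro p hp
    have hp' : lineIdx d p = k := (Finset.mem_filter.1 hp).2
    simp [hp']
  · intro p _ q _ h
    exact Fin.ext h
  · intro p hp
    simp only [List.mem_toFinset, List.mem_filter, List.mem_range, Nat.beq_eq] at hp
    exact ⟨⟨p, hp.1⟩, Finset.mem_filter.2 ⟨Finset.mem_univ _, hp.2⟩, rfl⟩

/-- If a point went to a line `l`, then the six lines through the point would go to six different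
points of `l`, which has only four. -/
theorem exists_map_inl (g : ModelAut) (p : Fin 64) : ∃ q, g (Sum.inl p) = Sum.inl q := by
  rcases h : g (Sum.inl p) with q | l
  · exact ⟨q, rfl⟩
  · exfalso
    have key : ∀ d : Fin 6, ∃ q : Fin 64, g (Sum.inr (lineThrough d p)) = Sum.inl q ∧
        ModelInc q l := by
      intro d
      have hadj : model.Adj (g (Sum.inl p)) (g (Sum.inr (lineThrough d p))) :=
        g.map_rel_iff.2 (modelInc_lineThrough d p)
      rw [h] at hadj
      rcases h' : g (Sum.inr (lineThrough d p)) with q | m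
      · rw [h'] at hadj
        exact ⟨q, rfl, hadj⟩
      · rw [h'] at hadj
        exact hadj.elim
    choose f hf hl using key
    have hinj : Function.Injective (fun d => (⟨f d, hl d⟩ : {q : Fin 64 // ModelInc q l})) := by
      intro d e hde
      have h1 : f d = f e := congrArg Subtype.val hde
      have h2 := g.injective ((hf d).trans ((congrArg Sum.inl h1).trans (hf e).symm))
      exact congrArg Prod.fst (Sum.inr.inj h2)
    have := Fintype.card_le_of_injective _ hinj
    rw [card_points, Fintype.card_fin] at this
    omega

/-- The action of an automorphism on points. -/
noncomputable def pt (g : ModelAut) (p : Fin 64) : Fin 64 := (exists_map_inl g p).choose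

theorem apply_inl (g : ModelAut) (p : Fin 64) : g (Sum.inl p) = Sum.inl (pt g p) :=
  (exists_map_inl g p).choose_spec

theorem pt_mul (g h : ModelAut) (p : Fin 64) : pt (g * h) p = pt g (pt h p) := by
  apply Sum.inl_injective (β := Fin 6 × Fin 16)
  rw [← apply_inl, ← apply_inl, ← apply_inl]
  rfl

theorem pt_one (p : Fin 64) : pt 1 p = p := by
  apply Sum.inl_injective (β := Fin 6 × Fin 16)
  rw [← apply_inl]
  rfl

theorem pt_inv_pt (g : ModelAut) (p : Fin 64) : pt g⁻¹ (pt g p) = p := by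
  rw [← pt_mul, inv_mul_cancel, pt_one]

theorem pt_pt_inv (g : ModelAut) (p : Fin 64) : pt g (pt g⁻¹ p) = p := by
  rw [← pt_mul, mul_inv_cancel, pt_one]

theorem pt_injective (g : ModelAut) : Function.Injective (pt g) :=
  Function.LeftInverse.injective (pt_inv_pt g)

theorem exists_map_inr (g : ModelAut) (l : Fin 6 × Fin 16) : ∃ m, g (Sum.inr l) = Sum.inr m := by
  rcases h : g (Sum.inr l) with q | m
  · exfalso
    have h1 := apply_inl g⁻¹ q
    rw [← h] at h1
    have h2 : g⁻¹ (g (Sum.inr l)) = Sum.inr l := g.symm_apply_apply _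
    rw [h2] at h1
    cases h1
  · exact ⟨m, rfl⟩

/-- The action of an automorphism on lines. -/
noncomputable def ln (g : ModelAut) (l : Fin 6 × Fin 16) : Fin 6 × Fin 16 :=
  (exists_map_inr g l).choose

theorem apply_inr (g : ModelAut) (l : Fin 6 × Fin 16) : g (Sum.inr l) = Sum.inr (ln g l) :=
  (exists_map_inr g l).choose_spec

theorem ln_mul (g h : ModelAut) (l : Fin 6 × Fin 16) : ln (g * h) l = ln g (ln h l) := by
  apply Sum.inr_injective (α := Fin 64)
  rw [← apply_inr, ← apply_inr, ← apply_inr]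
  rfl

theorem ln_one (l : Fin 6 × Fin 16) : ln 1 l = l := by
  apply Sum.inr_injective (α := Fin 64)
  rw [← apply_inr]
  rfl

theorem ln_inv_ln (g : ModelAut) (l : Fin 6 × Fin 16) : ln g⁻¹ (ln g l) = l := by
  rw [← ln_mul, inv_mul_cancel, ln_one]

theorem ln_injective (g : ModelAut) : Function.Injective (ln g) :=
  Function.LeftInverse.injective (ln_inv_ln g)

theorem modelInc_map_iff (g : ModelAut) (p : Fin 64) (l : Fin 6 × Fin 16) :
    ModelInc (pt g p) (ln g l) ↔ ModelInc p l := by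
  have h : model.Adj (g (Sum.inl p)) (g (Sum.inr l)) ↔ model.Adj (Sum.inl p) (Sum.inr l) :=
    g.map_rel_iff
  rwa [apply_inl, apply_inr] at h

theorem exists_ne_on_line (l : Fin 6 × Fin 16) : ∃ p q, p ≠ q ∧ ModelInc p l ∧ ModelInc q l := by
  have h : 1 < Fintype.card {p : Fin 64 // ModelInc p l} := by rw [card_points]; norm_num
  obtain ⟨⟨p, hp⟩, ⟨q, hq⟩, hpq⟩ := Fintype.one_lt_card_iff.1 h
  exact ⟨p, q, fun e => hpq (Subtype.ext e), hp, hq⟩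

/-- A line is determined by two of its points, so the action on points determines the automorphism.
This is why a table of 64 images suffices to describe one. -/
theorem ext_pt {g h : ModelAut} (H : ∀ p, pt g p = pt h p) : g = h := by
  apply RelIso.ext
  rintro (p | l)
  · rw [apply_inl, apply_inl, H]
  · rw [apply_inr, apply_inr]
    obtain ⟨p, q, hpq, hp, hq⟩ := exists_ne_on_line l
    congr 1
    refine modelInc_line_unique (fun e => hpq (pt_injective g e))
      ((modelInc_map_iff g p l).2 hp) ((modelInc_map_iff g q l).2 hq) ?_ ?_
    · rw [H]; exact (modelInc_map_iff h p l).2 hp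
    · rw [H]; exact (modelInc_map_iff h q l).2 hq

/-- The action on lines becomes visible in tables of points: the direction of an image line is the
direction of the difference of the images of two points. -/
theorem ln_lineThrough_fst (g : ModelAut) {p q : Fin 64} {d : Fin 6}
    (h : dirOf (p ^^^ q) = d) (hpq : p ≠ q) :
    dirOf ((pt g p : ℕ) ^^^ pt g q) = (ln g (lineThrough d p)).1 := by
  have hl : lineThrough d p = lineThrough d q := lineThrough_eq_iff.2 (Or.inr h)
  have h1 := modelInc_iff.1 ((modelInc_map_iff g p _).2 (modelInc_lineThrough d p))
  have h2 := modelInc_iff.1 ((modelInc_map_iff g q _).2 (modelInc_lineThrough d q))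
  rw [← hl] at h2
  exact (lineThrough_eq_iff.1 (h1.symm.trans h2)).resolve_left fun e => hpq (pt_injective g e)

theorem dirOf_lt_six_iff (g : ModelAut) {p q : Fin 64} (hpq : p ≠ q) :
    dirOf ((pt g p : ℕ) ^^^ pt g q) < 6 ↔ dirOf ((p : ℕ) ^^^ q) < 6 := by
  constructor
  · intro h
    have h' := ln_lineThrough_fst g⁻¹ (p := pt g p) (q := pt g q) (d := ⟨_, h⟩) rfl
      (fun e => hpq (pt_injective g e))
    rw [pt_inv_pt, pt_inv_pt] at h'
    rw [h']
    exact Fin.is_lt _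
  · intro h
    rw [ln_lineThrough_fst g (p := p) (q := q) (d := ⟨_, h⟩) rfl hpq]
    exact Fin.is_lt _


/-! ### Tables -/

/-- The table of the first `n` values of a function. -/
def tabulate : ℕ → (ℕ → ℕ) → ℕ
  | 0, _ => 0
  | n + 1, f => f n <<< (6 * n) + tabulate n f

theorem tabulate_lt (f : ℕ → ℕ) (hf : ∀ i, f i < 64) (n : ℕ) : tabulate n f < 64 ^ n := by
  induction n with
  | zero => simp [tabulate]
  | succ n ih =>
    rw [tabulate, Nat.shiftLeft_eq, pow_mul, show 2 ^ 6 = 64 by norm_num, pow_succ]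
    have := Nat.mul_le_mul_right (64 ^ n) (Nat.le_of_lt_succ (hf n))
    omega

theorem ap_eq (T p : ℕ) : ap T p = T / 64 ^ p % 64 := by
  rw [ap, Nat.shiftRight_eq_div_pow, pow_mul]
  exact Nat.and_two_pow_sub_one_eq_mod _ 6

/-- The entries are the digits in base 64, and the bound on `f` excludes carries. -/
theorem ap_tabulate (f : ℕ → ℕ) (hf : ∀ i, f i < 64) {n p : ℕ} (hp : p < n) :
    ap (tabulate n f) p = f p := by
  induction n with
  | zero => omega
  | succ n ih =>
    rw [ap_eq, tabulate, Nat.shiftLeft_eq, pow_mul, show 2 ^ 6 = 64 by norm_num]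
    rcases Nat.lt_succ_iff_lt_or_eq.1 hp with h | rfl
    · rw [← ih h, ap_eq]
      obtain ⟨m, rfl⟩ : ∃ m, n = p + 1 + m := ⟨n - (p + 1), by omega⟩
      rw [show f (p + 1 + m) * 64 ^ (p + 1 + m) + tabulate (p + 1 + m) f =
        tabulate (p + 1 + m) f + (f (p + 1 + m) * 64 ^ m * 64) * 64 ^ p by ring,
        Nat.add_mul_div_right _ _ (pow_pos (by norm_num) p), Nat.add_mul_mod_self_right]
    · rw [add_comm, Nat.add_mul_div_right _ _ (pow_pos (by norm_num) p),
        Nat.div_eq_of_lt (tabulate_lt f hf p), zero_add, Nat.mod_eq_of_lt (hf p)]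

/-- Composition of tables of functions on points. -/
def comp (T S : ℕ) : ℕ := tabulate 64 fun p => ap T (ap S p)

theorem ap_comp (T S : ℕ) {p : ℕ} (hp : p < 64) : ap (comp T S) p = ap T (ap S p) :=
  ap_tabulate _ (fun _ => ap_lt _ _) hp

/-- The table of the identity. -/
def idTab : ℕ := tabulate 64 fun p => p &&& 63

theorem ap_idTab {p : ℕ} (hp : p < 64) : ap idTab p = p := by
  rw [idTab, ap_tabulate _ _ hp]
  · rw [show 63 = 2 ^ 6 - 1 by norm_num, Nat.and_two_pow_sub_one_eq_mod, Nat.mod_eq_of_lt hp]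
  · intro i
    exact lt_of_le_of_lt Nat.and_le_right (by norm_num)

/-- The table `T` describes the action of the automorphism `g` on points. -/
def Rep (T : ℕ) (g : ModelAut) : Prop := ∀ p : Fin 64, (pt g p : ℕ) = ap T p

theorem Rep.comp {T S : ℕ} {g h : ModelAut} (hg : Rep T g) (hh : Rep S h) :
    Rep (comp T S) (g * h) := by
  intro p
  rw [pt_mul, hg, hh, ap_comp _ _ p.2]

theorem rep_one : Rep idTab 1 := by
  intro p
  rw [pt_one, ap_idTab p.2]

/-- `T` is a left inverse of `S`. -/
def invCheck (T S : ℕ) : Bool := (List.range 64).all fun p => Nat.beq (ap T (ap S p)) p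

theorem ap_ap_of_invCheck {T S : ℕ} (h : invCheck T S = true) {p : ℕ} (hp : p < 64) :
    ap T (ap S p) = p := Nat.eq_of_beq_eq_true (forall_lt_of_all h p hp)

theorem Rep.inv {T S : ℕ} {g : ModelAut} (hg : Rep S g) (h : invCheck T S = true) :
    Rep T g⁻¹ := by
  intro p
  obtain ⟨q, rfl⟩ : ∃ q, pt g q = p := ⟨_, pt_pt_inv g p⟩
  rw [pt_inv_pt, hg, ap_ap_of_invCheck h q.2]

/-- The table of the inverse permutation. -/
def invTab (T : ℕ) : ℕ :=
  (List.range 64).foldl (fun acc p => acc + p <<< (6 * ap T p)) 0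

/-! ### Automorphisms given by tables -/

/-- A nonzero vector in the direction `d`. -/
def dirPt (d : ℕ) : ℕ := (66191638608 >>> (6 * d)) &&& 63

/-- The table `T` maps lines of direction `d` into lines of direction `e`. -/
def mapsDir (T d e : ℕ) : Bool := Nat.blt e 6 && (List.range 64).all fun p =>
  Nat.beq (lineIdx e (ap T p)) (lineIdx e (ap T (linePt d (lineIdx d p))))

/-- The table `T` maps lines into lines. -/
def mapsLines (T : ℕ) : Bool :=
  -- More is demanded than that lines go to lines: all lines of direction `d` must go to lines of
  -- one direction, which is read off from the images of `0` and of one further point.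
  (List.range 6).all fun d => mapsDir T d (dirOf (ap T 0 ^^^ ap T (dirPt d)))

theorem exists_line_of_mapsLines {T : ℕ} (h : mapsLines T = true) (l : Fin 6 × Fin 16) :
    ∃ m, ∀ p : Fin 64, ModelInc p l → ModelInc ⟨ap T p, ap_lt _ _⟩ m := by
  obtain ⟨d, k⟩ := l
  have h' := forall_lt_of_all h d d.2
  rw [mapsDir, Bool.and_eq_true, Nat.blt_eq] at h'
  refine ⟨lineThrough ⟨_, h'.1⟩ ⟨ap T (linePt d k), ap_lt _ _⟩, fun p hp => ?_⟩
  have := Nat.eq_of_beq_eq_true (forall_lt_of_all h'.2 p p.2)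
  rw [ModelInc] at hp
  simp only [ModelInc, lineThrough]
  rw [this, hp]

/-- Bijectivity needs to be tested on points only: since two points determine a line, the induced
maps on lines are inverse to each other as soon as the maps on points are. -/
theorem exists_rep {T S : ℕ} (hT : mapsLines T = true) (hS : mapsLines S = true)
    (hST : invCheck S T = true) (hTS : invCheck T S = true) : ∃ g, Rep T g := by
  choose F hF using exists_line_of_mapsLines hT
  choose F' hF' using exists_line_of_mapsLines hS
  let f : Fin 64 → Fin 64 := fun p => ⟨ap T p, ap_lt _ _⟩
  let f' : Fin 64 → Fin 64 := fun p => ⟨ap S p, ap_lt _ _⟩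
  have hff : ∀ p, f' (f p) = p := fun p => Fin.ext (ap_ap_of_invCheck hST p.2)
  have hff' : ∀ p, f (f' p) = p := fun p => Fin.ext (ap_ap_of_invCheck hTS p.2)
  have hFF : ∀ l, F' (F l) = l := by
    intro l
    obtain ⟨p, q, hpq, hp, hq⟩ := exists_ne_on_line l
    refine modelInc_line_unique hpq ?_ ?_ hp hq
    · have := hF' _ _ (hF l p hp)
      rwa [show (⟨ap S _, ap_lt _ _⟩ : Fin 64) = p from hff p] at this
    · have := hF' _ _ (hF l q hq)
      rwa [show (⟨ap S _, ap_lt _ _⟩ : Fin 64) = q from hff q] at this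
  have hFF' : ∀ l, F (F' l) = l := by
    intro l
    obtain ⟨p, q, hpq, hp, hq⟩ := exists_ne_on_line l
    refine modelInc_line_unique hpq ?_ ?_ hp hq
    · have := hF _ _ (hF' l p hp)
      rwa [show (⟨ap T _, ap_lt _ _⟩ : Fin 64) = p from hff' p] at this
    · have := hF _ _ (hF' l q hq)
      rwa [show (⟨ap T _, ap_lt _ _⟩ : Fin 64) = q from hff' q] at this
  have hinc : ∀ p l, ModelInc (f p) (F l) ↔ ModelInc p l := by
    refine fun p l => ⟨fun h => ?_, hF l p⟩
    have := hF' _ _ h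
    rwa [hFF, show (⟨ap S _, ap_lt _ _⟩ : Fin 64) = p from hff p] at this
  let g : ModelAut :=
    { toEquiv := Equiv.sumCongr ⟨f, f', hff, hff'⟩ ⟨F, F', hFF, hFF'⟩
      map_rel_iff' := by
        rintro (p | l) (q | m)
        · exact Iff.rfl
        · exact hinc p m
        · exact hinc q l
        · exact Iff.rfl }
  refine ⟨g, fun p => ?_⟩
  have h := apply_inl g p
  have h' : g (Sum.inl p) = Sum.inl (f p) := rfl
  rw [h'] at h
  rw [← Sum.inl_injective h]

/-! ### Rigidity -/

/-- The assignment `x ↦ y` is compatible with the assignments in `asg`. -/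
def consistent (asg : List (ℕ × ℕ)) (x y : ℕ) : Bool :=
  Nat.beq (dirOf x) (dirOf y) &&
    asg.all fun ab => Nat.blt (dirOf (ab.1 ^^^ x)) 6 == Nat.blt (dirOf (ab.2 ^^^ y)) 6

/-- All extensions of the assignments `asg` to the points of a list are the identity. -/
def rigidSearch : List ℕ → List (ℕ × ℕ) → Bool
  | [], asg => asg.all fun ab => Nat.beq ab.1 ab.2
  | x :: xs, asg => (List.range 64).all fun y =>
      !consistent asg x y || rigidSearch xs ((x, y) :: asg)

/-- The branch of the search that follows the true values of `f` is never pruned, because each of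
its assignments is consistent. Hence it reaches a leaf, and there all assignments have been found to
be of the form `x ↦ x`. -/
theorem rigidSearch_sound (f : ℕ → ℕ) (hf : ∀ x < 64, f x < 64)
    (hd : ∀ x < 64, dirOf (f x) = dirOf x)
    (hc : ∀ x < 64, ∀ y < 64, (dirOf (f x ^^^ f y) < 6 ↔ dirOf (x ^^^ y) < 6)) (xs : List ℕ)
    (asg : List (ℕ × ℕ)) (hxs : ∀ x ∈ xs, x < 64) (hasg : ∀ ab ∈ asg, ab.1 < 64 ∧ f ab.1 = ab.2)
    (h : rigidSearch xs asg = true) : (∀ x ∈ xs, f x = x) ∧ ∀ ab ∈ asg, ab.1 = ab.2 := by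
  induction xs generalizing asg with
  | nil =>
    refine ⟨by simp, fun ab hab => ?_⟩
    exact Nat.eq_of_beq_eq_true (List.all_eq_true.1 h ab hab)
  | cons x xs ih =>
    have hx : x < 64 := hxs x (by simp)
    have h' := forall_lt_of_all h (f x) (hf x hx)
    have hcons : consistent asg x (f x) = true := by
      rw [consistent, Bool.and_eq_true, Nat.beq_eq, hd x hx]
      refine ⟨rfl, List.all_eq_true.2 fun ab hab => ?_⟩
      obtain ⟨h1, h2⟩ := hasg ab hab
      rw [beq_iff_eq, Bool.eq_iff_iff, Nat.blt_eq, Nat.blt_eq, ← h2]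
      exact (hc _ h1 x hx).symm
    rw [hcons, Bool.not_true, Bool.false_or] at h'
    obtain ⟨h1, h2⟩ := ih _ (fun y hy => hxs y (by simp [hy])) (by
      rintro ab hab
      rcases List.mem_cons.1 hab with rfl | hab
      · exact ⟨hx, rfl⟩
      · exact hasg ab hab) h'
    refine ⟨fun y hy => ?_, fun ab hab => h2 ab (by simp [hab])⟩
    rcases List.mem_cons.1 hy with rfl | hy
    · exact (h2 (y, f y) (by simp)).symm
    · exact h1 y hy

/-- An ordering of the points other than `0` and `16`. -/
def rigidOrder : List ℕ :=
  [8, 38, 2, 39, 29, 42, 31, 40, 50, 6, 10, 43, 26, 14, 15, 11, 45, 23, 46, 52, 20, 36, 22, 62,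
   44, 54, 33, 18, 53, 9, 57, 49, 35, 25, 19, 34, 5, 17, 28, 63, 37, 51, 60, 56, 59, 13, 24, 7,
   41, 27, 61, 1, 32, 12, 30, 3, 21, 47, 58, 55, 4, 48]

/-- The point `0` needs no initial assignment: collinearity with `0` is encoded in `dirOf x`, which
`consistent` compares directly. So `16 ↦ 16` is the only assignment to start from. -/
theorem rigidSearch_check : rigidSearch rigidOrder [(16, 16)] = true := by decide +kernel

theorem rigidOrder_check : (List.range 64).all (fun p =>
    Nat.beq p 0 || Nat.beq p 16 || rigidOrder.any (Nat.beq p)) = true := by decide +kernel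

theorem rigidOrder_lt : rigidOrder.all (fun p => Nat.blt p 64) = true := by decide +kernel

theorem eq_seven_of_dirOf : (List.range 64).all (fun p =>
    Nat.beq (dirOf (0 ^^^ p)) (dirOf p) && (Nat.beq (dirOf p) 7 == Nat.beq p 0) &&
      Nat.ble (dirOf p) 7) = true := by
  decide +kernel

theorem dirOf_lt_eight (p : ℕ) : dirOf p < 8 := by
  unfold dirOf
  exact lt_of_le_of_lt Nat.and_le_right (by norm_num)

theorem dirOf_eq_seven_iff {p : ℕ} (hp : p < 64) : dirOf p = 7 ↔ p = 0 := by
  have h := forall_lt_of_all eq_seven_of_dirOf p hp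
  simp only [Bool.and_eq_true, beq_iff_eq] at h
  rw [← Nat.beq_eq, h.1.2, Nat.beq_eq]

theorem dirPt_check : (List.range 6).all (fun d => Nat.beq (dirOf (dirPt d)) d) = true := by
  decide +kernel

theorem dirPt_lt (d : ℕ) : dirPt d < 64 := by
  unfold dirPt
  exact lt_of_le_of_lt Nat.and_le_right (by norm_num)

theorem dirOf_dirPt {d : ℕ} (hd : d < 6) : dirOf (dirPt d) = d :=
  Nat.eq_of_beq_eq_true (forall_lt_of_all dirPt_check d hd)

/-- An automorphism fixing `0`, the six lines through `0` and a further point is trivial. -/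
theorem eq_one_of_fixes {g : ModelAut} (h0 : pt g 0 = 0) (h16 : pt g 16 = 16)
    (hd : ∀ d : Fin 6, (ln g (lineThrough d 0)).1 = d) : g = 1 := by
  -- For points collinear with `0` this is the hypothesis on the lines through `0`. The others have
  -- value `6`, except for `0` itself, which alone has value `7`, so their values are preserved as
  -- well.
  have hdir : ∀ p : Fin 64, dirOf (pt g p) = dirOf p := by
    intro p
    by_cases hp : p = 0
    · rw [hp, h0]
    have hne : (0 : Fin 64) ≠ p := Ne.symm hp
    have hxor : ∀ q : Fin 64, ((0 : Fin 64) : ℕ) ^^^ (q : ℕ) = q := fun q => Nat.zero_xor _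
    have hiff := dirOf_lt_six_iff g hne
    rw [h0, hxor, hxor] at hiff
    by_cases h6 : dirOf p < 6
    · have := ln_lineThrough_fst g (p := 0) (q := p) (d := ⟨_, h6⟩)
        (by rw [hxor]) hne
      rw [h0, hxor, hd] at this
      exact this
    · have h6' : ¬ dirOf (pt g p) < 6 := fun h => h6 (hiff.1 h)
      have hp0 : pt g p ≠ 0 := fun h => hp (pt_injective g (h.trans h0.symm))
      have h7 : dirOf p ≠ 7 := fun h => hp (Fin.ext ((dirOf_eq_seven_iff p.2).1 h))
      have h7' : dirOf (pt g p) ≠ 7 := fun h => hp0 (Fin.ext ((dirOf_eq_seven_iff (Fin.is_lt _)).1 h))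
      have := dirOf_lt_eight p
      have := dirOf_lt_eight (pt g p)
      omega
  -- The search works with natural numbers; the default value `0` beyond the range plays no role.
  let f : ℕ → ℕ := fun x => if hx : x < 64 then pt g ⟨x, hx⟩ else 0
  have hfx : ∀ x (hx : x < 64), f x = pt g ⟨x, hx⟩ := fun x hx => dif_pos hx
  have hs := rigidSearch_sound f (fun x hx => by rw [hfx x hx]; exact Fin.is_lt _)
    (fun x hx => by rw [hfx x hx]; exact hdir _) (fun x hx y hy => by
      rw [hfx x hx, hfx y hy]
      by_cases hxy : x = y
      · subst hxy
        simp
      · exact dirOf_lt_six_iff g (p := ⟨x, hx⟩) (q := ⟨y, hy⟩) (fun h => hxy (Fin.ext_iff.1 h)))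
    rigidOrder [(16, 16)] (fun x hx => by
      have := List.all_eq_true.1 rigidOrder_lt x hx
      simpa using this) (by
      intro ab hab
      rw [List.mem_singleton.1 hab]
      refine ⟨by norm_num, ?_⟩
      rw [hfx 16 (by norm_num)]
      exact congrArg Fin.val h16) rigidSearch_check
  refine ext_pt fun p => ?_
  rw [pt_one]
  have h := forall_lt_of_all rigidOrder_check p p.2
  simp only [Bool.or_eq_true, Nat.beq_eq, List.any_eq_true] at h
  rcases h with (h | h) | ⟨q, hq, h⟩
  · rw [show p = 0 from Fin.ext h, h0]
  · rw [show p = 16 from Fin.ext h, h16]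
  · have := hs.1 q hq
    rw [← h, hfx p p.2] at this
    exact Fin.ext this

/-- The test whether a function on points, coming from an automorphism, is the identity. -/
def isId (f : ℕ → ℕ) : Bool :=
  Nat.beq (f 0) 0 && Nat.beq (f 16) 16 && (List.range 6).all fun d => Nat.beq (dirOf (f (dirPt d))) d

theorem zero_xor_val (q : Fin 64) : ((0 : Fin 64) : ℕ) ^^^ (q : ℕ) = q := Nat.zero_xor _

/-- The direction of the image of the line through `0` in direction `d`. -/
theorem ln_fst_eq_dirOf {g : ModelAut} (h0 : pt g 0 = 0) (d : Fin 6) :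
    ((ln g (lineThrough d 0)).1 : ℕ) = dirOf (pt g ⟨dirPt d, dirPt_lt d⟩) := by
  have hd := dirOf_dirPt d.2
  have hne : (0 : Fin 64) ≠ ⟨dirPt d, dirPt_lt d⟩ := by
    intro h
    have h' : dirPt d = 0 := (Fin.ext_iff.1 h).symm
    rw [h'] at hd
    have := (dirOf_eq_seven_iff (show 0 < 64 by norm_num)).2 rfl
    have := d.2
    omega
  rw [← ln_lineThrough_fst g (p := 0) (q := ⟨dirPt d, dirPt_lt d⟩) (by rw [zero_xor_val]; exact hd) hne,
    h0, zero_xor_val]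

/-- By rigidity at most eight values decide whether an automorphism is trivial. This makes the test
of a relator cheap. -/
theorem eq_one_iff_isId {g : ModelAut} {f : ℕ → ℕ} (hf : ∀ p : Fin 64, (pt g p : ℕ) = f p) :
    isId f = true ↔ g = 1 := by
  rw [isId, Bool.and_eq_true, Bool.and_eq_true, Nat.beq_eq, Nat.beq_eq]
  have e0 : f 0 = pt g 0 := (hf 0).symm
  have e16 : f 16 = pt g 16 := (hf 16).symm
  constructor
  · rintro ⟨⟨h0, h16⟩, h⟩
    have h0' : pt g 0 = 0 := Fin.ext (e0.symm.trans h0)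
    refine eq_one_of_fixes h0' (Fin.ext (e16.symm.trans h16)) fun d => ?_
    have := Nat.eq_of_beq_eq_true (forall_lt_of_all h d d.2)
    apply Fin.ext
    rw [ln_fst_eq_dirOf h0', hf]
    exact this
  · rintro rfl
    rw [e0, e16, pt_one, pt_one]
    refine ⟨⟨rfl, rfl⟩, List.all_eq_true.2 fun d hd => ?_⟩
    have hd := List.mem_range.1 hd
    rw [Nat.beq_eq]
    have := hf ⟨dirPt d, dirPt_lt d⟩
    rw [pt_one] at this
    rw [← this]
    exact dirOf_dirPt hd


/-! ### Edge-regular actions on the model -/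

/-- The edge given by an incident point-line pair. -/
def edge (p : Fin 64) (l : Fin 6 × Fin 16) (h : ModelInc p l) : model.edgeSet :=
  ⟨s(Sum.inl p, Sum.inr l), h⟩

theorem exists_edge (e : model.edgeSet) : ∃ p l h, e = edge p l h := by
  obtain ⟨e, he⟩ := e
  induction e using Sym2.ind with
  | _ x y =>
    rcases x with p | l <;> rcases y with q | m
    · exact he.elim
    · exact ⟨p, m, he, rfl⟩
    · exact ⟨q, l, he, Subtype.ext Sym2.eq_swap⟩
    · exact he.elim

theorem edge_inj {p q : Fin 64} {l m : Fin 6 × Fin 16} {h : ModelInc p l} {h' : ModelInc q m} :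
    edge p l h = edge q m h' ↔ p = q ∧ l = m := by
  rw [Subtype.ext_iff]
  change s(Sum.inl p, Sum.inr l) = s(Sum.inl q, Sum.inr m) ↔ _
  simp

theorem mapEdgeSet_edge (g : ModelAut) (p : Fin 64) (l : Fin 6 × Fin 16) (h : ModelInc p l) :
    g.mapEdgeSet (edge p l h) = edge (pt g p) (ln g l) ((modelInc_map_iff g p l).2 h) := by
  apply Subtype.ext
  change Sym2.map g s(Sum.inl p, Sum.inr l) = s(Sum.inl (pt g p), Sum.inr (ln g l))
  rw [Sym2.map_mk, apply_inl, apply_inr]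

/-- Automorphisms preserve the two types of vertices, so unordered edges can be replaced by incident
pairs with the point first. -/
theorem isEdgeRegular_iff {V : Type*} [Group V] (ρ : V →* ModelAut) :
    IsEdgeRegular ρ ↔ ∀ p l, ModelInc p l → ∀ q m, ModelInc q m →
      ∃! v, pt (ρ v) p = q ∧ ln (ρ v) l = m := by
  constructor
  · intro H p l h q m h'
    obtain ⟨v, hv, hu⟩ := H (edge p l h) (edge q m h')
    simp only [mapEdgeSet_edge, edge_inj] at hv hu
    exact ⟨v, hv, hu⟩
  · intro H e f
    obtain ⟨p, l, h, rfl⟩ := exists_edge e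
    obtain ⟨q, m, h', rfl⟩ := exists_edge f
    simp only [mapEdgeSet_edge, edge_inj]
    exact H p l h q m h'

/-- The number of edges of the model. -/
theorem card_flags : Nat.card {f : Fin 64 × (Fin 6 × Fin 16) // ModelInc f.1 f.2} = 384 := by
  let e : {f : Fin 64 × (Fin 6 × Fin 16) // ModelInc f.1 f.2} ≃ Fin 64 × Fin 6 :=
    { toFun := fun f => (f.1.1, f.1.2.1)
      invFun := fun x => ⟨(x.1, lineThrough x.2 x.1), modelInc_lineThrough _ _⟩
      left_inv := fun f => Subtype.ext (Prod.ext rfl (modelInc_iff.1 f.2).symm)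
      right_inv := fun x => rfl }
  rw [Nat.card_congr e]
  simp

/-- The base line, which passes through the point `0`. -/
def baseLine : Fin 6 × Fin 16 := lineThrough 0 0

theorem modelInc_base : ModelInc 0 baseLine := modelInc_lineThrough 0 0

section Coset

variable {V : Type*} [Group V] (ρ : V →* ModelAut)

theorem pt_map_mul (v w : V) (p : Fin 64) : pt (ρ (v * w)) p = pt (ρ v) (pt (ρ w) p) := by
  rw [map_mul, pt_mul]

theorem ln_map_mul (v w : V) (l : Fin 6 × Fin 16) : ln (ρ (v * w)) l = ln (ρ v) (ln (ρ w) l) := by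
  rw [map_mul, ln_mul]

/-- An action on the model which is transitive on edges is isomorphic to the action on the coset
graph with respect to the stabilizers of the base line and the base point. -/
theorem actionIso_cosetAction (E F : Subgroup V) (hE : ∀ v, v ∈ E ↔ ln (ρ v) baseLine = baseLine)
    (hF : ∀ v, v ∈ F ↔ pt (ρ v) 0 = 0)
    (htrans : ∀ p l, ModelInc p l → ∃ v, pt (ρ v) 0 = p ∧ ln (ρ v) baseLine = l) :
    ActionIso ρ (cosetAction E F) := by
  have hEeq : ∀ v w : V, (QuotientGroup.mk v : V ⧸ E) = QuotientGroup.mk w ↔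
      ln (ρ v) baseLine = ln (ρ w) baseLine := by
    intro v w
    rw [QuotientGroup.eq, hE, map_mul, ln_mul, map_inv]
    constructor
    · intro h
      rw [← (ln_injective (ρ v)⁻¹).eq_iff, h, ln_inv_ln]
    · intro h
      rw [← h, ln_inv_ln]
  have hFeq : ∀ v w : V, (QuotientGroup.mk v : V ⧸ F) = QuotientGroup.mk w ↔
      pt (ρ v) 0 = pt (ρ w) 0 := by
    intro v w
    rw [QuotientGroup.eq, hF, map_mul, pt_mul, map_inv]
    constructor
    · intro h
      rw [← (pt_injective (ρ v)⁻¹).eq_iff, h, pt_inv_pt]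
    · intro h
      rw [← h, pt_inv_pt]
  let fE : V ⧸ E → Fin 6 × Fin 16 := Quotient.lift (fun v => ln (ρ v) baseLine)
    fun v w h => (hEeq v w).1 (Quotient.sound h)
  let fF : V ⧸ F → Fin 64 := Quotient.lift (fun v => pt (ρ v) 0)
    fun v w h => (hFeq v w).1 (Quotient.sound h)
  have fEmk : ∀ v, fE (QuotientGroup.mk v) = ln (ρ v) baseLine := fun v => rfl
  have fFmk : ∀ v, fF (QuotientGroup.mk v) = pt (ρ v) 0 := fun v => rfl
  have hfE : Function.Bijective fE := by
    constructor
    · intro x y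
      obtain ⟨v, rfl⟩ := QuotientGroup.mk_surjective x
      obtain ⟨w, rfl⟩ := QuotientGroup.mk_surjective y
      exact (hEeq v w).2
    · intro l
      obtain ⟨p, _, _, hp, _⟩ := exists_ne_on_line l
      obtain ⟨v, _, hv⟩ := htrans p l hp
      exact ⟨QuotientGroup.mk v, hv⟩
  have hfF : Function.Bijective fF := by
    constructor
    · intro x y
      obtain ⟨v, rfl⟩ := QuotientGroup.mk_surjective x
      obtain ⟨w, rfl⟩ := QuotientGroup.mk_surjective y
      exact (hFeq v w).2
    · intro p
      obtain ⟨v, hv, _⟩ := htrans p _ (modelInc_lineThrough 0 p)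
      exact ⟨QuotientGroup.mk v, hv⟩
  have hadj : ∀ (x : V ⧸ E) (y : V ⧸ F),
      (∃ v : V, (QuotientGroup.mk v : V ⧸ E) = x ∧ (QuotientGroup.mk v : V ⧸ F) = y) ↔
        ModelInc (fF y) (fE x) := by
    intro x y
    constructor
    · rintro ⟨v, rfl, rfl⟩
      rw [fEmk, fFmk]
      exact (modelInc_map_iff _ _ _).2 modelInc_base
    · intro h
      obtain ⟨v, h1, h2⟩ := htrans _ _ h
      exact ⟨v, hfE.1 h2, hfF.1 h1⟩
  -- The subgroup `E` belongs to lines and stands first in the coset graph, while points stand first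
  -- in the model; hence the exchange of the two summands.
  let θ : cosetGraph E F ≃g model :=
    { toEquiv := (Equiv.sumCongr (Equiv.ofBijective fE hfE) (Equiv.ofBijective fF hfF)).trans
        (Equiv.sumComm _ _)
      map_rel_iff' := by
        rintro (x | x) (y | y)
        · exact Iff.rfl
        · exact (hadj x y).symm
        · exact (hadj y x).symm
        · exact Iff.rfl }
  refine ⟨MulEquiv.refl V, θ.symm, fun v x => ?_⟩
  obtain ⟨y, rfl⟩ := θ.surjective x
  rw [θ.symm_apply_apply, RelIso.symm_apply_eq]
  rcases y with y | y
  · obtain ⟨w, rfl⟩ := QuotientGroup.mk_surjective y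
    change ρ v (Sum.inr (ln (ρ w) baseLine)) = Sum.inr (ln (ρ (v * w)) baseLine)
    rw [ln_map_mul, apply_inr]
  · obtain ⟨w, rfl⟩ := QuotientGroup.mk_surjective y
    change ρ v (Sum.inl (pt (ρ w) 0)) = Sum.inl (pt (ρ (v * w)) 0)
    rw [pt_map_mul, apply_inl]

/-- Every point can be reached from `0` in at most two steps along lines, the first of which leads
to some `q ≠ 0`. Two applications of local transitivity therefore give transitivity on points. -/
theorem diameter_check : (List.range 64).all (fun p => (List.range 64).any fun q =>
    Nat.blt (dirOf q) 6 && (Nat.beq p q || Nat.blt (dirOf (q ^^^ p)) 6)) = true := by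
  decide +kernel

/-- A group containing elements that move the base point to all points of the base line and elements
that fix the base point and move the base line to all lines through the base point is
transitive on edges. -/
theorem transitive_of_local (E F : Subgroup V)
    (hF : ∀ v ∈ F, pt (ρ v) 0 = 0)
    (hEt : ∀ p, ModelInc p baseLine → ∃ v ∈ E, pt (ρ v) 0 = p)
    (hFt : ∀ d, ∃ v ∈ F, ln (ρ v) baseLine = lineThrough d 0) {p : Fin 64} {l : Fin 6 × Fin 16}
    (h : ModelInc p l) : ∃ v, pt (ρ v) 0 = p ∧ ln (ρ v) baseLine = l := by
  have hline0 : ∀ {m}, ModelInc 0 m → ∃ v ∈ F, ln (ρ v) baseLine = m := by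
    intro m hm
    obtain ⟨v, hv, hm'⟩ := hFt m.1
    exact ⟨v, hv, hm'.trans (modelInc_iff.1 hm).symm⟩
  -- If one point of the line `m` is in the orbit of `0`, then so is every point of `m`: pulling
  -- back by `v` gives a line through `0`, pulling back by an element of `F` gives the base line,
  -- and there `E` is transitive.
  have hstep : ∀ v q m, ModelInc (pt (ρ v) 0) m → ModelInc q m → ∃ w, pt (ρ w) 0 = q := by
    intro v q m h1 h2
    have h1' : ModelInc 0 (ln (ρ v)⁻¹ m) := by
      rwa [← modelInc_map_iff (ρ v)⁻¹, pt_inv_pt] at h1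
    obtain ⟨b, hb, hb'⟩ := hline0 h1'
    have h2' : ModelInc (pt (ρ b)⁻¹ (pt (ρ v)⁻¹ q)) baseLine := by
      rw [← modelInc_map_iff (ρ v)⁻¹, ← hb', ← modelInc_map_iff (ρ b)⁻¹, ln_inv_ln] at h2
      exact h2
    obtain ⟨a, ha, ha'⟩ := hEt _ h2'
    refine ⟨v * (b * a), ?_⟩
    rw [pt_map_mul, pt_map_mul, ha', pt_pt_inv, pt_pt_inv]
  have hpt : ∃ v, pt (ρ v) 0 = p := by
    have hd := forall_lt_of_all diameter_check p p.2
    simp only [List.any_eq_true, List.mem_range, Bool.and_eq_true, Bool.or_eq_true, Nat.blt_eq,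
      Nat.beq_eq] at hd
    obtain ⟨q, hq, hq6, hqp⟩ := hd
    have hq' : ∃ v, pt (ρ v) 0 = ⟨q, hq⟩ := by
      refine hstep 1 ⟨q, hq⟩ (lineThrough ⟨_, hq6⟩ ⟨q, hq⟩) ?_ (modelInc_lineThrough _ _)
      rw [map_one, pt_one, modelInc_iff]
      exact (lineThrough_eq_iff.2 (Or.inr (by rw [zero_xor_val]))).symm
    rcases hqp with hqp | hqp
    · obtain rfl : p = ⟨q, hq⟩ := Fin.ext hqp
      exact hq'
    · obtain ⟨v, hv⟩ := hq'
      refine hstep v p (lineThrough ⟨_, hqp⟩ p) ?_ (modelInc_lineThrough _ _)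
      rw [hv, modelInc_iff]
      exact (lineThrough_eq_iff.2 (Or.inr rfl)).symm
  obtain ⟨v, rfl⟩ := hpt
  have h1 : ModelInc 0 (ln (ρ v)⁻¹ l) := by
    rwa [← modelInc_map_iff (ρ v)⁻¹, pt_inv_pt] at h
  obtain ⟨b, hb, hb'⟩ := hline0 h1
  refine ⟨v * b, ?_, ?_⟩
  · rw [pt_map_mul, hF b hb]
  · apply ln_injective (ρ v)⁻¹
    rw [ln_map_mul, ln_inv_ln, hb']

/-- A group with at most `384` elements whose action is locally transitive acts regularly on edges,
and its action is the one on the coset graph. -/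
theorem regular_of_card_le [Finite V] (hcard : Nat.card V ≤ 384) (E F : Subgroup V)
    (hE : ∀ v ∈ E, ln (ρ v) baseLine = baseLine) (hF : ∀ v ∈ F, pt (ρ v) 0 = 0)
    (hEt : ∀ p, ModelInc p baseLine → ∃ v ∈ E, pt (ρ v) 0 = p)
    (hFt : ∀ d, ∃ v ∈ F, ln (ρ v) baseLine = lineThrough d 0) :
    IsEdgeRegular ρ ∧ ActionIso ρ (cosetAction E F) := by
  have htrans := fun p l => transitive_of_local ρ E F hF hEt hFt (p := p) (l := l)
  let φ : V → {f : Fin 64 × (Fin 6 × Fin 16) // ModelInc f.1 f.2} := fun v =>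
    ⟨(pt (ρ v) 0, ln (ρ v) baseLine), (modelInc_map_iff _ _ _).2 modelInc_base⟩
  have hφ : Function.Surjective φ := by
    rintro ⟨⟨p, l⟩, h⟩
    obtain ⟨v, hv1, hv2⟩ := htrans p l h
    exact ⟨v, Subtype.ext (Prod.ext hv1 hv2)⟩
  -- A surjection from at most 384 elements onto the 384 incident pairs is injective. So elements
  -- are determined by the image of the base edge, which yields both regularity and the fact that
  -- `E` and `F` are the full stabilizers.
  have hinj : Function.Injective φ :=
    ((Nat.bijective_iff_surjective_and_card φ).2
      ⟨hφ, le_antisymm (hcard.trans card_flags.ge) (Nat.card_le_card_of_surjective φ hφ)⟩).1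
  have hinj' : ∀ v w, pt (ρ v) 0 = pt (ρ w) 0 → ln (ρ v) baseLine = ln (ρ w) baseLine → v = w :=
    fun v w h1 h2 => hinj (Subtype.ext (Prod.ext h1 h2))
  constructor
  · rw [isEdgeRegular_iff]
    intro p l h q m h'
    obtain ⟨v, rfl, rfl⟩ := htrans p l h
    obtain ⟨w, rfl, rfl⟩ := htrans q m h'
    refine ⟨w * v⁻¹, ?_, ?_⟩
    · simp only [← pt_map_mul, ← ln_map_mul, inv_mul_cancel_right, and_self]
    · rintro u ⟨h1, h2⟩
      simp only [← pt_map_mul, ← ln_map_mul] at h1 h2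
      rw [← hinj' _ _ h1 h2, mul_inv_cancel_right]
  · refine actionIso_cosetAction ρ E F (fun v => ⟨hE v, fun h => ?_⟩)
      (fun v => ⟨hF v, fun h => ?_⟩) htrans
    · obtain ⟨w, hw, hw'⟩ := hEt (pt (ρ v) 0)
        (by have := (modelInc_map_iff (ρ v) 0 baseLine).2 modelInc_base; rwa [h] at this)
      rw [← hinj' w v hw' ((hE w hw).trans h.symm)]
      exact hw
    · have h1 := modelInc_iff.1 ((modelInc_map_iff (ρ v) 0 baseLine).2 modelInc_base)
      rw [h] at h1
      obtain ⟨w, hw, hw'⟩ := hFt (ln (ρ v) baseLine).1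
      rw [← hinj' w v ((hF w hw).trans h.symm) (hw'.trans h1.symm)]
      exact hw

end Coset

/-! ### Isomorphisms of actions -/

theorem _root_.ActionIso.symm {G H X Y : Type*} [Group G] [Group H] {Γ : SimpleGraph X}
    {Δ : SimpleGraph Y} {ρ : G →* (Γ ≃g Γ)} {σ : H →* (Δ ≃g Δ)} (h : ActionIso ρ σ) :
    ActionIso σ ρ := by
  obtain ⟨φ, ψ, h⟩ := h
  refine ⟨φ.symm, ψ.symm, fun g x => ?_⟩
  rw [RelIso.symm_apply_eq, h, φ.apply_symm_apply, ψ.apply_symm_apply]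

theorem _root_.ActionIso.trans {G H K X Y Z : Type*} [Group G] [Group H] [Group K] {Γ : SimpleGraph X}
    {Δ : SimpleGraph Y} {Λ : SimpleGraph Z} {ρ : G →* (Γ ≃g Γ)} {σ : H →* (Δ ≃g Δ)}
    {τ : K →* (Λ ≃g Λ)} (h : ActionIso ρ σ) (h' : ActionIso σ τ) : ActionIso ρ τ := by
  obtain ⟨φ, ψ, h⟩ := h
  obtain ⟨φ', ψ', h'⟩ := h'
  refine ⟨φ.trans φ', ψ.trans ψ', fun g x => ?_⟩
  change ψ' (ψ (ρ g x)) = τ (φ' (φ g)) (ψ' (ψ x))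
  rw [h, h']

theorem actionIso_range {G X : Type*} [Group G] {Γ : SimpleGraph X} (ρ : G →* (Γ ≃g Γ))
    (h : Function.Injective ρ) : ActionIso ρ.range.subtype ρ :=
  ActionIso.symm ⟨MonoidHom.ofInjective h, RelIso.refl _, fun _ _ => rfl⟩

theorem _root_.IsEdgeRegular.injective {V : Type*} [Group V] {ρ : V →* ModelAut} (h : IsEdgeRegular ρ) :
    Function.Injective ρ := by
  intro v w hvw
  obtain ⟨u, _, hu⟩ := (isEdgeRegular_iff ρ).1 h 0 baseLine modelInc_base (pt (ρ v) 0)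
    (ln (ρ v) baseLine) ((modelInc_map_iff _ _ _).2 modelInc_base)
  rw [hu v ⟨rfl, rfl⟩, hu w ⟨by rw [hvw], by rw [hvw]⟩]

theorem _root_.IsEdgeRegular.range {V : Type*} [Group V] {ρ : V →* ModelAut} (h : IsEdgeRegular ρ) :
    IsEdgeRegular ρ.range.subtype := by
  intro e f
  obtain ⟨v, hv, hu⟩ := h e f
  refine ⟨⟨ρ v, v, rfl⟩, hv, ?_⟩
  rintro ⟨_, w, rfl⟩ hw
  exact Subtype.ext (congrArg ρ (hu w hw))


/-! ### Words

A letter is a number: `2 * k` stands for the generator with index `k` and `2 * k + 1` for its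
inverse. The generators `a₁, a₂` have the indices `0, 1`, and `b₁, b₂` have the indices `2, 3`. -/

section Words

variable {G : Type*} [Group G]

/-- The value of a letter. -/
def letter (y : ℕ → G) (l : ℕ) : G := if l % 2 = 0 then y (l / 2) else (y (l / 2))⁻¹

/-- The value of a word. -/
def word (y : ℕ → G) (w : List ℕ) : G := (w.map (letter y)).prod

@[simp] theorem word_nil (y : ℕ → G) : word y [] = 1 := rfl

@[simp] theorem word_cons (y : ℕ → G) (l : ℕ) (w : List ℕ) :
    word y (l :: w) = letter y l * word y w := List.prod_cons

theorem word_append (y : ℕ → G) (v w : List ℕ) : word y (v ++ w) = word y v * word y w := by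
  simp [word]

theorem map_letter {H : Type*} [Group H] (f : G →* H) (y : ℕ → G) (l : ℕ) :
    f (letter y l) = letter (fun k => f (y k)) l := by
  unfold letter
  split_ifs <;> simp

theorem map_word {H : Type*} [Group H] (f : G →* H) (y : ℕ → G) (w : List ℕ) :
    f (word y w) = word (fun k => f (y k)) w := by
  induction w with
  | nil => simp
  | cons l w ih => rw [word_cons, word_cons, map_mul, ih, map_letter]

theorem letter_mem {S : Subgroup G} {y : ℕ → G} {l : ℕ} (h : y (l / 2) ∈ S) : letter y l ∈ S := by
  unfold letter
  split_ifs
  · exact h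
  · exact S.inv_mem h

theorem word_mem {S : Subgroup G} {y : ℕ → G} {w : List ℕ} (h : ∀ l ∈ w, y (l / 2) ∈ S) :
    word y w ∈ S := by
  induction w with
  | nil => exact S.one_mem
  | cons l w ih =>
    rw [word_cons]
    exact S.mul_mem (letter_mem (h l (by simp))) (ih fun m hm => h m (by simp [hm]))

end Words

/-! ### The presentations -/

/-- The generators of the free group of a presentation, with the index convention for words. -/
def freeGen (P : EdgePresentation) (k : ℕ) : FreeGroup (Fin P.numA ⊕ Fin P.numB) :=
  if k < 2 then if h : k < P.numA then FreeGroup.of (Sum.inl ⟨k, h⟩) else 1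
  else if h : k - 2 < P.numB then FreeGroup.of (Sum.inr ⟨k - 2, h⟩) else 1

/-- The generators of the presented group. -/
def gen (P : EdgePresentation) (k : ℕ) : P.Grp := PresentedGroup.mk P.rels (freeGen P k)

/-- The relators `a₂` or `b₂` for the generators that do not occur. -/
def relMissing (i : ℕ) : List (List ℕ) :=
  [[[2], [6]], [], [[6]], [], [[6]], [[2]], [[6]], [[6]], [[2]], [], []].getD i []

/-- The relators that involve only the generators `aⱼ`. -/
def relA (i : ℕ) : List (List ℕ) :=
  [[[0, 0, 0, 0]], [[0, 0], [2, 2], [0, 2, 0, 2]], [[0, 0], [2, 2], [0, 2, 0, 2]], [[0, 0], [2, 2],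
    [0, 2, 0, 2]], [[0, 0], [2, 2], [0, 2, 0, 2]], [[0, 0, 0, 0]], [[0, 0], [2, 2], [0, 2, 0,
    2]], [[0, 0], [2, 2], [0, 2, 0, 2]], [[0, 0, 0, 0]], [[0, 0], [2, 2], [0, 2, 0, 2]], [[2, 2],
    [0, 0], [0, 2, 0, 2]]].getD i []

/-- The relators that involve only the generators `bⱼ`. -/
def relB (i : ℕ) : List (List ℕ) :=
  [[[4, 4, 4, 4, 4, 4]], [[4, 4], [6, 6, 6], [4, 6, 4, 6]], [[4, 4, 4, 4, 4, 4]], [[4, 4], [6, 6,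
    6], [4, 6, 4, 6]], [[4, 4, 4, 4, 4, 4]], [[4, 4], [6, 6, 6], [4, 7, 4, 7]], [[4, 4, 4, 4, 4,
    4]], [[4, 4, 4, 4, 4, 4]], [[4, 4], [6, 6, 6], [4, 6, 4, 6]], [[4, 4], [6, 6, 6], [4, 6, 4,
    6]], [[4, 4], [6, 6, 6], [4, 6, 4, 6]]].getD i []

/-- The relators that involve both kinds of generators. -/
def relC (i : ℕ) : List (List ℕ) :=
  [[[0, 5, 1, 4, 4, 1, 4, 1, 1, 4], [0, 4, 1, 1, 5, 1, 4, 1, 1, 5], [0, 4, 0, 5, 0, 5, 5, 1, 4, 4]],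
    [[2, 6, 0, 7, 2, 7, 0, 6], [0, 7, 0, 6, 0, 7, 0, 6], [2, 6, 2, 4, 0, 7, 0, 4], [0, 2, 6, 0,
    6, 4, 2, 6, 0, 4], [0, 6, 4, 0, 4, 7, 0, 4, 7, 0, 4, 7]], [[0, 4, 2, 4, 2, 5, 2, 5], [2, 5,
    2, 4, 2, 4, 0, 5], [0, 4, 0, 4, 0, 4, 0, 4], [0, 4, 2, 5, 5, 0, 5, 5, 2, 4]], [[2, 4, 0, 4,
    2, 4, 0, 4], [0, 4, 0, 4, 0, 4, 0, 4], [2, 6, 2, 4, 0, 7, 0, 4], [0, 7, 0, 6, 0, 7, 0, 6],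
    [2, 6, 0, 7, 2, 0, 6, 0, 7], [0, 7, 2, 4, 6, 2, 6, 0, 4, 6], [0, 6, 2, 4, 7, 2, 7, 0, 6, 4]],
    [[2, 4, 2, 4, 2, 4, 2, 4], [2, 4, 0, 4, 2, 4, 0, 4], [0, 4, 0, 4, 0, 4, 0, 4], [2, 5, 0, 4,
    4, 2, 4, 0, 5, 5], [2, 4, 4, 0, 5, 5, 2, 4, 2, 5]], [[0, 7, 0, 4, 0, 7, 0, 4], [0, 4, 1, 4,
    0, 4, 1, 4, 7], [1, 7, 0, 7, 1, 4, 1, 4, 6]], [[2, 4, 2, 5, 2, 4, 2, 5], [0, 4, 2, 5, 0, 4,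
    2, 5], [2, 4, 0, 5, 2, 4, 0, 5], [0, 4, 0, 5, 0, 4, 0, 5], [0, 4, 2, 4, 0, 4, 4, 2, 4, 4],
    [0, 4, 0, 4, 4, 0, 4, 0, 4, 4], [2, 4, 2, 4, 0, 2, 4, 0, 4, 4, 4]], [[4, 0, 5, 2, 4, 0, 5,
    2], [2, 4, 0, 2, 4, 2, 5, 2, 5], [0, 4, 4, 2, 4, 2, 4, 4, 0, 4]], [[0, 6, 0, 6, 0, 6, 0, 6],
    [0, 7, 0, 4, 1, 6, 1, 4, 6], [0, 4, 0, 4, 6, 0, 7, 1, 7], [0, 4, 6, 0, 4, 0, 6, 1, 6], [0, 6,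
    0, 4, 0, 4, 0, 0, 6, 4]], [[0, 7, 0, 6, 0, 7, 0, 6], [2, 7, 0, 4, 0, 6, 2, 6, 4], [2, 0, 7,
    0, 4, 2, 6, 0, 4, 7], [2, 7, 0, 6, 4, 2, 4, 7, 0, 6]], [[0, 4, 0, 4, 0, 4, 0, 4], [2, 7, 0,
    6, 2, 7, 0, 6], [0, 7, 0, 4, 0, 7, 0, 4], [0, 7, 0, 6, 0, 7, 0, 6], [0, 6, 2, 6, 2, 6, 4, 2,
    4], [0, 6, 2, 4, 2, 7, 0, 4, 6]]].getD i []

/-- The relators of the presentation, as they are given. -/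
def relGiven (i : ℕ) : List (List ℕ) := relA i ++ (relB i ++ relC i)

/-- All relators. -/
def relWords (i : ℕ) : List (List ℕ) := relMissing i ++ relGiven i

/-- Powers, products and inverses evaluate in the free group to classes of explicit lists. A relator
and its coded word give the same list, so the equivalence is definitional once the lists of words
are unfolded. The same holds for the following ten presentations. -/
theorem mem_rels_L1 (r : FreeGroup (Fin presL1.numA ⊕ Fin presL1.numB)) :
    r ∈ presL1.rels ↔ r ∈ (relGiven 0).map (word (freeGen presL1)) := by
  simp only [relGiven, relA, relB, relC, List.getD_cons_zero, List.cons_append,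
    List.nil_append, List.map_cons, List.map_nil, List.mem_cons, List.not_mem_nil, or_false]
  exact Iff.rfl

theorem mem_rels_L2 (r : FreeGroup (Fin presL2.numA ⊕ Fin presL2.numB)) :
    r ∈ presL2.rels ↔ r ∈ (relGiven 1).map (word (freeGen presL2)) := by
  simp only [relGiven, relA, relB, relC, List.getD_cons_succ, List.getD_cons_zero, List.cons_append,
    List.nil_append, List.map_cons, List.map_nil, List.mem_cons, List.not_mem_nil, or_false]
  exact Iff.rfl

theorem mem_rels_L3 (r : FreeGroup (Fin presL3.numA ⊕ Fin presL3.numB)) :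
    r ∈ presL3.rels ↔ r ∈ (relGiven 2).map (word (freeGen presL3)) := by
  simp only [relGiven, relA, relB, relC, List.getD_cons_succ, List.getD_cons_zero, List.cons_append,
    List.nil_append, List.map_cons, List.map_nil, List.mem_cons, List.not_mem_nil, or_false]
  exact Iff.rfl

theorem mem_rels_L4 (r : FreeGroup (Fin presL4.numA ⊕ Fin presL4.numB)) :
    r ∈ presL4.rels ↔ r ∈ (relGiven 3).map (word (freeGen presL4)) := by
  simp only [relGiven, relA, relB, relC, List.getD_cons_succ, List.getD_cons_zero, List.cons_append,
    List.nil_append, List.map_cons, List.map_nil, List.mem_cons, List.not_mem_nil, or_false]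
  exact Iff.rfl

theorem mem_rels_L5 (r : FreeGroup (Fin presL5.numA ⊕ Fin presL5.numB)) :
    r ∈ presL5.rels ↔ r ∈ (relGiven 4).map (word (freeGen presL5)) := by
  simp only [relGiven, relA, relB, relC, List.getD_cons_succ, List.getD_cons_zero, List.cons_append,
    List.nil_append, List.map_cons, List.map_nil, List.mem_cons, List.not_mem_nil, or_false]
  exact Iff.rfl

theorem mem_rels_L6 (r : FreeGroup (Fin presL6.numA ⊕ Fin presL6.numB)) :
    r ∈ presL6.rels ↔ r ∈ (relGiven 5).map (word (freeGen presL6)) := by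
  simp only [relGiven, relA, relB, relC, List.getD_cons_succ, List.getD_cons_zero, List.cons_append,
    List.nil_append, List.map_cons, List.map_nil, List.mem_cons, List.not_mem_nil, or_false]
  exact Iff.rfl

theorem mem_rels_L7 (r : FreeGroup (Fin presL7.numA ⊕ Fin presL7.numB)) :
    r ∈ presL7.rels ↔ r ∈ (relGiven 6).map (word (freeGen presL7)) := by
  simp only [relGiven, relA, relB, relC, List.getD_cons_succ, List.getD_cons_zero, List.cons_append,
    List.nil_append, List.map_cons, List.map_nil, List.mem_cons, List.not_mem_nil, or_false]
  exact Iff.rfl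

theorem mem_rels_L8 (r : FreeGroup (Fin presL8.numA ⊕ Fin presL8.numB)) :
    r ∈ presL8.rels ↔ r ∈ (relGiven 7).map (word (freeGen presL8)) := by
  simp only [relGiven, relA, relB, relC, List.getD_cons_succ, List.getD_cons_zero, List.cons_append,
    List.nil_append, List.map_cons, List.map_nil, List.mem_cons, List.not_mem_nil, or_false]
  exact Iff.rfl

theorem mem_rels_L9 (r : FreeGroup (Fin presL9.numA ⊕ Fin presL9.numB)) :
    r ∈ presL9.rels ↔ r ∈ (relGiven 8).map (word (freeGen presL9)) := by
  simp only [relGiven, relA, relB, relC, List.getD_cons_succ, List.getD_cons_zero, List.cons_append,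
    List.nil_append, List.map_cons, List.map_nil, List.mem_cons, List.not_mem_nil, or_false]
  exact Iff.rfl

theorem mem_rels_L10 (r : FreeGroup (Fin presL10.numA ⊕ Fin presL10.numB)) :
    r ∈ presL10.rels ↔ r ∈ (relGiven 9).map (word (freeGen presL10)) := by
  simp only [relGiven, relA, relB, relC, List.getD_cons_succ, List.getD_cons_zero, List.cons_append,
    List.nil_append, List.map_cons, List.map_nil, List.mem_cons, List.not_mem_nil, or_false]
  exact Iff.rfl

theorem mem_rels_L11 (r : FreeGroup (Fin presL11.numA ⊕ Fin presL11.numB)) :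
    r ∈ presL11.rels ↔ r ∈ (relGiven 10).map (word (freeGen presL11)) := by
  simp only [relGiven, relA, relB, relC, List.getD_cons_succ, List.getD_cons_zero, List.cons_append,
    List.nil_append, List.map_cons, List.map_nil, List.mem_cons, List.not_mem_nil, or_false]
  exact Iff.rfl

theorem mem_rels_iff (i : Fin 11) (r : FreeGroup (Fin (presL i).numA ⊕ Fin (presL i).numB)) :
    r ∈ (presL i).rels ↔ r ∈ (relGiven i).map (word (freeGen (presL i))) := by
  fin_cases i
  · exact mem_rels_L1 r
  · exact mem_rels_L2 r
  · exact mem_rels_L3 r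
  · exact mem_rels_L4 r
  · exact mem_rels_L5 r
  · exact mem_rels_L6 r
  · exact mem_rels_L7 r
  · exact mem_rels_L8 r
  · exact mem_rels_L9 r
  · exact mem_rels_L10 r
  · exact mem_rels_L11 r

theorem numA_le_and_numB_le (i : Fin 11) : (presL i).numA ≤ 2 ∧ (presL i).numB ≤ 2 := by
  fin_cases i <;> exact ⟨by decide, by decide⟩

theorem relMissing_eq_A (i : Fin 11) : ∀ k < 2, (presL i).numA ≤ k → [2 * k] ∈ relMissing i := by
  fin_cases i <;> decide

theorem relMissing_eq_B (i : Fin 11) : ∀ k < 2, (presL i).numB ≤ k → [2 * (k + 2)] ∈ relMissing i := by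
  fin_cases i <;> decide

theorem freeGen_missing (i : Fin 11) : ∀ w ∈ relMissing i, word (freeGen (presL i)) w = 1 := by
  fin_cases i <;> simp [relMissing, letter, freeGen] <;> decide

theorem word_gen_eq_one (i : Fin 11) (w : List ℕ) (hw : w ∈ relWords i) :
    word (gen (presL i)) w = 1 := by
  have h : word (gen (presL i)) w = PresentedGroup.mk _ (word (freeGen (presL i)) w) :=
    (map_word _ _ _).symm
  rw [h]
  rcases List.mem_append.1 hw with hw | hw
  · rw [freeGen_missing i w hw, map_one]
  · exact PresentedGroup.one_of_mem ((mem_rels_iff i _).2 (List.mem_map_of_mem hw))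

/-- The universal property of the presented groups. -/
theorem exists_hom (i : Fin 11) {K : Type*} [Group K] (y : ℕ → K)
    (h : ∀ w ∈ relWords i, word y w = 1) :
    ∃ ρ : (presL i).Grp →* K, ∀ k < 4, ρ (gen (presL i) k) = y k := by
  let f : Fin (presL i).numA ⊕ Fin (presL i).numB → K :=
    Sum.elim (fun j => y j) (fun j => y (j + 2))
  -- A generator that does not occur in the presentation is represented by the trivial element of
  -- the free group, and the additional relators force its prescribed image to be trivial too.
  have hf : ∀ k < 4, FreeGroup.lift f (freeGen (presL i) k) = y k := by
    have h1 : ∀ k, [2 * k] ∈ relMissing i → y k = 1 := by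
      intro k hk
      simpa [letter] using h _ (List.mem_append_left _ hk)
    intro k hk
    unfold freeGen
    split_ifs with h2 h3 h3
    · simp [f]
    · rw [map_one, h1 k (relMissing_eq_A i k h2 (by omega))]
    · simp only [f, FreeGroup.lift_apply_of, Sum.elim_inr]
      congr 1
      omega
    · have := relMissing_eq_B i (k - 2) (by omega) (by omega)
      rw [show k - 2 + 2 = k by omega] at this
      rw [map_one, h1 k this]
  have hletters : ∀ w ∈ relGiven i, ∀ l ∈ w, l < 8 := by
    have : ∀ i : Fin 11, ∀ w ∈ relGiven i, ∀ l ∈ w, l < 8 := by decide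
    exact this i
  have hword : ∀ w : List ℕ, (∀ l ∈ w, l < 8) →
      FreeGroup.lift f (word (freeGen (presL i)) w) = word y w := by
    intro w hw
    rw [map_word]
    unfold word
    congr 1
    refine List.map_congr_left fun l hl => ?_
    have h4 : l / 2 < 4 := by have := hw l hl; omega
    simp only [letter, hf _ h4]
  refine ⟨PresentedGroup.toGroup (f := f) ?_, fun k hk => hf k hk⟩
  intro r hr
  obtain ⟨w, hw, rfl⟩ := List.mem_map.1 ((mem_rels_iff i r).1 hr)
  rw [hword w (hletters w hw)]
  exact h w (List.mem_append_right _ hw)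

theorem gen_mem_subA (i : Fin 11) {k : ℕ} (hk : k < 2) : gen (presL i) k ∈ (presL i).subA := by
  unfold gen freeGen
  rw [if_pos hk]
  split_ifs with h
  · exact Subgroup.subset_closure ⟨⟨k, h⟩, rfl⟩
  · rw [map_one]
    exact Subgroup.one_mem _

theorem gen_mem_subB (i : Fin 11) {k : ℕ} (hk : 2 ≤ k) : gen (presL i) k ∈ (presL i).subB := by
  unfold gen freeGen
  rw [if_neg (by omega)]
  split_ifs with h
  · exact Subgroup.subset_closure ⟨⟨k - 2, h⟩, rfl⟩
  · rw [map_one]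
    exact Subgroup.one_mem _

theorem subA_le (i : Fin 11) {S : Subgroup (presL i).Grp} (h : ∀ k < 2, gen (presL i) k ∈ S) :
    (presL i).subA ≤ S := by
  refine (Subgroup.closure_le _).2 ?_
  rintro _ ⟨j, rfl⟩
  have h1 := h j (j.2.trans_le (numA_le_and_numB_le i).1)
  unfold gen freeGen at h1
  rwa [if_pos (j.2.trans_le (numA_le_and_numB_le i).1), dif_pos j.2] at h1

theorem subB_le (i : Fin 11) {S : Subgroup (presL i).Grp}
    (h : ∀ k, 2 ≤ k → k < 4 → gen (presL i) k ∈ S) : (presL i).subB ≤ S := by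
  refine (Subgroup.closure_le _).2 ?_
  rintro _ ⟨j, rfl⟩
  have h1 := h (j + 2) (by omega) (by have := (numA_le_and_numB_le i).2; omega)
  unfold gen freeGen at h1
  rwa [if_neg (by omega), dif_pos (show (j : ℕ) + 2 - 2 < _ by simp)] at h1

theorem closure_gen (i : Fin 11) :
    Subgroup.closure (Set.range fun k : Fin 4 => gen (presL i) k) = ⊤ := by
  rw [eq_top_iff, ← PresentedGroup.closure_range_of, Subgroup.closure_le]
  rintro _ ⟨j | j, rfl⟩
  · have : gen (presL i) j ∈ Subgroup.closure (Set.range fun k : Fin 4 => gen (presL i) k) :=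
      Subgroup.subset_closure ⟨⟨j, by have := (numA_le_and_numB_le i).1; omega⟩, rfl⟩
    unfold gen freeGen at this
    rwa [if_pos (j.2.trans_le (numA_le_and_numB_le i).1), dif_pos j.2] at this
  · have : gen (presL i) (j + 2) ∈ Subgroup.closure (Set.range fun k : Fin 4 => gen (presL i) k) :=
      Subgroup.subset_closure ⟨⟨j + 2, by have := (numA_le_and_numB_le i).2; omega⟩, rfl⟩
    unfold gen freeGen at this
    rwa [if_neg (by omega), dif_pos (show (j : ℕ) + 2 - 2 < _ by simp)] at this


/-! ### Coset enumeration -/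

/-- Evaluation of `f n` which makes the kernel evaluate `n` first. -/
def force {α : Type*} (n : ℕ) (f : ℕ → α) : α :=
  match n with
  | 0 => f 0
  | n + 1 => f (n + 1)

theorem force_eq {α : Type*} (n : ℕ) (f : ℕ → α) : force n f = f n := by
  cases n <;> rfl

/-- The bit with index `b` of `K`. -/
def bit (K b : ℕ) : Bool := Nat.beq ((K >>> b) &&& 1) 1

theorem bit_eq (K b : ℕ) : bit K b = K.testBit b := by
  rw [bit, Nat.and_one_is_mod, Nat.testBit_eq_decide_div_mod_eq, Nat.shiftRight_eq_div_pow]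
  exact Bool.eq_iff_iff.2 (by rw [Nat.beq_eq, decide_eq_true_iff])

theorem bit_or_iff {K a b : ℕ} : bit (K ||| 1 <<< a) b = true ↔ bit K b = true ∨ b = a := by
  rw [bit_eq, bit_eq, Nat.testBit_or, Nat.one_shiftLeft, Nat.testBit_two_pow, Bool.or_eq_true,
    decide_eq_true_iff, eq_comm (a := a)]

/-- The edges `x_k • c q = c (T_k q)` known so far are recorded in the bits `4 * q + k` of `K`. This
adds the edge `letter l • c q = c p`. -/
def addEdge (tabs : List ℕ) (K l q p : ℕ) : ℕ :=
  if Nat.beq (l % 2) 0 then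
    if Nat.beq (ap (tabs.getD l 0) q) p then K ||| 1 <<< (4 * q + l / 2) else K
  else
    if Nat.beq (ap (tabs.getD (l - 1) 0) p) q then K ||| 1 <<< (4 * p + l / 2) else K

/-- The image of `p` under a letter, if the corresponding edge is known. -/
def stepEdge (tabs : List ℕ) (K l p : ℕ) : Option ℕ :=
  if Nat.beq (l % 2) 0 then
    if bit K (4 * p + l / 2) then some (ap (tabs.getD l 0) p) else none
  else
    force (ap (tabs.getD l 0) p) fun q =>
      if bit K (4 * q + l / 2) && Nat.beq (ap (tabs.getD (l - 1) 0) q) p then some q else none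

/-- The image of `p` under a word, if all edges on the way are known. -/
def walk (tabs : List ℕ) (K : ℕ) : List ℕ → ℕ → Option ℕ
  | [], p => some p
  | l :: w, p =>
    match walk tabs K w p with
    | none => none
    | some q => stepEdge tabs K l q

/-- A deduction: if all edges but one on a closed path along a relator are known, then so is the
last one. The code `p + 64 * (r + 32 * j)` stands for the relator with index `j`, rotated by `r`, at
the node `p`. -/
def deduce (rels : List (List ℕ)) (tabs : List ℕ) (K s : ℕ) : ℕ :=
  let w := rels.getD (s / 2048) []
  let r := s / 64 % 32
  match w.drop r ++ w.take r with
  | [] => K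
  | l :: v =>
    match walk tabs K v (s % 64) with
    | none => K
    | some q => addEdge tabs K l q (s % 64)

/-- A sequence of deductions. -/
def deduceAll (rels : List (List ℕ)) (tabs : List ℕ) : List ℕ → ℕ → ℕ
  | [], K => K
  | s :: ss, K => force K fun K => deduceAll rels tabs ss (deduce rels tabs K s)

/-- The edges of the tree by which the nodes are defined. The word that defines a node is coded as a
number whose digits in base `8` are the letters, the first letter being the last digit, after a
leading digit `1`. -/
def treeEdges (W tabs : List ℕ) : List ℕ → ℕ → ℕ
  | [], K => K
  | q :: qs, K => force K fun K =>
    treeEdges W tabs qs <| force (W.getD q 0) fun n =>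
      force (ap (tabs.getD ((n % 8) ^^^ 1) 0) q) fun p =>
        if Nat.ble 8 n && Nat.beq (W.getD p 0) (n / 8) then addEdge tabs K (n % 8) p q else K

/-- The loops at the base node given by generators of the subgroup. -/
def loopEdges (tabs : List ℕ) : List ℕ → ℕ → ℕ
  | [], K => K
  | l :: ls, K => loopEdges tabs ls (addEdge tabs K l 0 0)

/-- The complete coset enumeration with `n` nodes: the generators are those with index in `gens`, those
in `loops` fix the base node. -/
def enumerate (n : ℕ) (gens loops : List ℕ) (rels : List (List ℕ)) (tabs W steps : List ℕ) : Bool :=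
  Nat.beq (W.getD 0 0) 1 &&
  force (deduceAll rels tabs steps
    (treeEdges W tabs (List.range n) (loopEdges tabs loops 0))) fun K =>
    (List.range n).all fun p => gens.all fun k =>
      bit K (4 * p + k) && Nat.blt (ap (tabs.getD (2 * k) 0) p) n

section Enumeration

variable {V X : Type*} [Group V] [MulAction V X] (x : ℕ → V)

/-- The element given by a number that codes a word. -/
def codeWord (n : ℕ) : V :=
  if n < 8 then 1 else letter x (n % 8) * codeWord (n / 8)
termination_by n
decreasing_by omega

/-- All edges recorded in `K` are correct. -/
def Correct (tabs : List ℕ) (c : ℕ → X) (K : ℕ) : Prop :=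
  ∀ q k, k < 4 → bit K (4 * q + k) = true → x k • c q = c (ap (tabs.getD (2 * k) 0) q)

variable {x} {tabs : List ℕ} {c : ℕ → X} {K : ℕ}

/-- An edge is recorded only when the table contains it, so wrong tables or certificates can make
the enumeration fail but cannot make it record a false edge. -/
theorem Correct.addEdge (h : Correct x tabs c K) {l q p : ℕ} (hl : l < 8)
    (he : letter x l • c q = c p) : Correct x tabs c (addEdge tabs K l q p) := by
  unfold letter at he
  unfold Quadrangle.addEdge
  simp only [Nat.beq_eq]
  split_ifs at he ⊢ with h1 h2 h2
  · intro q' k hk hb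
    rcases bit_or_iff.1 hb with hb | hb
    · exact h q' k hk hb
    · obtain ⟨rfl, rfl⟩ : q' = q ∧ k = l / 2 := by omega
      rw [he, show 2 * (l / 2) = l by omega, h2]
  · exact h
  · intro q' k hk hb
    rcases bit_or_iff.1 hb with hb | hb
    · exact h q' k hk hb
    · obtain ⟨rfl, rfl⟩ : q' = p ∧ k = l / 2 := by omega
      rw [show 2 * (l / 2) = l - 1 by omega, h2, ← he, smul_inv_smul]
  · exact h

theorem Correct.stepEdge (h : Correct x tabs c K) {l p q : ℕ} (hl : l < 8)
    (hs : stepEdge tabs K l p = some q) : letter x l • c p = c q := by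
  unfold Quadrangle.stepEdge at hs
  rw [force_eq] at hs
  unfold letter
  simp only [Nat.beq_eq, Bool.and_eq_true] at hs
  split_ifs at hs ⊢ with h1 h2 h2
  · rw [h p _ (by omega) h2, show 2 * (l / 2) = l by omega, Option.some.inj hs]
  · rw [inv_smul_eq_iff, ← Option.some.inj hs, h _ _ (by omega) h2.1,
      show 2 * (l / 2) = l - 1 by omega, h2.2]

theorem Correct.walk (h : Correct x tabs c K) {w : List ℕ} (hw : ∀ l ∈ w, l < 8) {p q : ℕ}
    (hs : walk tabs K w p = some q) : word x w • c p = c q := by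
  induction w generalizing q with
  | nil =>
    rw [Quadrangle.walk] at hs
    rw [word_nil, one_smul, Option.some.inj hs]
  | cons l w ih =>
    rw [Quadrangle.walk] at hs
    split at hs
    · cases hs
    · next r hr =>
      rw [word_cons, mul_smul, ih (fun m hm => hw m (by simp [hm])) hr]
      exact h.stepEdge (hw l (by simp)) hs

/-- Rotations of a relator are conjugates of it, hence trivial. If all letters but the leftmost are
known to lead from `p` to `q`, then the leftmost letter must lead from `q` back to `p`. -/
theorem Correct.deduce (h : Correct x tabs c K) {rels : List (List ℕ)}
    (hrels : ∀ w ∈ rels, word x w = 1) (hlt : ∀ w ∈ rels, ∀ l ∈ w, l < 8) (s : ℕ) :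
    Correct x tabs c (deduce rels tabs K s) := by
  unfold Quadrangle.deduce
  set w := rels.getD (s / 2048) [] with hw
  -- A relator index beyond the end of the list yields the empty word, which is harmless.
  have hw1 : word x w = 1 ∧ ∀ l ∈ w, l < 8 := by
    rcases lt_or_ge (s / 2048) rels.length with hlen | hlen
    · have hmem : w ∈ rels := by
        rw [hw, List.getD_eq_getElem _ _ hlen]
        exact List.getElem_mem _
      exact ⟨hrels w hmem, hlt w hmem⟩
    · rw [hw, List.getD_eq_default _ _ hlen]
      simp
  have hrot : word x (w.drop (s / 64 % 32) ++ w.take (s / 64 % 32)) = 1 := by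
    rw [word_append, mul_eq_one_comm, ← word_append, List.take_append_drop, hw1.1]
  have hrotlt : ∀ l ∈ w.drop (s / 64 % 32) ++ w.take (s / 64 % 32), l < 8 := by
    intro l hl
    rcases List.mem_append.1 hl with hl | hl
    · exact hw1.2 l (List.mem_of_mem_drop hl)
    · exact hw1.2 l (List.mem_of_mem_take hl)
  simp only
  split
  · exact h
  · next l v hlv =>
    rw [hlv] at hrot hrotlt
    split
    · exact h
    · next q hq =>
      refine h.addEdge (hrotlt l (by simp)) ?_
      rw [← h.walk (fun m hm => hrotlt m (by simp [hm])) hq, ← mul_smul, ← word_cons, hrot,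
        one_smul]

theorem Correct.deduceAll {rels : List (List ℕ)}
    (hrels : ∀ w ∈ rels, word x w = 1) (hlt : ∀ w ∈ rels, ∀ l ∈ w, l < 8) (ss : List ℕ) {K : ℕ}
    (h : Correct x tabs c K) : Correct x tabs c (deduceAll rels tabs ss K) := by
  induction ss generalizing K with
  | nil => exact h
  | cons s ss ih =>
    rw [Quadrangle.deduceAll, force_eq]
    exact ih (h.deduce hrels hlt s)

/-- These edges hold by the very definition of the nodes: the word of `q` is the word of its
predecessor with one more letter in front. -/
theorem Correct.treeEdges {W : List ℕ} {x₀ : X}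
    (hc : ∀ q, c q = codeWord x (W.getD q 0) • x₀) (qs : List ℕ) {K : ℕ}
    (h : Correct x tabs c K) : Correct x tabs c (treeEdges W tabs qs K) := by
  induction qs generalizing K with
  | nil => exact h
  | cons q qs ih =>
    rw [Quadrangle.treeEdges, force_eq]
    apply ih
    rw [force_eq, force_eq]
    split_ifs with h'
    · rw [Bool.and_eq_true, Nat.ble_eq, Nat.beq_eq] at h'
      refine h.addEdge (Nat.mod_lt _ (by norm_num)) ?_
      rw [hc, hc, h'.2, codeWord.eq_1 x (W.getD q 0), if_neg (not_lt.2 h'.1), mul_smul]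
    · exact h

theorem Correct.loopEdges (ls : List ℕ) (hls : ∀ l ∈ ls, l < 8 ∧ letter x l • c 0 = c 0) {K : ℕ}
    (h : Correct x tabs c K) : Correct x tabs c (loopEdges tabs ls K) := by
  induction ls generalizing K with
  | nil => exact h
  | cons l ls ih =>
    exact ih (fun m hm => hls m (by simp [hm])) (h.addEdge (hls l (by simp)).1 (hls l (by simp)).2)

open scoped Pointwise in
/-- Soundness of coset enumeration: the orbit of the base point has at most as many elements as
there are nodes. -/
theorem exists_eq_codeWord_smul {n : ℕ} {gens loops : List ℕ} {rels : List (List ℕ)}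
    {W steps : List ℕ} (hen : enumerate n gens loops rels tabs W steps = true) (x₀ : X)
    (hgens : ∀ k ∈ gens, k < 4) (hloops : ∀ l ∈ loops, l < 8 ∧ letter x l • x₀ = x₀)
    (hrels : ∀ w ∈ rels, word x w = 1) (hlt : ∀ w ∈ rels, ∀ l ∈ w, l < 8) (hn : 0 < n) (v : V)
    (hv : v ∈ Subgroup.closure {u | ∃ k ∈ gens, u = x k}) :
    ∃ q < n, v • x₀ = codeWord x (W.getD q 0) • x₀ := by
  rw [enumerate, force_eq, Bool.and_eq_true, Nat.beq_eq] at hen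
  obtain ⟨hW, hen⟩ := hen
  set c : ℕ → X := fun q => codeWord x (W.getD q 0) • x₀ with hc
  have hc0 : c 0 = x₀ := by
    simp only [hc]
    rw [hW, codeWord.eq_1, if_pos (by norm_num), one_smul]
  have hcorr : Correct x tabs c _ := Correct.deduceAll hrels hlt steps
    (Correct.treeEdges (fun _ => rfl) (List.range n) (Correct.loopEdges (c := c) loops (by simpa only [hc0] using hloops)
      (K := 0) (fun q k _ hb => by simp [bit_eq] at hb)))
  have hedge : ∀ k ∈ gens, ∀ p < n, ∃ q < n, x k • c p = c q := by
    intro k hk p hp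
    have := List.all_eq_true.1 (forall_lt_of_all hen p hp) k hk
    rw [Bool.and_eq_true, Nat.blt_eq] at this
    exact ⟨_, this.2, hcorr p k (hgens k hk) this.1⟩
  let S : Set X := c '' Set.Iio n
  have hfin : S.Finite := (Set.finite_Iio n).image c
  have hstab : ∀ k ∈ gens, x k ∈ MulAction.stabilizer V S := by
    intro k hk
    -- As the set of nodes is finite, it is enough that each generator maps it into itself.
    rw [MulAction.mem_stabilizer_set_iff_smul_set_subset hfin]
    rintro _ ⟨_, ⟨p, hp, rfl⟩, rfl⟩
    obtain ⟨q, hq, h⟩ := hedge k hk p hp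
    exact ⟨q, hq, h.symm⟩
  have hv' : v ∈ MulAction.stabilizer V S := by
    refine (Subgroup.closure_le _).2 ?_ hv
    rintro _ ⟨k, hk, rfl⟩
    exact hstab k hk
  have h0 : x₀ ∈ S := ⟨0, hn, hc0⟩
  have : v • x₀ ∈ S := by
    rw [← MulAction.mem_stabilizer_iff.1 hv']
    exact Set.smul_mem_smul_set h0
  obtain ⟨q, hq, h⟩ := this
  exact ⟨q, hq, h.symm⟩

end Enumeration

/-! ### The orders of the presented groups -/

/-- The tables of the letters for a model of the group with index `i` as a group of automorphisms of the
quadrangle. -/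
def letterTabs (i : ℕ) : List ℕ :=
  [[19378212509707519714814459548643027863033299092192376121344826966921203229837907107774663041457781326241366387799120,
    29385072419162454281337346304261906349225876082972100879528599507568922251558448324628676516617756369661327026305120,
    39392078757191557952714343944915560488424390381760365930566598193007564623154681709773698286566728461254900444831808,
    39392078757191557952714343944915560488424390381760365930566598193007564623154681709773698286566728461254900444831808,
    33680757757753563553931550850659655357687375289229492186193421168492686668516313365312605566557461891082642181744320,
    35304599329929263706664081262516598648308778496264180169362994791748565422734872842332308296831306779604357454736320,
    39392078757191557952714343944915560488424390381760365930566598193007564623154681709773698286566728461254900444831808,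
    39392078757191557952714343944915560488424390381760365930566598193007564623154681709773698286566728461254900444831808],
    [29385220040646928311500619475290425927850379972578224426651117322527416602473999359201102685904944885637045912675408,
    29385220040646928311500619475290425927850379972578224426651117322527416602473999359201102685904944885637045912675408,
    19348579565670373643470891706547887342563948942635892607609368341171764113276722225942767013022723127986214635997472,
    19348579565670373643470891706547887342563948942635892607609368341171764113276722225942767013022723127986214635997472,
    23376211387140377711275053019139891685029100973915650565185061322056138189970084240417275857618850509254429953648320,
    23376211387140377711275053019139891685029100973915650565185061322056138189970084240417275857618850509254429953648320,
    18097722859836045523772529865006621121957189918242362093763955610753477849244462463881198197865434883827379284771072,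
    14543545702445754165978872083696214082988149321424935620125990967305993841234935189821746913097151609461643174611968],
    [9341720849125744002257167236922752781989938533453751103693887470691616092596039875370171412360939552368360103841072,
    9341720849125744002257167236922752781989938533453751103693887470691616092596039875370171412360939552368360103841072,
    29438797562501390780393672331423249226652768768438795975373841640059568219034168446489907423462497558839456345805520,
    29438797562501390780393672331423249226652768768438795975373841640059568219034168446489907423462497558839456345805520,
    33680757757753563553931550850659655357687375289229492186193421168492686668516313365312605566557461891082642181744320,
    35304599329929263706664081262516598648308778496264180169362994791748565422734872842332308296831306779604357454736320,
    39392078757191557952714343944915560488424390381760365930566598193007564623154681709773698286566728461254900444831808,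
    39392078757191557952714343944915560488424390381760365930566598193007564623154681709773698286566728461254900444831808],
    [19101105634263924354583907908506184291337030006430981377977645212730159085870577171029219925259636802792218394197920,
    19101105634263924354583907908506184291337030006430981377977645212730159085870577171029219925259636802792218394197920,
    29438797562501390780393672331423249226652768768438795975373841640059568219034168446489907423462497558839456345805520,
    29438797562501390780393672331423249226652768768438795975373841640059568219034168446489907423462497558839456345805520,
    23376211387140377711275053019139891685029100973915650565185061322056138189970084240417275857618850509254429953648320,
    23376211387140377711275053019139891685029100973915650565185061322056138189970084240417275857618850509254429953648320,
    18097722859836045523772529865006621121957189918242362093763955610753477849244462463881198197865434883827379284771072,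
    14543545702445754165978872083696214082988149321424935620125990967305993841234935189821746913097151609461643174611968],
    [9341720849125744002257167236922752781989938533453751103693887470691616092596039875370171412360939552368360103841072,
    9341720849125744002257167236922752781989938533453751103693887470691616092596039875370171412360939552368360103841072,
    19348579565670373643470891706547887342563948942635892607609368341171764113276722225942767013022723127986214635997472,
    19348579565670373643470891706547887342563948942635892607609368341171764113276722225942767013022723127986214635997472,
    33680757757753563553931550850659655357687375289229492186193421168492686668516313365312605566557461891082642181744320,
    35304599329929263706664081262516598648308778496264180169362994791748565422734872842332308296831306779604357454736320,
    39392078757191557952714343944915560488424390381760365930566598193007564623154681709773698286566728461254900444831808,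
    39392078757191557952714343944915560488424390381760365930566598193007564623154681709773698286566728461254900444831808],
    [22723567086207235611622782106096302523430104800257692351258539798197143208502167786606873293514436485950214361684912,
    15559352619606346313537547186787921651745165903212590868092533479146573123435193339156179343740857676037786589874720,
    39392078757191557952714343944915560488424390381760365930566598193007564623154681709773698286566728461254900444831808,
    39392078757191557952714343944915560488424390381760365930566598193007564623154681709773698286566728461254900444831808,
    33487821021057535361260442659825676432757524176758771800495999805865335499661313829593995270172857582864679069789120,
    33487821021057535361260442659825676432757524176758771800495999805865335499661313829593995270172857582864679069789120,
    18097722859836045523772529865006621121957189918242362093763955610753477849244462463881198197865434883827379284771072,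
    14543545702445754165978872083696214082988149321424935620125990967305993841234935189821746913097151609461643174611968],
    [9371502607557669029073170535534939550667020343135457865159948204673474552965662072817432376290869492662976111389808,
    9371502607557669029073170535534939550667020343135457865159948204673474552965662072817432376290869492662976111389808,
    29385220040646928311500619475290425927850379972578224426651117322527416602473999359201102685904944885637045912675408,
    29385220040646928311500619475290425927850379972578224426651117322527416602473999359201102685904944885637045912675408,
    33680757757753563553931550850659655357687375289229492186193421168492686668516313365312605566557461891082642181744320,
    35304599329929263706664081262516598648308778496264180169362994791748565422734872842332308296831306779604357454736320,
    39392078757191557952714343944915560488424390381760365930566598193007564623154681709773698286566728461254900444831808,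
    39392078757191557952714343944915560488424390381760365930566598193007564623154681709773698286566728461254900444831808],
    [19101105634263924354583907908506184291337030006430981377977645212730159085870577171029219925259636802792218394197920,
    19101105634263924354583907908506184291337030006430981377977645212730159085870577171029219925259636802792218394197920,
    29410833575976432593285672928915186798723927726888073147370289856640463701859333058085766342571845750111432731947920,
    29410833575976432593285672928915186798723927726888073147370289856640463701859333058085766342571845750111432731947920,
    33680757757753563553931550850659655357687375289229492186193421168492686668516313365312605566557461891082642181744320,
    35304599329929263706664081262516598648308778496264180169362994791748565422734872842332308296831306779604357454736320,
    39392078757191557952714343944915560488424390381760365930566598193007564623154681709773698286566728461254900444831808,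
    39392078757191557952714343944915560488424390381760365930566598193007564623154681709773698286566728461254900444831808],
    [19347986656633453972818416966644240733561217097138989715108030334779048019200635823379168717109001330261442309506320,
    29437465835039795298709798191512551024366397416180489949647239374094175267462903977759908718302228421072764315922144,
    39392078757191557952714343944915560488424390381760365930566598193007564623154681709773698286566728461254900444831808,
    39392078757191557952714343944915560488424390381760365930566598193007564623154681709773698286566728461254900444831808,
    35470015954674928287245143628871442535679163547285487123732838573642680774492308089513212333938331953440900259944320,
    35470015954674928287245143628871442535679163547285487123732838573642680774492308089513212333938331953440900259944320,
    18097722859836045523772529865006621121957189918242362093763955610753477849244462463881198197865434883827379284771072,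
    14543545702445754165978872083696214082988149321424935620125990967305993841234935189821746913097151609461643174611968],
    [19101105634263924354583907908506184291337030006430981377977645212730159085870577171029219925259636802792218394197920,
    19101105634263924354583907908506184291337030006430981377977645212730159085870577171029219925259636802792218394197920,
    9371502607557669029073170535534939550667020343135457865159948204673474552965662072817432376290869492662976111389808,
    9371502607557669029073170535534939550667020343135457865159948204673474552965662072817432376290869492662976111389808,
    23376211387140377711275053019139891685029100973915650565185061322056138189970084240417275857618850509254429953648320,
    23376211387140377711275053019139891685029100973915650565185061322056138189970084240417275857618850509254429953648320,
    18097722859836045523772529865006621121957189918242362093763955610753477849244462463881198197865434883827379284771072,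
    14543545702445754165978872083696214082988149321424935620125990967305993841234935189821746913097151609461643174611968],
    [9371502607557669029073170535534939550667020343135457865159948204673474552965662072817432376290869492662976111389808,
    9371502607557669029073170535534939550667020343135457865159948204673474552965662072817432376290869492662976111389808,
    19378361324102298670286895005160074111241030752317599369075429075153622573646344423390027976952653068280830643546208,
    19378361324102298670286895005160074111241030752317599369075429075153622573646344423390027976952653068280830643546208,
    23376211387140377711275053019139891685029100973915650565185061322056138189970084240417275857618850509254429953648320,
    23376211387140377711275053019139891685029100973915650565185061322056138189970084240417275857618850509254429953648320,
    18097722859836045523772529865006621121957189918242362093763955610753477849244462463881198197865434883827379284771072,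
    14543545702445754165978872083696214082988149321424935620125990967305993841234935189821746913097151609461643174611968]].getD i []

/-- The words that define the points in the coset enumeration over the subgroup generated by the
`bⱼ`. -/
def cosetWords (i : ℕ) : List ℕ :=
  [[1, 4717, 621, 557, 4708, 39200, 4897, 4361, 612, 545, 4421, 37664, 548, 4932, 4704, 4941, 8,
    4429, 4456, 4940, 4712, 4461, 4937, 609, 616, 4864, 39008, 589, 552, 4385, 588, 39529, 9,
    4364, 4420, 4969, 4713, 4876, 77, 608, 617, 76, 39009, 37705, 553, 4869, 37641, 37741, 73,
    35432, 39520, 37636, 38945, 39201, 4877, 68, 37709, 544, 4900, 4868, 4428, 69, 4705, 4356],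
    [1, 606, 86, 78, 607, 609, 5491, 5084, 87, 5499, 5464, 5015, 79, 5012, 5086, 4834, 9, 4848,
    689, 624, 4857, 76, 39366, 4923, 697, 39311, 683, 4852, 633, 4915, 4860, 38672, 10, 4859,
    699, 635, 4850, 4889, 687, 4913, 691, 686, 681, 5470, 626, 4920, 5471, 604, 75, 4879, 5579,
    5067, 4878, 611, 5496, 614, 5514, 5488, 85, 39367, 5009, 615, 39310, 4832], [1, 621, 4845,
    685, 612, 39180, 39452, 680, 4836, 39117, 39019, 4971, 676, 673, 4898, 43653, 10, 618, 682,
    4842, 611, 5485, 4833, 43868, 675, 4840, 4877, 77, 4835, 43285, 76, 39201, 75, 4889, 5401,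
    4893, 4931, 43880, 605, 38691, 5456, 604, 39016, 609, 4948, 38762, 616, 4900, 9, 4897, 39116,
    5409, 4969, 312132, 5483, 84, 39453, 5410, 38765, 39185, 5480, 85, 39755, 39203], [1, 606,
    78, 86, 607, 683, 697, 39309, 79, 689, 4889, 4850, 87, 39365, 4859, 4832, 10, 39033, 5499,
    4923, 39025, 85, 5012, 624, 5491, 5084, 609, 4852, 4915, 633, 4860, 38672, 9, 5583, 5488,
    4913, 5518, 5464, 615, 635, 5496, 614, 611, 4878, 4920, 626, 4879, 604, 75, 5471, 5067, 5579,
    5470, 681, 691, 686, 5009, 699, 76, 4857, 5514, 687, 4848, 4834], [1, 621, 685, 4845, 612,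
    39180, 675, 4840, 676, 682, 43880, 4931, 4836, 4833, 4889, 39203, 75, 39755, 38724, 43868,
    39185, 38765, 673, 4842, 38669, 680, 4877, 77, 43285, 4835, 76, 39201, 10, 4898, 5410, 38691,
    4971, 38740, 85, 4893, 5483, 84, 39016, 609, 38762, 4948, 616, 4900, 9, 4897, 5409, 39116,
    4969, 312132, 5456, 604, 5480, 5401, 5485, 611, 39453, 605, 618, 43653], [1, 70, 78, 590, 71,
    5062, 4465, 4720, 79, 5007, 552, 37829, 591, 37864, 5065, 569, 73, 37767, 37774, 4876, 4864,
    4725, 4464, 37801, 4425, 624, 633, 558, 4420, 37865, 69, 608, 9, 553, 609, 4713, 625, 4712,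
    614, 4998, 561, 76, 4489, 4912, 4721, 39308, 560, 559, 8, 632, 568, 4728, 5063, 4729, 37702,
    589, 4920, 4553, 615, 4913, 37766, 4733, 4921, 4992], [1, 621, 4845, 685, 612, 39181, 38722,
    673, 4836, 38681, 39011, 618, 676, 680, 611, 313610, 10, 4971, 5388, 5483, 4898, 5485, 4840,
    5401, 5445, 4833, 4876, 77, 5410, 5456, 76, 39201, 75, 39755, 43284, 39139, 39185, 43653,
    605, 675, 43561, 604, 39008, 616, 39597, 682, 609, 4900, 9, 4969, 38760, 4892, 4897, 312068,
    4842, 84, 38689, 4835, 38765, 4931, 4949, 85, 4889, 39203], [1, 4845, 621, 685, 4836, 43882,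
    5409, 5401, 612, 5480, 4892, 39460, 676, 5460, 39021, 5445, 10, 4933, 675, 611, 4876, 5485,
    4931, 4969, 682, 4889, 39139, 605, 618, 4897, 604, 43563, 9, 4833, 673, 609, 4840, 39181, 77,
    4971, 680, 76, 39136, 39009, 616, 4898, 39465, 38765, 75, 312169, 39754, 4877, 312939, 43880,
    5410, 84, 39184, 5483, 4900, 39117, 4932, 85, 39189, 43868], [1, 590, 78, 70, 591, 4912, 625,
    4992, 79, 553, 4420, 4870, 71, 5065, 4728, 4999, 8, 4712, 608, 552, 4720, 558, 4553, 609,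
    560, 4489, 4465, 589, 624, 561, 4725, 39024, 9, 4729, 569, 633, 4429, 4876, 76, 568, 4921,
    615, 4464, 37833, 4871, 4920, 37760, 4733, 73, 38960, 4431, 37766, 37705, 4913, 5063, 559,
    5006, 632, 614, 4721, 4864, 69, 4713, 4878], [1, 86, 78, 606, 87, 5534, 4857, 39309, 79,
    4848, 611, 5579, 607, 39364, 5514, 681, 75, 39033, 39163, 5455, 39024, 604, 4923, 624, 39155,
    4915, 609, 687, 5454, 633, 686, 683, 9, 5086, 4895, 4913, 5015, 4834, 615, 5009, 4894, 614,
    4889, 4878, 4920, 5067, 4879, 85, 10, 691, 626, 4850, 699, 4832, 4996, 4860, 635, 5068, 76,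
    697, 4859, 4852, 689, 5071], [1, 78, 86, 606, 79, 5071, 5014, 38804, 87, 5087, 681, 39385,
    607, 38790, 39306, 611, 75, 5009, 5514, 4895, 5067, 604, 5496, 39119, 5579, 5488, 683, 615,
    4894, 39118, 614, 609, 10, 626, 691, 4850, 635, 4832, 687, 39327, 699, 686, 5464, 4920, 4859,
    39390, 4913, 76, 9, 624, 689, 4848, 633, 4834, 38662, 4860, 697, 38663, 85, 4923, 4857, 4852,
    4915, 4889]].getD i []

/-- The deductions of this coset enumeration. -/
def cosetSteps (i : ℕ) : List ℕ :=
  [[0, 1, 2, 3, 4, 5, 6, 7, 8, 9, 10, 11, 12, 13, 14, 15, 16, 17, 18, 19, 20, 21, 22, 23, 24, 25,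
    26, 27, 28, 29, 30, 31, 32, 33, 34, 35, 36, 37, 38, 39, 40, 41, 42, 43, 44, 45, 46, 47, 48,
    49, 50, 51, 52, 53, 54, 55, 56, 57, 58, 59, 60, 61, 62, 63, 2049, 2050, 2051, 2052, 2053,
    2054, 2055, 2056, 2057, 2058, 2059, 2060, 2061, 2062, 2063, 2064, 2065, 2066, 2067, 2068,
    2069, 2070, 2071, 2072, 2073, 2074, 2075, 2076, 2077, 2078, 2079, 2080, 2081, 2082, 2083,
    2084, 2085, 2086, 2087, 2088, 2089, 2090, 2091, 2092, 2093, 2094, 2095, 2096, 2097, 2098,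
    2099, 2100, 2101, 2102, 2103, 2104, 2105, 2106, 2107, 2108, 2109, 2110, 2111, 4272, 4103,
    4334, 4331, 4118, 4119, 6255, 6146, 6229, 8493, 8594, 8732, 12563, 12291, 12709, 8292, 8434,
    10366, 12825, 12289, 4332, 10829, 4195, 8792, 10378, 10437, 8811, 8380, 10458, 10389, 12550,
    8596, 10539, 6166, 10753, 10801, 12811, 8524, 12835, 8248, 12627, 8262, 12522, 12532, 12881,
    8810, 10360, 8474, 8463, 8379, 12404, 8338, 10629, 4284, 10681, 12871, 8563, 4278, 8559,
    8335, 8287, 4276, 6262, 4191], [80, 1, 82, 3, 84, 5, 88, 90, 92, 15, 37, 38, 39, 41, 42, 124,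
    125, 47, 2048, 2049, 2152, 2051, 2145, 2054, 2146, 2057, 2147, 2159, 2160, 2066, 2165, 2071,
    2162, 2074, 2163, 2077, 4272, 6145, 6148, 6243, 6252, 6160, 6266, 6256, 8324, 8328, 8332,
    8305, 8317, 8379, 8217, 8302, 8230, 10252, 10406, 14428, 18708, 4264, 4325, 12387, 4170,
    4179, 4351, 12754, 16610, 19032, 16851, 4348, 4274, 4275, 4191, 4256, 4280, 4165, 4258, 4330,
    4259, 10334, 10429, 16501, 21159, 10248, 16746, 10479, 10331, 6263, 18909, 6146, 12500,
    10251, 8344, 12668, 8203, 6172, 6268, 10492, 6248, 16627, 18597, 6147, 6169, 10430, 6249,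
    14454, 18553, 12574, 12347, 16797, 16457, 8205, 18843, 6228, 16558, 21083, 18638, 19026,
    10254, 16463, 8199, 10338, 21067, 12566, 14838, 16471, 16504, 4118, 12731, 16391, 13, 4173,
    12514, 18535, 2174, 12631, 2059, 12764, 16498, 94, 12697, 16481, 6225, 18833, 18591, 19045,
    18541, 4286, 16484, 4102, 12715, 16633, 12598, 12313, 20991, 12564, 14471, 12618, 18758,
    4331, 14766, 4119, 12742, 16621, 12337, 16885, 16777, 16863, 20982, 20631, 10255, 18788,
    18510, 19017, 2164, 4276, 12721, 20778, 16861, 16842, 12708, 19064, 19030, 16622, 19013,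
    18802, 18795, 18811, 19034, 12449, 18785, 18801, 16884], [1, 2, 3, 4, 5, 6, 7, 8, 9, 10, 11,
    12, 13, 14, 15, 16, 17, 18, 19, 20, 21, 22, 23, 24, 25, 26, 27, 28, 29, 30, 31, 32, 33, 34,
    35, 36, 37, 38, 39, 40, 41, 42, 43, 44, 45, 46, 47, 48, 49, 50, 51, 52, 53, 54, 55, 56, 57,
    58, 59, 60, 61, 62, 63, 2160, 2164, 2051, 2161, 2173, 2163, 2061, 2171, 2066, 2145, 2069,
    2070, 2146, 2150, 2074, 2075, 2155, 2079, 4096, 4171, 4098, 4214, 4100, 4199, 4106, 4108,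
    4187, 4221, 4198, 4116, 4120, 4124, 4128, 4132, 4223, 4222, 6304, 8193, 8314, 8277, 6343,
    6370, 6257, 6308, 6241, 14574, 10712, 12743, 6334, 16455, 6267, 16974, 10449, 16684, 6376,
    10579, 6251, 12504, 16819, 6349, 6160, 6161, 6155, 16805, 10600, 16663, 10486, 12409, 10647,
    12796, 10355, 10338, 12573, 12338, 16917, 14681, 10424, 14462, 10259, 10284, 12653, 16714,
    16986, 12293, 12735, 12687, 12681, 16710, 10505, 10556, 12467, 12422, 10363, 12700, 12707,
    16586, 12341, 10488, 10297, 12581, 16758, 10693, 10649, 6252, 10612, 14487, 16442, 6266,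
    10471, 12674, 12728, 6351, 10319, 6367, 16838, 16754, 12711, 12701, 6371, 6358, 10248, 6149,
    10346, 6325, 10285, 10326, 14687, 6250], [96, 1, 2, 73, 123, 5, 6, 93, 10, 111, 17, 20, 117,
    26, 127, 119, 35, 38, 125, 120, 2048, 2049, 2050, 2166, 2126, 2053, 2163, 2151, 2057, 2169,
    2066, 2067, 2072, 2076, 2162, 2160, 2090, 2095, 4272, 6145, 6148, 6151, 6157, 6229, 6253,
    6247, 6176, 6256, 8324, 8328, 8332, 8305, 8317, 8302, 8230, 10248, 10429, 18525, 4278, 4303,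
    4197, 4298, 16590, 4183, 16633, 24984, 4344, 20920, 16855, 4213, 4281, 4274, 4284, 4275,
    4263, 4112, 20589, 4314, 12533, 4319, 10334, 10252, 16757, 22806, 24857, 10406, 12650, 14554,
    16852, 16490, 10479, 10331, 6249, 6147, 22636, 6225, 6173, 24823, 8289, 23046, 6262, 14794,
    16595, 18792, 22838, 8379, 6146, 14799, 16866, 10414, 6155, 22607, 12776, 20706, 20904,
    12636, 16406, 25057, 6264, 12796, 16626, 10361, 20788, 20811, 25148, 25176, 10427, 16467,
    16479, 6187, 16796, 20766, 25046, 25132, 16546, 16485, 22692, 22894, 10319, 16391, 23001,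
    23118, 22696, 24939, 25108, 2147, 30, 18843, 10273, 16511, 22881, 14616, 16581, 6153, 12626,
    14611, 25097, 2174, 116, 25139, 25060, 14349, 16883, 16561, 12301, 2068, 22795, 24799, 24669,
    16461, 24955, 20881, 23111, 24702, 4114, 4332, 18558, 8344, 18609, 4103, 25189, 22683, 4305,
    12516, 18788, 24831, 10417, 4185, 16894, 18574, 12532], [1, 2, 3, 4, 5, 6, 7, 8, 9, 10, 11,
    12, 13, 14, 15, 16, 17, 18, 19, 20, 21, 22, 23, 24, 25, 26, 27, 28, 29, 30, 31, 32, 33, 34,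
    35, 36, 37, 38, 39, 40, 41, 42, 43, 44, 45, 46, 47, 48, 49, 50, 51, 52, 53, 54, 55, 56, 57,
    58, 59, 60, 61, 62, 63, 2160, 2164, 2050, 2161, 2169, 2173, 2162, 2057, 2170, 2061, 2062,
    2068, 2070, 2150, 2074, 2075, 2155, 2079, 4096, 4196, 4200, 4099, 4100, 4102, 4104, 4198,
    4107, 4195, 4111, 4112, 4113, 4221, 4123, 4125, 4219, 6288, 8193, 8314, 8277, 16804, 6257,
    6265, 6233, 6155, 6350, 14574, 6289, 6228, 16481, 18913, 6230, 6262, 10441, 6176, 6180, 6334,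
    12414, 6379, 12505, 18788, 12743, 12314, 10344, 12793, 18588, 12631, 16483, 16442, 16921,
    12622, 18745, 8376, 10703, 16812, 16725, 6346, 10396, 16552, 16760, 16586, 16847, 16434,
    12312, 14627, 6378, 12634, 8423, 18531, 8477, 12479, 16866, 18648, 4213, 4211, 2066, 6226,
    10503, 14739, 6271, 12632, 10663, 2076, 6323, 16628, 10684, 12732, 16501, 18861, 18957,
    16533, 10533, 18661, 18669, 18647, 6239, 16403, 14673, 18627, 2156, 18732, 12639, 12401,
    18437, 6301, 6156, 12421, 12469, 6183], [0, 1, 2, 3, 4, 5, 6, 7, 8, 9, 10, 11, 12, 13, 14,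
    15, 16, 17, 18, 19, 20, 21, 22, 23, 24, 25, 26, 27, 28, 29, 30, 31, 32, 33, 34, 35, 36, 37,
    38, 39, 40, 41, 42, 43, 44, 45, 46, 47, 48, 49, 50, 51, 52, 53, 54, 55, 56, 57, 58, 59, 60,
    61, 62, 63, 2192, 2218, 2148, 2233, 2190, 2264, 2274, 4181, 4106, 4107, 4221, 4215, 4194,
    4126, 4128, 4219, 6276, 6280, 6284, 6324, 6225, 6319, 6330, 8194, 8219, 10468, 14568, 14383,
    14876, 8311, 8277, 8193, 12358, 8358, 10338, 12511, 8317, 4218, 4100, 12641, 4210, 4207,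
    4104, 6312, 8284, 12831, 14681, 12392, 12623, 14443, 6159, 10732, 14420, 14699, 4222, 10361,
    14570, 4116, 12409, 8395, 4122, 6265, 10478, 10540, 12631, 14413, 12567, 12405, 12823, 14564,
    6155, 12799, 8430, 12788, 2181, 12650, 6157, 8210, 10541, 10589, 10558, 14631, 6153, 10566,
    12502, 4150, 12598, 6315, 10702, 14542, 4101, 12306, 12615, 14652, 8309, 8333, 2205, 14503,
    14445, 6237, 8357, 2065, 12647, 8201, 10633, 12625, 14347, 14742, 2171, 10287, 14563, 12529,
    10524, 10684, 8344, 12668, 12643, 10619, 12509, 14439, 8278, 10488, 14854, 14881, 6243,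
    14364, 14462], [1, 2, 3, 4, 5, 6, 7, 8, 9, 10, 11, 12, 13, 14, 15, 16, 17, 18, 19, 20, 21,
    22, 23, 24, 25, 26, 27, 28, 29, 30, 31, 32, 33, 34, 35, 36, 37, 38, 39, 40, 41, 42, 43, 44,
    45, 46, 47, 48, 49, 50, 51, 52, 53, 54, 55, 56, 57, 58, 59, 60, 61, 62, 63, 2160, 2161, 2050,
    2164, 2055, 2168, 2057, 2173, 2174, 2148, 2150, 2071, 2152, 2073, 2074, 2075, 2157, 2158,
    2079, 4096, 4177, 4179, 4100, 4182, 4106, 4187, 4108, 4110, 4191, 4128, 4129, 4131, 4134,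
    4135, 4217, 4219, 4221, 4223, 6304, 8193, 8314, 8277, 14670, 16494, 20593, 6359, 18961, 6349,
    6260, 6345, 6331, 6270, 20715, 6335, 10599, 12615, 18840, 6305, 6244, 6150, 18748, 6254,
    18435, 6160, 6161, 6326, 6343, 6361, 6155, 6365, 22765, 6159, 22655, 16510, 22620, 12795,
    20895, 18546, 20485, 10461, 23013, 18660, 22612, 20714, 12631, 8428, 18885, 2060, 18853,
    2163, 6307, 22651, 10707, 14835, 18904, 10248, 14793, 18562, 19030, 22726, 18706, 18476,
    22986, 10694, 12392, 20741, 22774, 2165, 2069, 14419, 12469, 12709, 14634, 18938, 12572,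
    22716, 4181, 12322, 6163, 12716, 6264, 12346, 6248, 23160, 4178, 6242, 14562, 22898], [1, 2,
    3, 4, 5, 6, 7, 8, 9, 10, 11, 12, 13, 14, 15, 16, 17, 18, 19, 20, 21, 22, 23, 24, 25, 26, 27,
    28, 29, 30, 31, 32, 33, 34, 35, 36, 37, 38, 39, 40, 41, 42, 43, 44, 45, 46, 47, 48, 49, 50,
    51, 52, 53, 54, 55, 56, 57, 58, 59, 60, 61, 62, 63, 2144, 2135, 2051, 2054, 2055, 2141, 2058,
    2161, 2158, 2137, 2155, 2069, 2075, 2145, 2082, 2083, 2086, 2173, 2093, 4096, 4199, 4217,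
    4181, 4104, 4186, 4108, 4191, 4114, 4115, 4118, 4119, 4221, 4198, 4208, 4148, 6320, 6237,
    8303, 8194, 8277, 10515, 14631, 6311, 6215, 6233, 6166, 12520, 14921, 6392, 6370, 12370,
    14481, 6371, 6322, 14744, 6172, 6160, 12749, 12474, 6157, 14965, 8199, 10449, 8526, 12635,
    12628, 10718, 12700, 6168, 2074, 6250, 6241, 12378, 6251, 10622, 12750, 6244, 10561, 12566,
    6254, 14539, 14351, 12740, 12703, 14657, 6266, 14955, 12380, 10351, 12489, 6270, 14644,
    14479, 12527, 12476, 6257, 12799, 10532, 14470, 14446, 12594, 14974, 14954, 14753, 14395,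
    4211, 6323, 10673, 12593, 6335, 12863, 14841, 2102, 6214, 6175, 12420, 10748, 14821, 10422,
    14843, 12645, 12661, 8376, 6155, 10617, 10612, 14885, 14853], [0, 1, 2, 3, 4, 5, 6, 7, 8, 9,
    10, 11, 12, 13, 14, 15, 16, 17, 18, 19, 20, 21, 22, 23, 24, 25, 26, 27, 28, 29, 30, 31, 32,
    33, 34, 35, 36, 37, 38, 39, 40, 41, 42, 43, 44, 45, 46, 47, 48, 49, 50, 51, 52, 53, 54, 55,
    56, 57, 58, 59, 60, 61, 62, 63, 2224, 2171, 2118, 2201, 2219, 2189, 2198, 2292, 2199, 4190,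
    4207, 4196, 4179, 4221, 4119, 4123, 4128, 6276, 6280, 6284, 6316, 6327, 6249, 8200, 8375,
    10467, 12486, 12343, 8411, 8204, 14876, 8303, 18659, 8361, 14629, 14760, 16680, 16791, 18853,
    8286, 4218, 4099, 16438, 14908, 4181, 6159, 4113, 14753, 16862, 4098, 6326, 8377, 16821,
    10408, 12539, 12502, 4124, 8207, 18814, 6237, 2138, 16810, 14429, 14897, 16658, 14453, 16482,
    18479, 16945, 6241, 8353, 12628, 14413, 16882, 4223, 18613, 2163, 19028, 14614, 8424, 4135,
    14631, 16920, 10475, 18495, 10674, 4214, 19019, 18969, 18852, 4138, 8266, 18831, 12411,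
    14855, 6324, 10424, 4216, 16647, 6157, 10586, 16700, 16666, 16910, 14879, 2250, 14445, 18796,
    12787, 16830, 16664, 10363, 19033, 12494, 12779, 12580, 14450, 16888, 18676, 10738, 14577,
    18798, 14431, 14763, 6151, 19013, 14729], [96, 126, 2, 3, 123, 6, 93, 106, 15, 17, 107, 21,
    26, 35, 38, 39, 2048, 2161, 2050, 2051, 2164, 2168, 2058, 2059, 2172, 2174, 2064, 2066, 2069,
    2070, 2072, 2073, 2157, 2079, 4240, 6147, 6151, 6156, 6252, 6160, 6167, 6173, 6176, 6191,
    8324, 8328, 8332, 8290, 8275, 8302, 8219, 8230, 10248, 10267, 12381, 4145, 4202, 4183, 14590,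
    4327, 4235, 4269, 18974, 4314, 4148, 4238, 4272, 4280, 10359, 10325, 10406, 16866, 10244,
    14766, 16473, 18593, 10365, 6249, 6145, 8383, 10361, 16649, 6146, 119, 19043, 6238, 14366,
    4321, 19, 4179, 16782, 6258, 14695, 14422, 4305, 16902, 4323, 14872, 8344, 12580, 12571,
    6264, 14840, 16441, 14844, 6268, 19005, 16523, 18889, 8198, 12411, 16790, 2057, 4275, 18930,
    16685, 18600, 12394, 12405, 12404, 14870, 10404, 14718, 10273, 14862, 14801, 16758, 14907,
    12694, 12700, 4281, 16886, 16935, 18853, 18751, 14554, 17017, 8372, 18759, 18740, 18865,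
    18807, 14891, 8217, 16731, 18841, 6225, 14763, 8199, 18862, 2054, 4284, 4188, 14735, 18703,
    4332, 18826, 18495, 12372, 14605, 10358, 14562, 14556, 18565, 18981, 4114, 16949, 10245,
    14773, 4103, 14568, 14488, 16479, 16659, 4308, 16420, 16691, 4287, 16916, 16907, 4349, 12756,
    16563, 16389, 16717, 14418, 16786, 6186, 14546, 14431, 14559], [0, 1, 98, 3, 100, 104, 108,
    110, 15, 16, 114, 20, 21, 24, 26, 123, 126, 2160, 2049, 2162, 2051, 2164, 2168, 2058, 2059,
    2172, 2175, 2065, 2069, 2150, 2153, 2074, 2075, 2158, 2079, 4240, 4299, 6147, 6243, 6156,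
    6160, 6266, 6256, 8324, 8328, 8332, 8275, 8215, 8219, 8313, 8230, 10244, 10406, 4177, 20554,
    4244, 4248, 4242, 4298, 4110, 4128, 14578, 18548, 22756, 4130, 4132, 16625, 4136, 4191, 4209,
    4330, 4331, 4286, 4223, 10359, 10325, 10248, 20745, 10267, 12511, 16479, 22635, 10365, 6238,
    6146, 16883, 8201, 18931, 8197, 10249, 6260, 6249, 105, 6145, 12654, 14509, 14493, 18539,
    20759, 22779, 14553, 6162, 23026, 8340, 10245, 22753, 12651, 8218, 20683, 22740, 22731, 119,
    8359, 20665, 20883, 22888, 16393, 16701, 20749, 20774, 22782, 10266, 18538, 18774, 22998,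
    20755, 20844, 25, 6248, 8360, 14546, 16892, 2169, 2061, 14643, 109, 4189, 14445, 6, 14662,
    21007, 20998, 10279, 20613, 20558, 23001, 22730, 14646, 6253, 4131, 23033, 10381, 14748,
    14764, 10268, 14670, 16600, 20906, 10284, 23010, 12509, 14358, 4243, 23039, 4221, 14759,
    18839, 8289, 18742, 18438, 12645, 6264, 101, 4277, 20935, 21045, 20887, 22872, 4220, 4188,
    22695, 12727, 10422, 12295, 16593, 18641, 21006, 4101, 22901, 14844, 23047]].getD i []

/-- The action of the letters on the elements of the subgroup generated by the `bⱼ`. -/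
def subBTabs (i : ℕ) : List ℕ :=
  [[5436612672, 5436612672, 5436612672, 5436612672, 84947073, 4345827333, 5436612672, 5436612672],
    [5436612672, 5436612672, 5436612672, 5436612672, 3256107009, 3256107009, 17846466,
    2198077701], [5436612672, 5436612672, 5436612672, 5436612672, 84947073, 4345827333,
    5436612672, 5436612672], [5436612672, 5436612672, 5436612672, 5436612672, 3256107009,
    3256107009, 17846466, 2198077701], [5436612672, 5436612672, 5436612672, 5436612672, 84947073,
    4345827333, 5436612672, 5436612672], [5436612672, 5436612672, 5436612672, 5436612672,
    3256107009, 3256107009, 17846466, 2198077701], [5436612672, 5436612672, 5436612672,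
    5436612672, 84947073, 4345827333, 5436612672, 5436612672], [5436612672, 5436612672,
    5436612672, 5436612672, 84947073, 4345827333, 5436612672, 5436612672], [5436612672,
    5436612672, 5436612672, 5436612672, 3256107009, 3256107009, 17846466, 2198077701],
    [5436612672, 5436612672, 5436612672, 5436612672, 3256107009, 3256107009, 17846466,
    2198077701], [5436612672, 5436612672, 5436612672, 5436612672, 3256107009, 3256107009,
    17846466, 2198077701]].getD i []

/-- The words that define the elements of the subgroup generated by the `bⱼ`. -/
def subBWords (i : ℕ) : List ℕ :=
  [[1, 12, 100, 804, 109, 13], [1, 12, 14, 102, 116, 15], [1, 12, 100, 804, 109, 13], [1, 12, 14,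
    102, 116, 15], [1, 12, 100, 804, 109, 13], [1, 12, 14, 102, 116, 15], [1, 12, 100, 804, 109,
    13], [1, 12, 100, 804, 109, 13], [1, 12, 14, 102, 116, 15], [1, 12, 14, 102, 116, 15], [1,
    12, 14, 102, 116, 15]].getD i []

/-- The deductions in the enumeration of the subgroup generated by the `bⱼ`. -/
def subBSteps (i : ℕ) : List ℕ :=
  [[2048, 2049, 2050, 2051, 2052, 2053, 6276], [6144, 6146, 8261, 10373, 10305, 6147, 8260], [0, 1,
    2, 3, 4, 5, 8324], [6144, 6146, 8261, 10373, 10305, 6147, 8260], [0, 1, 2, 3, 4, 5, 8324],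
    [4096, 4098, 6213, 8323, 8388, 4165, 6212], [0, 1, 2, 3, 4, 5, 8324], [0, 1, 2, 3, 4, 5,
    8324], [4096, 4098, 6213, 8325, 8257, 4099, 6212], [6144, 6146, 8261, 10373, 10305, 6147,
    8260], [6144, 6146, 8261, 10373, 10305, 6147, 8260]].getD i []

/-- The coset `v B` corresponds to the image of the point `0` under `v`. Therefore the 64 nodes are
the points of the quadrangle, the tables of the realization on the model serve as the coset table,
and the letters `4` and `6` are loops at `0`. -/
theorem enumerate_cosets : (List.range 11).all (fun i =>
    enumerate 64 [0, 1, 2, 3] [4, 6] (relWords i) (letterTabs i) (cosetWords i) (cosetSteps i)) =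
      true := by
  decide +kernel

/-- Here the group acts on itself by left multiplication and the orbit of `1` under the `bⱼ` is
enumerated; hence there are no loops to start from, and only six nodes. -/
theorem enumerate_subB : (List.range 11).all (fun i =>
    enumerate 6 [2, 3] [] (relWords i) (subBTabs i) (subBWords i) (subBSteps i)) = true := by
  decide +kernel

theorem relWords_lt : (List.range 11).all (fun i =>
    (relWords i).all fun w => w.all fun l => Nat.blt l 8) = true := by
  decide +kernel

theorem letter_lt (i : Fin 11) : ∀ w ∈ relWords i, ∀ l ∈ w, l < 8 := by
  intro w hw l hl
  have := List.all_eq_true.1 (List.all_eq_true.1 (forall_lt_of_all relWords_lt i i.2) w hw) l hl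
  rwa [Nat.blt_eq] at this

theorem finite_card_subB (i : Fin 11) :
    Finite (presL i).subB ∧ Nat.card (presL i).subB ≤ 6 := by
  have h : ∀ v : (presL i).subB, ∃ q : Fin 6,
      (v : (presL i).Grp) = codeWord (gen (presL i)) ((subBWords i).getD q 0) := by
    rintro ⟨v, hv⟩
    obtain ⟨q, hq, h⟩ := exists_eq_codeWord_smul (forall_lt_of_all enumerate_subB i i.2)
      (1 : (presL i).Grp) (by simp) (by simp) (word_gen_eq_one i) (letter_lt i) (by norm_num) v
      (subB_le i (S := Subgroup.closure {u | ∃ k ∈ [2, 3], u = gen (presL i) k})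
        (fun k h2 h4 => Subgroup.subset_closure ⟨k, by simp; omega, rfl⟩) hv)
    simp only [smul_eq_mul, mul_one] at h
    exact ⟨⟨q, hq⟩, h⟩
  choose f hf using h
  have hinj : Function.Injective f := fun v w hvw => Subtype.ext (by rw [hf, hf, hvw])
  exact ⟨Finite.of_injective f hinj, by simpa using Nat.card_le_card_of_injective f hinj⟩

theorem finite_card_quotient_subB (i : Fin 11) :
    Finite ((presL i).Grp ⧸ (presL i).subB) ∧ Nat.card ((presL i).Grp ⧸ (presL i).subB) ≤ 64 := by
  have h : ∀ v : (presL i).Grp ⧸ (presL i).subB, ∃ q : Fin 64,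
      v = codeWord (gen (presL i)) ((cosetWords i).getD q 0) •
        (QuotientGroup.mk 1 : (presL i).Grp ⧸ (presL i).subB) := by
    intro v
    obtain ⟨v, rfl⟩ := QuotientGroup.mk_surjective v
    have hmem : v ∈ Subgroup.closure (Set.range fun k : Fin 4 => gen (presL i) k) := by
      rw [closure_gen]
      trivial
    obtain ⟨q, hq, h⟩ := exists_eq_codeWord_smul (forall_lt_of_all enumerate_cosets i i.2)
      (QuotientGroup.mk 1 : (presL i).Grp ⧸ (presL i).subB) (by simp) (by
        intro l hl
        have hmk : ∀ b ∈ (presL i).subB, b • (QuotientGroup.mk 1 : (presL i).Grp ⧸ (presL i).subB) =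
            QuotientGroup.mk 1 := by
          intro b hb
          rw [MulAction.Quotient.smul_mk, smul_eq_mul, mul_one, eq_comm, QuotientGroup.eq]
          simpa using hb
        simp only [List.mem_cons, List.not_mem_nil, or_false] at hl
        refine ⟨by omega, hmk _ (letter_mem (gen_mem_subB i (by omega)))⟩)
      (word_gen_eq_one i) (letter_lt i) (by norm_num) v
      (Subgroup.closure_mono (by
        rintro _ ⟨k, rfl⟩
        exact ⟨k, by fin_cases k <;> simp, rfl⟩) hmem)
    refine ⟨⟨q, hq⟩, ?_⟩
    rw [← h, MulAction.Quotient.smul_mk, smul_eq_mul, mul_one]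
  choose f hf using h
  have hinj : Function.Injective f := fun v w hvw => by rw [hf v, hf w, hvw]
  exact ⟨Finite.of_injective f hinj, by simpa using Nat.card_le_card_of_injective f hinj⟩

/-- The presented groups have at most `384` elements. -/
theorem finite_card_le (i : Fin 11) : Finite (presL i).Grp ∧ Nat.card (presL i).Grp ≤ 384 := by
  obtain ⟨h1, h2⟩ := finite_card_subB i
  obtain ⟨h3, h4⟩ := finite_card_quotient_subB i
  have hmul := Subgroup.card_eq_card_quotient_mul_card_subgroup (presL i).subB
  have : Nat.card (presL i).Grp ≠ 0 := by
    rw [hmul]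
    exact (Nat.mul_pos Nat.card_pos Nat.card_pos).ne'
  refine ⟨Nat.finite_of_card_ne_zero this, ?_⟩
  rw [hmul]
  exact Nat.mul_le_mul h4 h2


/-! ### Realizations of the presented groups on the model -/

/-- Words for the elements of the subgroup generated by the `aⱼ`. -/
def aWords (i : ℕ) : List (List ℕ) :=
  if Nat.beq ([1, 2, 2, 2, 2, 1, 2, 2, 1, 2, 2].getD i 0) 1 then [[], [0], [0, 0], [0, 0, 0]]
  else [[], [0], [2], [0, 2]]

/-- Words for the elements of the subgroup generated by the `bⱼ`. -/
def bWords (i : ℕ) : List (List ℕ) :=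
  if Nat.beq ([1, 2, 1, 2, 1, 2, 1, 1, 2, 2, 2].getD i 0) 1 then
    [[], [4], [4, 4], [4, 4, 4], [4, 4, 4, 4], [4, 4, 4, 4, 4]]
  else [[], [4], [6], [6, 6], [4, 6], [4, 6, 6]]

/-- The relators in the `aⱼ`, including `a₂` if this generator does not occur. -/
def allRelA (i : ℕ) : List (List ℕ) :=
  (relMissing i).filter (fun w => w.all fun l => Nat.blt l 4) ++ relA i

/-- The relators in the `bⱼ`, including `b₂` if this generator does not occur. -/
def allRelB (i : ℕ) : List (List ℕ) :=
  (relMissing i).filter (fun w => w.all fun l => Nat.ble 4 l) ++ relB i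

/-- The images `y k` of generators satisfy the conditions on the `aⱼ`: the relators hold, they fix the
base line, and move the base point to all points of the base line. -/
structure GoodA (i : ℕ) (y : ℕ → ModelAut) : Prop where
  rel : ∀ w ∈ allRelA i, word y w = 1
  fix : ∀ k < 2, ln (y k) baseLine = baseLine
  trans : ∀ p, ModelInc p baseLine → ∃ w ∈ aWords i, pt (word y w) 0 = p

/-- The images `y k` of generators satisfy the conditions on the `bⱼ`: the relators hold, they fix the
base point, and move the base line to all lines through the base point. -/
structure GoodB (i : ℕ) (y : ℕ → ModelAut) : Prop where
  rel : ∀ w ∈ allRelB i, word y w = 1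
  fix : ∀ k, 2 ≤ k → k < 4 → pt (y k) 0 = 0
  trans : ∀ d, ∃ w ∈ bWords i, ln (word y w) baseLine = lineThrough d 0

/-- Images of generators that define a homomorphism whose image is regular on edges. -/
structure Good (i : ℕ) (y : ℕ → ModelAut) : Prop where
  a : GoodA i y
  b : GoodB i y
  rel : ∀ w ∈ relC i, word y w = 1

theorem relWords_cases (i : Fin 11) :
    ∀ w ∈ relWords i, w ∈ allRelA i ∨ w ∈ allRelB i ∨ w ∈ relC i := by
  revert i
  decide +kernel

theorem aWords_lt (i : ℕ) : ∀ w ∈ aWords i, ∀ l ∈ w, l < 4 := by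
  unfold aWords
  split_ifs <;> decide

theorem bWords_lt (i : ℕ) : ∀ w ∈ bWords i, ∀ l ∈ w, 4 ≤ l ∧ l < 8 := by
  unfold bWords
  split_ifs <;> decide

theorem Good.word_eq_one {i : Fin 11} {y : ℕ → ModelAut} (h : Good i y) :
    ∀ w ∈ relWords i, word y w = 1 := by
  intro w hw
  rcases relWords_cases i w hw with hw | hw | hw
  · exact h.a.rel w hw
  · exact h.b.rel w hw
  · exact h.rel w hw

/-- The stabilizer of the base line. -/
def stabLine : Subgroup ModelAut where
  carrier := {g | ln g baseLine = baseLine}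
  mul_mem' {g h} hg hh := by
    simp only [Set.mem_ofPred_eq] at *
    rw [ln_mul, hh, hg]
  one_mem' := ln_one _
  inv_mem' {g} hg := by
    simp only [Set.mem_ofPred_eq] at *
    have := ln_inv_ln g baseLine
    rwa [hg] at this

/-- The stabilizer of the base point. -/
def stabPoint : Subgroup ModelAut where
  carrier := {g | pt g 0 = 0}
  mul_mem' {g h} hg hh := by
    simp only [Set.mem_ofPred_eq] at *
    rw [pt_mul, hh, hg]
  one_mem' := pt_one _
  inv_mem' {g} hg := by
    simp only [Set.mem_ofPred_eq] at *
    have := pt_inv_pt g 0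
    rwa [hg] at this

theorem GoodA.word_fix {i : ℕ} {y : ℕ → ModelAut} (h : GoodA i y) {w : List ℕ}
    (hw : w ∈ aWords i) : ln (word y w) baseLine = baseLine :=
  word_mem (S := stabLine) fun l hl => h.fix _ (by have := aWords_lt i w hw l hl; omega)

theorem GoodB.word_fix {i : ℕ} {y : ℕ → ModelAut} (h : GoodB i y) {w : List ℕ}
    (hw : w ∈ bWords i) : pt (word y w) 0 = 0 :=
  word_mem (S := stabPoint) fun l hl => h.fix _ (by have := bWords_lt i w hw l hl; omega)
    (by have := bWords_lt i w hw l hl; omega)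

theorem word_congr {G : Type*} [Group G] {x y : ℕ → G} {w : List ℕ}
    (h : ∀ l ∈ w, x (l / 2) = y (l / 2)) : word x w = word y w := by
  unfold word
  congr 1
  refine List.map_congr_left fun l hl => ?_
  unfold letter
  rw [h l hl]

/-- The conditions `GoodA` and `GoodB` provide local transitivity only. It is the bound of
`finite_card_le` that turns it into regularity and identifies `subA` and `subB` with the stabilizers
of the base line and the base point. -/
theorem Good.exists_regular {i : Fin 11} {y : ℕ → ModelAut} (h : Good i y) :
    ∃ ρ : (presL i).Grp →* ModelAut, (∀ k < 4, ρ (gen (presL i) k) = y k) ∧ IsEdgeRegular ρ ∧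
      ActionIso ρ (presL i).action := by
  obtain ⟨ρ, hρ⟩ := exists_hom i y h.word_eq_one
  have hword : ∀ w : List ℕ, (∀ l ∈ w, l < 8) → ρ (word (gen (presL i)) w) = word y w := by
    intro w hw
    rw [map_word]
    exact word_congr fun l hl => hρ _ (by have := hw l hl; omega)
  obtain ⟨hfin, hcard⟩ := finite_card_le i
  refine ⟨ρ, hρ, regular_of_card_le ρ hcard (presL i).subA (presL i).subB ?_ ?_ ?_ ?_⟩
  · intro v hv
    have : (presL i).subA ≤ stabLine.comap ρ := subA_le i fun k hk => by
      rw [Subgroup.mem_comap, hρ k (by omega)]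
      exact h.a.fix k hk
    exact this hv
  · intro v hv
    have : (presL i).subB ≤ stabPoint.comap ρ := subB_le i fun k hk hk' => by
      rw [Subgroup.mem_comap, hρ k hk']
      exact h.b.fix k hk hk'
    exact this hv
  · intro p hp
    obtain ⟨w, hw, hwp⟩ := h.a.trans p hp
    refine ⟨word (gen (presL i)) w, word_mem fun l hl => gen_mem_subA i ?_, ?_⟩
    · have := aWords_lt i w hw l hl
      omega
    · rw [hword w fun l hl => (aWords_lt i w hw l hl).trans (by norm_num), hwp]
  · intro d
    obtain ⟨w, hw, hwd⟩ := h.b.trans d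
    refine ⟨word (gen (presL i)) w, word_mem fun l hl => gen_mem_subB i ?_, ?_⟩
    · have := bWords_lt i w hw l hl
      omega
    · rw [hword w fun l hl => (bWords_lt i w hw l hl).2, hwd]

theorem conj_letter {G : Type*} [Group G] (η : G) (y : ℕ → G) (w : List ℕ) :
    word (fun k => η * y k * η⁻¹) w = η * word y w * η⁻¹ := by
  have := map_word (MulAut.conj η).toMonoidHom y w
  simpa using this.symm

/-- All conditions refer to relators, the base point and the base line, so they survive conjugation
by an automorphism that fixes the base edge. -/
theorem Good.conj {i : ℕ} {y : ℕ → ModelAut} (h : Good i y) {η : ModelAut} (h0 : pt η 0 = 0)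
    (hl : ln η baseLine = baseLine) : Good i fun k => η * y k * η⁻¹ := by
  have h0' : pt η⁻¹ 0 = 0 := (stabPoint.inv_mem h0 :)
  have hl' : ln η⁻¹ baseLine = baseLine := (stabLine.inv_mem hl :)
  refine ⟨⟨fun w hw => ?_, fun k hk => ?_, fun p hp => ?_⟩,
    ⟨fun w hw => ?_, fun k hk hk' => ?_, fun d => ?_⟩, fun w hw => ?_⟩
  · rw [conj_letter, h.a.rel w hw, mul_one, mul_inv_cancel]
  · rw [ln_mul, ln_mul, hl', h.a.fix k hk, hl]
  · obtain ⟨w, hw, hwp⟩ := h.a.trans (pt η⁻¹ p) (by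
      rw [← modelInc_map_iff η⁻¹, hl'] at hp
      exact hp)
    exact ⟨w, hw, by rw [conj_letter, pt_mul, pt_mul, h0', hwp, pt_pt_inv]⟩
  · rw [conj_letter, h.b.rel w hw, mul_one, mul_inv_cancel]
  · rw [pt_mul, pt_mul, h0', h.b.fix k hk hk', h0]
  · have hline := (modelInc_map_iff η⁻¹ 0 _).2 (modelInc_lineThrough d 0)
    rw [h0'] at hline
    obtain ⟨w, hw, hwd⟩ := h.b.trans (ln η⁻¹ (lineThrough d 0)).1
    refine ⟨w, hw, ?_⟩
    rw [conj_letter, ln_mul, ln_mul, hl', hwd, ← modelInc_iff.1 hline, ← ln_mul, mul_inv_cancel,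
      ln_one]
  · rw [conj_letter, h.rel w hw, mul_one, mul_inv_cancel]

/-! ### Testing realizations given by tables -/

/-- The action of a word on points, where the letters act by tables. -/
def evalWord (tabs : List ℕ) : List ℕ → ℕ → ℕ
  | [], p => p
  | l :: w, p => ap (tabs.getD l 0) (evalWord tabs w p)

/-- The letters have arbitrary values here, without the convention about inverses, because the
certificates of the classification use words in arbitrary elements of a group. -/
theorem pt_prod {tabs : List ℕ} {e : ℕ → ModelAut} {w : List ℕ}
    (h : ∀ l ∈ w, Rep (tabs.getD l 0) (e l)) (p : Fin 64) :
    (pt (w.map e).prod p : ℕ) = evalWord tabs w p := by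
  induction w with
  | nil => exact congrArg Fin.val (pt_one p)
  | cons l w ih =>
    rw [List.map_cons, List.prod_cons, pt_mul, h l (by simp), ih fun m hm => h m (by simp [hm])]
    rfl

theorem pt_word {tabs : List ℕ} {y : ℕ → ModelAut} {w : List ℕ}
    (h : ∀ l ∈ w, Rep (tabs.getD l 0) (letter y l)) (p : Fin 64) :
    (pt (word y w) p : ℕ) = evalWord tabs w p := pt_prod h p

/-- The test for `GoodA`. -/
def goodA (i : ℕ) (tabs : List ℕ) : Bool :=
  (allRelA i).all (fun w => isId (evalWord tabs w)) &&
  ([0, 2].all fun l => Nat.beq (lineIdx 0 (ap (tabs.getD l 0) 0)) (lineIdx 0 0) &&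
    Nat.beq (lineIdx 0 (ap (tabs.getD l 0) 16)) (lineIdx 0 0)) &&
  [0, 16, 32, 48].all fun u => (aWords i).any fun w => Nat.beq (evalWord tabs w 0) u

/-- The test for `GoodB`. -/
def goodB (i : ℕ) (tabs : List ℕ) : Bool :=
  (allRelB i).all (fun w => isId (evalWord tabs w)) &&
  ([4, 6].all fun l => Nat.beq (ap (tabs.getD l 0) 0) 0) &&
  (List.range 6).all fun d => (bWords i).any fun w => Nat.beq (dirOf (evalWord tabs w 16)) d

theorem baseLine_check : (List.range 64).all (fun p =>
    Nat.beq (lineIdx 0 p) (lineIdx 0 0) == [0, 16, 32, 48].any (Nat.beq p)) = true := by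
  decide +kernel

theorem modelInc_baseLine_iff {p : Fin 64} :
    ModelInc p baseLine ↔ lineIdx 0 p = lineIdx 0 0 := Iff.rfl

theorem modelInc_baseLine_iff_mem {p : Fin 64} :
    ModelInc p baseLine ↔ (p : ℕ) ∈ [0, 16, 32, 48] := by
  have h := forall_lt_of_all baseLine_check p p.2
  rw [beq_iff_eq] at h
  rw [modelInc_baseLine_iff, ← Nat.beq_eq, h, List.any_eq_true]
  simp only [Nat.beq_eq, exists_eq_right']

theorem ln_baseLine_iff {g : ModelAut} {l : Fin 6 × Fin 16} :
    ln g baseLine = l ↔ ModelInc (pt g 0) l ∧ ModelInc (pt g 16) l := by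
  have h0 : ModelInc (0 : Fin 64) baseLine := modelInc_base
  have h16 : ModelInc (16 : Fin 64) baseLine :=
    modelInc_baseLine_iff_mem.2 (by simp)
  constructor
  · rintro rfl
    exact ⟨(modelInc_map_iff _ _ _).2 h0, (modelInc_map_iff _ _ _).2 h16⟩
  · rintro ⟨h1, h2⟩
    exact modelInc_line_unique (fun e => absurd (pt_injective g e) (by decide))
      ((modelInc_map_iff _ _ _).2 h0) ((modelInc_map_iff _ _ _).2 h16) h1 h2

/-- The base line joins `0` and `16`, so if `0` is fixed, its image is determined by the image of
`16`. -/
theorem ln_baseLine_of_fix {g : ModelAut} (h0 : pt g 0 = 0) (d : Fin 6) :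
    ln g baseLine = lineThrough d 0 ↔ dirOf (pt g 16) = d := by
  have hne : (0 : Fin 64) ≠ pt g 16 := fun e => by
    rw [← h0] at e
    exact absurd (pt_injective g e) (by decide)
  rw [ln_baseLine_iff, h0, modelInc_iff (l := lineThrough d 0) (p := pt g 16)]
  simp only [modelInc_lineThrough, true_and]
  change lineThrough d 0 = lineThrough d (pt g 16) ↔ _
  rw [lineThrough_eq_iff, zero_xor_val]
  simp [hne]

/-- Both directions are used: a passed test realizes or recognizes one of the groups, and a failed
test excludes isomorphisms between two of them. -/
theorem goodA_iff {i : Fin 11} {tabs : List ℕ} {y : ℕ → ModelAut}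
    (h : ∀ l < 4, Rep (tabs.getD l 0) (letter y l)) : goodA i tabs = true ↔ GoodA i y := by
  have hlt : ∀ i : Fin 11, ∀ w ∈ allRelA i, ∀ l ∈ w, l < 4 := by decide +kernel
  have hrel : ∀ w ∈ allRelA i, isId (evalWord tabs w) = true ↔ word y w = 1 := fun w hw =>
    eq_one_iff_isId (pt_word fun l hl => h l (hlt i w hw l hl))
  have hpt : ∀ w ∈ aWords i, (pt (word y w) 0 : ℕ) = evalWord tabs w 0 := fun w hw =>
    pt_word (fun l hl => h l (aWords_lt i w hw l hl)) 0
  have hfix : ∀ k < 2, (lineIdx 0 (ap (tabs.getD (2 * k) 0) 0) = lineIdx 0 0 ∧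
      lineIdx 0 (ap (tabs.getD (2 * k) 0) 16) = lineIdx 0 0) ↔ ln (y k) baseLine = baseLine := by
    intro k hk
    have hR := h (2 * k) (by omega)
    have : letter y (2 * k) = y k := by simp [letter]
    rw [this] at hR
    rw [ln_baseLine_iff, modelInc_baseLine_iff, modelInc_baseLine_iff, hR, hR]
    rfl
  rw [goodA, Bool.and_eq_true, Bool.and_eq_true]
  simp only [List.all_eq_true, List.any_eq_true, Nat.beq_eq, Bool.and_eq_true]
  constructor
  · rintro ⟨⟨h1, h2⟩, h3⟩
    refine ⟨fun w hw => (hrel w hw).1 (h1 w hw), fun k hk => (hfix k hk).1 (h2 _ ?_), fun p hp => ?_⟩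
    · interval_cases k <;> simp
    · obtain ⟨w, hw, hwp⟩ := h3 p (modelInc_baseLine_iff_mem.1 hp)
      exact ⟨w, hw, Fin.ext ((hpt w hw).trans hwp)⟩
  · rintro ⟨h1, h2, h3⟩
    refine ⟨⟨fun w hw => (hrel w hw).2 (h1 w hw), fun l hl => ?_⟩, fun u hu => ?_⟩
    · simp only [List.mem_cons, List.not_mem_nil, or_false] at hl
      rcases hl with rfl | rfl
      · exact (hfix 0 (by norm_num)).2 (h2 0 (by norm_num))
      · exact (hfix 1 (by norm_num)).2 (h2 1 (by norm_num))
    · have hu64 : u < 64 := by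
        simp only [List.mem_cons, List.not_mem_nil, or_false] at hu
        omega
      obtain ⟨w, hw, hwp⟩ := h3 ⟨u, hu64⟩ (modelInc_baseLine_iff_mem.2 hu)
      exact ⟨w, hw, by rw [← hpt w hw, hwp]⟩

theorem goodB_iff {i : Fin 11} {tabs : List ℕ} {y : ℕ → ModelAut}
    (h : ∀ l, 4 ≤ l → l < 8 → Rep (tabs.getD l 0) (letter y l)) :
    goodB i tabs = true ↔ GoodB i y := by
  have hlt : ∀ i : Fin 11, ∀ w ∈ allRelB i, ∀ l ∈ w, 4 ≤ l ∧ l < 8 := by decide +kernel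
  have hrel : ∀ w ∈ allRelB i, isId (evalWord tabs w) = true ↔ word y w = 1 := fun w hw =>
    eq_one_iff_isId (pt_word fun l hl => h l (hlt i w hw l hl).1 (hlt i w hw l hl).2)
  have hpt : ∀ w ∈ bWords i, (pt (word y w) 16 : ℕ) = evalWord tabs w 16 := fun w hw =>
    pt_word (fun l hl => h l (bWords_lt i w hw l hl).1 (bWords_lt i w hw l hl).2) 16
  have hfix : ∀ k, 2 ≤ k → k < 4 → (ap (tabs.getD (2 * k) 0) 0 = 0 ↔ pt (y k) 0 = 0) := by
    intro k hk hk'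
    have hR := h (2 * k) (by omega) (by omega)
    have : letter y (2 * k) = y k := by simp [letter]
    rw [this] at hR
    rw [← Fin.val_inj, hR]
    rfl
  have hword : ∀ hfix' : (∀ k, 2 ≤ k → k < 4 → pt (y k) 0 = 0), ∀ w ∈ bWords i,
      pt (word y w) 0 = 0 := fun hfix' w hw =>
    word_mem (S := stabPoint) fun l hl => hfix' _ (by have := bWords_lt i w hw l hl; omega)
      (by have := bWords_lt i w hw l hl; omega)
  rw [goodB, Bool.and_eq_true, Bool.and_eq_true]
  simp only [List.all_eq_true, List.any_eq_true, Nat.beq_eq]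
  constructor
  · rintro ⟨⟨h1, h2⟩, h3⟩
    have hfix' : ∀ k, 2 ≤ k → k < 4 → pt (y k) 0 = 0 := fun k hk hk' =>
      (hfix k hk hk').1 (h2 _ (by interval_cases k <;> simp))
    refine ⟨fun w hw => (hrel w hw).1 (h1 w hw), hfix', fun d => ?_⟩
    obtain ⟨w, hw, hwp⟩ := h3 d (List.mem_range.2 d.2)
    refine ⟨w, hw, (ln_baseLine_of_fix (hword hfix' w hw) d).2 ?_⟩
    rw [hpt w hw, hwp]
  · rintro ⟨h1, h2, h3⟩
    refine ⟨⟨fun w hw => (hrel w hw).2 (h1 w hw), fun l hl => ?_⟩, fun d hd => ?_⟩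
    · simp only [List.mem_cons, List.not_mem_nil, or_false] at hl
      rcases hl with rfl | rfl
      · exact (hfix 2 (by norm_num) (by norm_num)).2 (h2 2 (by norm_num) (by norm_num))
      · exact (hfix 3 (by norm_num) (by norm_num)).2 (h2 3 (by norm_num) (by norm_num))
    · obtain ⟨w, hw, hwp⟩ := h3 ⟨d, List.mem_range.1 hd⟩
      refine ⟨w, hw, ?_⟩
      rw [← hpt w hw]
      exact (ln_baseLine_of_fix (hword h2 w hw) _).1 hwp

/-- The test for `Good`. -/
def goodTabs (i : ℕ) (tabs : List ℕ) : Bool :=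
  goodA i tabs && goodB i tabs && (relC i).all fun w => isId (evalWord tabs w)

theorem relC_iff {i : Fin 11} {tabs : List ℕ} {y : ℕ → ModelAut}
    (h : ∀ l < 8, Rep (tabs.getD l 0) (letter y l)) :
    ((relC i).all fun w => isId (evalWord tabs w)) = true ↔ ∀ w ∈ relC i, word y w = 1 := by
  have hlt : ∀ i : Fin 11, ∀ w ∈ relC i, ∀ l ∈ w, l < 8 := by decide +kernel
  rw [List.all_eq_true]
  exact forall₂_congr fun w hw => eq_one_iff_isId (pt_word fun l hl => h l (hlt i w hw l hl))

theorem goodTabs_iff {i : Fin 11} {tabs : List ℕ} {y : ℕ → ModelAut}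
    (h : ∀ l < 8, Rep (tabs.getD l 0) (letter y l)) : goodTabs i tabs = true ↔ Good i y := by
  rw [goodTabs, Bool.and_eq_true, Bool.and_eq_true, goodA_iff fun l hl => h l (by omega),
    goodB_iff fun l _ hl => h l hl, relC_iff h]
  exact ⟨fun h => ⟨h.1.1, h.1.2, h.2⟩, fun h => ⟨⟨h.a, h.b⟩, h.rel⟩⟩

/-! ### Existence of regular groups -/

theorem letterTabs_check : (List.range 11).all (fun i =>
    ((List.range 4).all fun k =>
      mapsLines ((letterTabs i).getD (2 * k) 0) && mapsLines ((letterTabs i).getD (2 * k + 1) 0) &&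
      invCheck ((letterTabs i).getD (2 * k) 0) ((letterTabs i).getD (2 * k + 1) 0) &&
      invCheck ((letterTabs i).getD (2 * k + 1) 0) ((letterTabs i).getD (2 * k) 0)) &&
    goodTabs i (letterTabs i)) = true := by
  decide +kernel

theorem exists_good (i : Fin 11) :
    ∃ y, (∀ l < 8, Rep ((letterTabs i).getD l 0) (letter y l)) ∧ Good i y := by
  have h := forall_lt_of_all letterTabs_check i i.2
  rw [Bool.and_eq_true] at h
  have hy : ∀ k, ∃ g, k < 4 → Rep ((letterTabs i).getD (2 * k) 0) g ∧
      Rep ((letterTabs i).getD (2 * k + 1) 0) g⁻¹ := by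
    intro k
    by_cases hk : k < 4
    · have hk' := forall_lt_of_all h.1 k hk
      simp only [Bool.and_eq_true] at hk'
      obtain ⟨g, hg⟩ := exists_rep hk'.1.1.1 hk'.1.1.2 hk'.2 hk'.1.2
      exact ⟨g, fun _ => ⟨hg, hg.inv hk'.2⟩⟩
    · exact ⟨1, fun h => absurd h hk⟩
  choose y hy using hy
  have hrep : ∀ l < 8, Rep ((letterTabs i).getD l 0) (letter y l) := by
    intro l hl
    have := hy (l / 2) (by omega)
    unfold letter
    split_ifs with h2
    · rw [show 2 * (l / 2) = l by omega] at this
      exact this.1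
    · rw [show 2 * (l / 2) + 1 = l by omega] at this
      exact this.2
  exact ⟨y, hrep, (goodTabs_iff hrep).1 h.2⟩


/-! ### The actions are pairwise non-isomorphic -/

/-- The word for the inverse. -/
def invWord (w : List ℕ) : List ℕ := (w.map fun l => l ^^^ 1).reverse

theorem letter_xor_one {G : Type*} [Group G] (y : ℕ → G) (l : ℕ) :
    letter y (l ^^^ 1) = (letter y l)⁻¹ := by
  unfold letter
  rcases Nat.even_or_odd l with h | h
  · have h1 := Nat.even_iff.1 h
    rw [Nat.xor_one_of_even h, if_neg (by omega), if_pos h1, show (l + 1) / 2 = l / 2 by omega]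
  · have h1 := Nat.odd_iff.1 h
    rw [Nat.xor_one_of_odd h, if_pos (by omega), if_neg (by omega), inv_inv,
      show (l - 1) / 2 = l / 2 by omega]

theorem word_invWord {G : Type*} [Group G] (y : ℕ → G) (w : List ℕ) :
    word y (invWord w) = (word y w)⁻¹ := by
  induction w with
  | nil => simp [invWord]
  | cons l w ih =>
    have : invWord (l :: w) = invWord w ++ [l ^^^ 1] := by simp [invWord]
    rw [this, word_append, ih, word_cons, word_cons, letter_xor_one]
    simp

/-- The table of a word. -/
def wordTab (tabs : List ℕ) (w : List ℕ) : ℕ := tabulate 64 fun p => evalWord tabs w p &&& 63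

theorem and_63 {p : ℕ} (hp : p < 64) : p &&& 63 = p := by
  rw [show 63 = 2 ^ 6 - 1 by norm_num, Nat.and_two_pow_sub_one_eq_mod, Nat.mod_eq_of_lt hp]

theorem rep_wordTab {tabs : List ℕ} {y : ℕ → ModelAut} {w : List ℕ}
    (h : ∀ l ∈ w, Rep (tabs.getD l 0) (letter y l)) : Rep (wordTab tabs w) (word y w) := by
  intro p
  rw [wordTab, ap_tabulate _ (fun _ => lt_of_le_of_lt Nat.and_le_right (by norm_num)) p.2,
    ← pt_word h p, and_63 (Fin.is_lt _)]

/-- Evaluation of `f` at the list of the tables of words and their inverses. -/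
def withTabs (tabs : List ℕ) : List (List ℕ) → (List (ℕ × ℕ) → Bool) → Bool
  | [], f => f []
  | w :: ws, f => force (wordTab tabs w) fun T => force (wordTab tabs (invWord w)) fun S =>
    withTabs tabs ws fun l => f ((T, S) :: l)

theorem withTabs_eq (tabs : List ℕ) (ws : List (List ℕ)) (f : List (ℕ × ℕ) → Bool) :
    withTabs tabs ws f = f (ws.map fun w => (wordTab tabs w, wordTab tabs (invWord w))) := by
  induction ws generalizing f with
  | nil => rfl
  | cons w ws ih => rw [withTabs, force_eq, force_eq, ih]; rfl

/-- No choice of images of generators in the group with index `j` satisfies the relations of the group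
with index `i`. -/
def crossCheck (i j : ℕ) : Bool :=
  withTabs (letterTabs j) (aWords j) fun as => withTabs (letterTabs j) (bWords j) fun bs =>
    -- The conditions on the `aⱼ` involve letters below `4` only and those on the `bⱼ` only the
    -- others. So pairs are discarded as early as possible, and the zeros stand for tables that are
    -- not consulted.
    as.all fun a₁ => as.all fun a₂ => !goodA i [a₁.1, a₁.2, a₂.1, a₂.2] ||
      bs.all fun b₁ => bs.all fun b₂ => !goodB i [0, 0, 0, 0, b₁.1, b₁.2, b₂.1, b₂.2] ||
        !(relC i).all fun w =>
          isId (evalWord [a₁.1, a₁.2, a₂.1, a₂.2, b₁.1, b₁.2, b₂.1, b₂.2] w)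

theorem crossCheck_all : (List.range 11).all (fun i => (List.range 11).all fun j =>
    Nat.beq i j || crossCheck i j) = true := by
  decide +kernel

/-- The hypotheses place the images of the four generators among the 4 · 4 · 6 · 6 choices that
`crossCheck` runs through, all of which it has excluded for `i ≠ j`. -/
theorem eq_of_good {i j : Fin 11} {y t : ℕ → ModelAut}
    (hrep : ∀ l < 8, Rep ((letterTabs j).getD l 0) (letter y l))
    (hA : ∀ k < 2, ∃ w ∈ aWords j, t k = word y w)
    (hB : ∀ k, 2 ≤ k → k < 4 → ∃ w ∈ bWords j, t k = word y w) (ht : Good i t) : i = j := by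
  by_contra hne
  have h := forall_lt_of_all (forall_lt_of_all crossCheck_all i i.2) j j.2
  rw [Bool.or_eq_true, Nat.beq_eq] at h
  have hc := h.resolve_left fun e => hne (Fin.ext e)
  rw [crossCheck, withTabs_eq, withTabs_eq] at hc
  obtain ⟨w₀, hw₀, ht₀⟩ := hA 0 (by norm_num)
  obtain ⟨w₁, hw₁, ht₁⟩ := hA 1 (by norm_num)
  obtain ⟨w₂, hw₂, ht₂⟩ := hB 2 (by norm_num) (by norm_num)
  obtain ⟨w₃, hw₃, ht₃⟩ := hB 3 (by norm_num) (by norm_num)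
  have hletter : ∀ k, letter t (2 * k) = t k ∧ letter t (2 * k + 1) = (t k)⁻¹ := by
    intro k
    constructor
    · simp [letter]
    · unfold letter
      rw [if_neg (by omega), show (2 * k + 1) / 2 = k by omega]
  have hinv : ∀ w : List ℕ, (∀ l ∈ w, l < 8) → ∀ l ∈ invWord w, l < 8 := by
    intro w hw l hl
    simp only [invWord, List.mem_reverse, List.mem_map] at hl
    obtain ⟨m, hm, rfl⟩ := hl
    exact Nat.xor_lt_two_pow (n := 3) (hw m hm) (by norm_num)
  have hR : ∀ k w, (∀ l ∈ w, l < 8) → t k = word y w →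
      Rep (wordTab (letterTabs j) w) (letter t (2 * k)) ∧
      Rep (wordTab (letterTabs j) (invWord w)) (letter t (2 * k + 1)) := by
    intro k w hw hk
    rw [(hletter k).1, (hletter k).2, hk, ← word_invWord]
    exact ⟨rep_wordTab fun l hl => hrep l (hw l hl),
      rep_wordTab fun l hl => hrep l (hinv w hw l hl)⟩
  have hlA : ∀ w ∈ aWords j, ∀ l ∈ w, l < 8 := fun w hw l hl =>
    (aWords_lt j w hw l hl).trans (by norm_num)
  have hlB : ∀ w ∈ bWords j, ∀ l ∈ w, l < 8 := fun w hw l hl => (bWords_lt j w hw l hl).2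
  have R₀ := hR 0 w₀ (hlA _ hw₀) ht₀
  have R₁ := hR 1 w₁ (hlA _ hw₁) ht₁
  have R₂ := hR 2 w₂ (hlB _ hw₂) ht₂
  have R₃ := hR 3 w₃ (hlB _ hw₃) ht₃
  rw [List.all_eq_true] at hc
  have hc := hc _ (List.mem_map_of_mem hw₀)
  rw [List.all_eq_true] at hc
  have hc := hc _ (List.mem_map_of_mem hw₁)
  rw [(goodA_iff (y := t) ?_).2 ht.a, Bool.not_true, Bool.false_or, List.all_eq_true] at hc
  · have hc := hc _ (List.mem_map_of_mem hw₂)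
    rw [List.all_eq_true] at hc
    have hc := hc _ (List.mem_map_of_mem hw₃)
    rw [(goodB_iff (y := t) ?_).2 ht.b, Bool.not_true, Bool.false_or, (relC_iff (y := t) ?_).2 ht.rel] at hc
    · cases hc
    · intro l hl
      interval_cases l
      · exact R₀.1
      · exact R₀.2
      · exact R₁.1
      · exact R₁.2
      · exact R₂.1
      · exact R₂.2
      · exact R₃.1
      · exact R₃.2
    · intro l hl hl'
      interval_cases l
      · exact R₂.1
      · exact R₂.2
      · exact R₃.1
      · exact R₃.2
  · intro l hl
    interval_cases l
    · exact R₀.1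
    · exact R₀.2
    · exact R₁.1
    · exact R₁.2

/-- Elements of a regular group that agree on the base edge are equal. -/
theorem _root_.IsEdgeRegular.eq_of_base {V : Type*} [Group V] {ρ : V →* ModelAut} (h : IsEdgeRegular ρ)
    {v w : V} (h0 : pt (ρ v) 0 = pt (ρ w) 0) (hl : ln (ρ v) baseLine = ln (ρ w) baseLine) :
    v = w := by
  obtain ⟨u, _, hu⟩ := (isEdgeRegular_iff ρ).1 h 0 baseLine modelInc_base (pt (ρ w) 0)
    (ln (ρ w) baseLine) ((modelInc_map_iff _ _ _).2 modelInc_base)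
  rw [hu v ⟨h0, hl⟩, hu w ⟨rfl, rfl⟩]

/-- With both groups realized on the model, an isomorphism of the actions is an automorphism `η`
that conjugates one realization into the other. After composition with an element of the second
group it fixes the base edge. Then the conjugated generators lie in the stabilizers of the base line
and the base point in the second group, where only finitely many elements are available. -/
theorem eq_of_actionIso (i j : Fin 11) (h : ActionIso (presL i).action (presL j).action) :
    i = j := by
  obtain ⟨y, _, hy⟩ := exists_good i
  obtain ⟨z, hzrep, hz⟩ := exists_good j
  obtain ⟨ρ, hρ, hρreg, hρiso⟩ := hy.exists_regular
  obtain ⟨σ, hσ, hσreg, hσiso⟩ := hz.exists_regular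
  obtain ⟨φ, η, hη⟩ := (hρiso.trans h).trans hσiso.symm
  have hη' : ∀ v, η * ρ v = σ (φ v) * η := fun v => RelIso.ext fun x => hη v x
  -- The element `u` moves the image of the base edge under `η` back to the base edge.
  obtain ⟨u, ⟨hu0, hul⟩, _⟩ := (isEdgeRegular_iff σ).1 hσreg (pt η 0) (ln η baseLine)
    ((modelInc_map_iff _ _ _).2 modelInc_base) 0 baseLine modelInc_base
  have hgood := hy.conj (η := σ u * η) (by rw [pt_mul, hu0]) (by rw [ln_mul, hul])
  have hmem : ∀ k < 4, σ u * η * y k * (σ u * η)⁻¹ = σ (u * φ (gen (presL i) k) * u⁻¹) := by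
    intro k hk
    rw [← hρ k hk, map_mul, map_mul, map_inv, mul_assoc (σ u), hη']
    group
  have hword : ∀ w : List ℕ, (∀ l ∈ w, l < 8) → σ (word (gen (presL j)) w) = word z w := by
    intro w hw
    rw [map_word]
    exact word_congr fun l hl => hσ _ (by have := hw l hl; omega)
  refine eq_of_good hzrep (t := fun k => σ u * η * y k * (σ u * η)⁻¹) (fun k hk => ?_)
    (fun k hk hk' => ?_) hgood
  · have hfix := hgood.a.fix k hk
    -- In a regular group an element that fixes the base line is determined by the image of `0`, and
    -- some word in the `aⱼ` has the same image. The case of the `bⱼ` below is dual.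
    obtain ⟨w, hw, hwp⟩ := hz.a.trans (pt (σ u * η * y k * (σ u * η)⁻¹) 0) (by
      have := (modelInc_map_iff (σ u * η * y k * (σ u * η)⁻¹) 0 baseLine).2 modelInc_base
      rwa [hfix] at this)
    refine ⟨w, hw, ?_⟩
    have hwσ := hword w fun l hl => (aWords_lt j w hw l hl).trans (by norm_num)
    rw [hmem k (by omega)] at hfix hwp ⊢
    rw [← hwσ] at hwp ⊢
    rw [hσreg.eq_of_base hwp.symm (hfix.trans (by rw [hwσ]; exact (hz.a.word_fix hw).symm))]
  · have hfix := hgood.b.fix k hk hk'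
    have hline := (modelInc_map_iff (σ u * η * y k * (σ u * η)⁻¹) 0 baseLine).2 modelInc_base
    rw [hfix] at hline
    obtain ⟨w, hw, hwd⟩ := hz.b.trans (ln (σ u * η * y k * (σ u * η)⁻¹) baseLine).1
    rw [← modelInc_iff.1 hline] at hwd
    refine ⟨w, hw, ?_⟩
    have hwσ := hword w fun l hl => (bWords_lt j w hw l hl).2
    rw [hmem k hk'] at hfix hwd ⊢
    rw [← hwσ] at hwd ⊢
    rw [hσreg.eq_of_base (hfix.trans (by rw [hwσ]; exact (hz.b.word_fix hw).symm)) hwd.symm]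


/-! ### The stabilizer of the base point -/

/-- The test whether `T` is the table of an automorphism. -/
def isAutTab (T : ℕ) : Bool :=
  force (invTab T) fun S => mapsLines T && mapsLines S && invCheck S T && invCheck T S

theorem exists_rep_of_isAutTab {T : ℕ} (h : isAutTab T = true) : ∃ g, Rep T g := by
  rw [isAutTab, force_eq] at h
  simp only [Bool.and_eq_true] at h
  exact exists_rep h.1.1.1 h.1.1.2 h.1.2 h.2

/-- The test whether two tables describe the same automorphism. -/
def eqTab (T S : ℕ) : Bool := (List.range 64).all fun p => Nat.beq (ap T p) (ap S p)

theorem eqTab_iff {T S : ℕ} {g h : ModelAut} (hg : Rep T g) (hh : Rep S h) :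
    eqTab T S = true ↔ g = h := by
  constructor
  · intro H
    exact ext_pt fun p => Fin.ext (by
      rw [hg, hh, Nat.eq_of_beq_eq_true (forall_lt_of_all H p p.2)])
  · rintro rfl
    refine List.all_eq_true.2 fun p hp => ?_
    have hp := List.mem_range.1 hp
    rw [Nat.beq_eq, ← hg ⟨p, hp⟩, hh ⟨p, hp⟩]

/-- The automorphism `g` fixes the base point and acts on the lines through it by `σ`. -/
structure Acts (g : ModelAut) (σ : Equiv.Perm (Fin 6)) : Prop where
  pt_zero : pt g 0 = 0
  ln_eq : ∀ d, ln g (lineThrough d 0) = lineThrough (σ d) 0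

theorem lineThrough_fst (d : Fin 6) (p : Fin 64) : (lineThrough d p).1 = d := rfl

theorem exists_acts {g : ModelAut} (h0 : pt g 0 = 0) : ∃ σ, Acts g σ := by
  have key : ∀ d, ln g (lineThrough d 0) = lineThrough (ln g (lineThrough d 0)).1 0 := by
    intro d
    have := (modelInc_map_iff g 0 _).2 (modelInc_lineThrough d 0)
    rw [h0] at this
    exact modelInc_iff.1 this
  have hinj : Function.Injective fun d => (ln g (lineThrough d 0)).1 := by
    intro d e hde
    have h1 : ln g (lineThrough d 0) = ln g (lineThrough e 0) := by
      rw [key d, key e]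
      exact congrArg (fun x => lineThrough x 0) hde
    exact congrArg Prod.fst (ln_injective g h1)
  exact ⟨Equiv.ofBijective _ (Finite.injective_iff_bijective.1 hinj), h0, key⟩

theorem Acts.mul {g h : ModelAut} {σ τ : Equiv.Perm (Fin 6)} (hg : Acts g σ) (hh : Acts h τ) :
    Acts (g * h) (σ * τ) :=
  ⟨by rw [pt_mul, hh.pt_zero, hg.pt_zero], fun d => by
    rw [ln_mul, hh.ln_eq, hg.ln_eq, Equiv.Perm.mul_apply]⟩

theorem Acts.inv {g : ModelAut} {σ : Equiv.Perm (Fin 6)} (hg : Acts g σ) : Acts g⁻¹ σ⁻¹ := by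
  refine ⟨(stabPoint.inv_mem (x := g) hg.pt_zero :), fun d => ?_⟩
  apply ln_injective g
  rw [← ln_mul, mul_inv_cancel, ln_one, hg.ln_eq]
  simp

theorem Acts.tab {T : ℕ} {g : ModelAut} (hT : Rep T g) {σ : Equiv.Perm (Fin 6)} (hg : Acts g σ)
    (d : Fin 6) : dirOf (ap T (dirPt d)) = σ d := by
  rw [← hT ⟨dirPt d, dirPt_lt d⟩, ← ln_fst_eq_dirOf hg.pt_zero, hg.ln_eq, lineThrough_fst]

/-- The test whether the automorphism with table `T` fixes `0` and acts on directions by `f`. -/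
def actsTab (T : ℕ) (f : ℕ → ℕ) : Bool :=
  Nat.beq (ap T 0) 0 && (List.range 6).all fun d => Nat.beq (dirOf (ap T (dirPt d))) (f d)

theorem acts_of_actsTab {T : ℕ} {g : ModelAut} (hT : Rep T g) {f : ℕ → ℕ}
    {σ : Equiv.Perm (Fin 6)} (hf : ∀ d : Fin 6, (σ d : ℕ) = f d) (h : actsTab T f = true) :
    Acts g σ := by
  rw [actsTab, Bool.and_eq_true, Nat.beq_eq] at h
  have h0 : pt g 0 = 0 := Fin.ext ((hT 0).trans h.1)
  obtain ⟨τ, hτ⟩ := exists_acts h0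
  have : τ = σ := by
    ext d
    rw [← hτ.tab hT, Nat.eq_of_beq_eq_true (forall_lt_of_all h.2 d d.2), hf]
  rwa [← this]

/-- The tables of the scalars. -/
def scalarTabs : List ℕ :=
  [idTab, 16251671243927620843410266165717600391433786942157285171809303351801763716420551180636293722783060941322897211265216,
    23160248300413443081102545325105860429490670414872048227336773410602008775173713482896598482775415469974142687916160]

theorem scalarTabs_check : scalarTabs.all (fun T => isAutTab T && actsTab T fun d => d) = true ∧
    (List.range 64).all (fun p => !Nat.beq (dirOf p) 0 ||
      scalarTabs.any fun T => Nat.beq (ap T 16) p) = true := by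
  decide +kernel

theorem exists_acts_one {T : ℕ} (hT : T ∈ scalarTabs) : ∃ g, Rep T g ∧ Acts g 1 := by
  have h := List.all_eq_true.1 scalarTabs_check.1 T hT
  rw [Bool.and_eq_true] at h
  obtain ⟨g, hg⟩ := exists_rep_of_isAutTab h.1
  exact ⟨g, hg, acts_of_actsTab hg (fun _ => rfl) h.2⟩

/-- The image of `16` is again a point other than `0` on the base line, and one of the listed
scalars maps `16` to it. By rigidity the automorphism equals this scalar. -/
theorem Acts.exists_scalar {g : ModelAut} (hg : Acts g 1) : ∃ T ∈ scalarTabs, Rep T g := by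
  have h := forall_lt_of_all scalarTabs_check.2 (pt g 16) (pt g 16).2
  have h16 : dirOf (pt g 16) = (0 : Fin 6) :=
    (ln_baseLine_of_fix hg.pt_zero 0).1 (hg.ln_eq 0)
  rw [h16] at h
  change (false || _) = true at h
  rw [Bool.false_or, List.any_eq_true] at h
  obtain ⟨T, hT, hT16⟩ := h
  obtain ⟨k, hk, hk1⟩ := exists_acts_one hT
  have hk16 : pt k 16 = pt g 16 := Fin.ext ((hk 16).trans (Nat.eq_of_beq_eq_true hT16))
  have h1 : Acts (k⁻¹ * g) 1 := by simpa using hk1.inv.mul hg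
  have : k⁻¹ * g = 1 := eq_one_of_fixes h1.pt_zero (by rw [pt_mul, ← hk16, pt_inv_pt]) fun d => by
    rw [h1.ln_eq, lineThrough_fst]
    rfl
  rw [inv_mul_eq_one] at this
  exact ⟨T, hT, this ▸ hk⟩

/-- The entry with index `k` is the table of an automorphism that fixes `0` and the directions below
`j`, and maps the direction `j` to `j + k`. -/
def cosetTabs (j : ℕ) : List ℕ :=
    [[39392078757191557952714343944915560488424390381760365930566598193007564623154681709773698286566728461254900444831808,
      36741455024946557327158847337061379668815520022796581369991560431538228778115138248330552600309620545748411017724928,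
      27044866798198664859482643585792697796632226308788977756966266405594715904944028181254322416572235514097609115632640,
      17988364682759803309363971203161242960284528895415317236562185434076386295305139000190335854233629838031391004165120,
      13607996625928531973479995565580670268132306846514127335802994180712647297819825164747188241613815862416190931665920,
      14235792589498657582294334973222817021924493099146420514664581425984472511687120408370874532938705543109471973278720],
    [39392078757191557952714343944915560488424390381760365930566598193007564623154681709773698286566728461254900444831808,
      26305862676898959212948821285774608588247249926116044170439245269770448896393366978739116972908294074586514684166400,
      17330786885053807117954464398188661558410380317371880117990134314391694220790460071107229856980307408516185476539712,
      12418574962264828641506522235046177742136241190327286749453818857433028097419642102331138083064414743124010336163712,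
      12463702246796405597200039167378594427447454052437795867502627041492794321040364111678499041363874900789982201108160],
    [39392078757191557952714343944915560488424390381760365930566598193007564623154681709773698286566728461254900444831808,
      15020362911870011143282293263946132473498377978921972005838831090451909897896177057677785216506079604660828509843520,
      15029979932205859274476535801767203544876881512048105062604145253117954445319793216137941448181615681590293755605120,
      17541163822617808349240368451424715765222493129748821860251086198593872846996202954373659870118696404089647747309760],
    [39392078757191557952714343944915560488424390381760365930566598193007564623154681709773698286566728461254900444831808,
      24372321656344101020981162093501160146199101047973465411698343895912049509984725568559910038731051558435625674477696,
      33763674445222140389779926465657376363100586870807515663335706497287049709693932260883280359085872660364692543770816],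
    [39392078757191557952714343944915560488424390381760365930566598193007564623154681709773698286566728461254900444831808,
      26277468907216164100194112988609583568233602510623327099166978443450108427025622635888755660464541049453995989938240]].getD j []

theorem cosetTabs_check : (List.range 5).all (fun j => (List.range 6).all fun k => Nat.blt k j ||
    (cosetTabs j).any fun T => isAutTab T && Nat.beq (ap T 0) 0 &&
      ((List.range j).all fun d => Nat.beq (dirOf (ap T (dirPt d))) d) &&
      Nat.beq (dirOf (ap T (dirPt j))) k) = true := by
  decide +kernel

theorem exists_cosetTab (j : Fin 6) (hj : (j : ℕ) < 5) (k : Fin 6) (hk : j ≤ k) :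
    ∃ T ∈ cosetTabs j, ∃ g σ, Rep T g ∧ Acts g σ ∧ (∀ d < j, σ d = d) ∧ σ j = k := by
  have h := forall_lt_of_all (forall_lt_of_all cosetTabs_check j hj) k k.2
  have hkj : Nat.blt k j = false := by
    rw [← Bool.not_eq_true, Nat.blt_eq]
    exact Nat.not_lt.2 hk
  simp only [hkj, Bool.false_or, List.any_eq_true, Bool.and_eq_true] at h
  obtain ⟨T, hT, ⟨⟨hT1, hT2⟩, hT3⟩, hT4⟩ := h
  obtain ⟨g, hg⟩ := exists_rep_of_isAutTab hT1
  obtain ⟨σ, hσ⟩ := exists_acts (g := g) (Fin.ext ((hg 0).trans (Nat.eq_of_beq_eq_true hT2)))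
  refine ⟨T, hT, g, σ, hg, hσ, fun d hd => Fin.ext ?_, Fin.ext ?_⟩
  · rw [← hσ.tab hg, Nat.eq_of_beq_eq_true (forall_lt_of_all hT3 d hd)]
  · rw [← hσ.tab hg, Nat.eq_of_beq_eq_true hT4]

/-- The composition of a table with all products of entries of the given lists. -/
def products : List (List ℕ) → ℕ → List ℕ
  | [], T => [T]
  | R :: Rs, T => R.flatMap fun a => products Rs (comp T a)

/-- Every permutation that fixes the directions below `j` is induced by an automorphism. -/
theorem exists_acts_of_fixes (n j : ℕ) (hn : j + n = 5) (σ : Equiv.Perm (Fin 6))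
    (hσ : ∀ d : Fin 6, (d : ℕ) < j → σ d = d) {T₀ : ℕ} {g₀ : ModelAut} (h₀ : Rep T₀ g₀) :
    ∃ g, Acts g σ ∧ ∃ T ∈ products ((List.range' j n).map cosetTabs) T₀, Rep T (g₀ * g) := by
  induction n generalizing j σ T₀ g₀ with
  | zero =>
    -- A permutation of six directions that fixes five of them fixes the last one, which is why the
    -- chain ends at `5`.
    have h1 : σ = 1 := by
      obtain rfl : j = 5 := by omega
      have h5 : σ 5 = 5 := by
        by_contra h5
        have hlt : ((σ 5 : Fin 6) : ℕ) < 5 := by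
          have := (σ 5).2
          have : ((σ 5 : Fin 6) : ℕ) ≠ 5 := fun h => h5 (Fin.ext h)
          omega
        exact h5 (σ.injective (hσ _ hlt))
      ext d
      rcases lt_or_ge (d : ℕ) 5 with h | h
      · rw [hσ d h]; rfl
      · obtain rfl : d = 5 := Fin.ext (by have := d.2; change (d : ℕ) = 5; omega)
        rw [h5]; rfl
    refine ⟨1, ⟨pt_one _, fun d => ?_⟩, T₀, by simp [products], by rwa [mul_one]⟩
    rw [ln_one, h1]
    rfl
  | succ n ih =>
    -- The directions below `j` are already images of themselves, so `σ j` is not among them.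
    have hle : (⟨j, by omega⟩ : Fin 6) ≤ σ ⟨j, by omega⟩ := by
      by_contra hlt
      have hlt : (σ ⟨j, by omega⟩ : ℕ) < j := Nat.lt_of_not_le hlt
      have := σ.injective (hσ _ hlt)
      rw [this] at hlt
      exact lt_irrefl _ hlt
    -- This is a stabilizer chain: the chosen element agrees with `σ` on the directions up to `j`,
    -- and after division by it the induction goes on at `j + 1`. The factors found so far are
    -- accumulated in `g₀`.
    obtain ⟨T, hT, g, τ, hg, hτ, hτ1, hτ2⟩ := exists_cosetTab ⟨j, by omega⟩ (by simp; omega) _ hle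
    obtain ⟨h, hh, S, hS, hS'⟩ := ih (j + 1) (by omega) (τ⁻¹ * σ) (fun d hd => by
      rw [Equiv.Perm.mul_apply, Equiv.Perm.inv_eq_iff_eq]
      rcases Nat.lt_succ_iff_lt_or_eq.1 hd with hd | rfl
      · rw [hσ d hd, hτ1 d hd]
      · exact hτ2.symm) (h₀.comp hg)
    refine ⟨g * h, by simpa using hτ.mul hh, S, ?_, by rwa [← mul_assoc]⟩
    rw [List.range'_succ, List.map_cons, products, List.mem_flatMap]
    exact ⟨T, hT, hS⟩

theorem exists_acts_perm (σ : Equiv.Perm (Fin 6)) : ∃ g, Acts g σ := by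
  obtain ⟨g, hg, -⟩ := exists_acts_of_fixes 5 0 rfl σ (fun d hd => absurd hd (by omega)) rep_one
  exact ⟨g, hg⟩

/-- Two lifts of the same permutation differ by an element that acts trivially on the directions,
that is, by a scalar. -/
theorem Acts.exists_mul_scalar {g h : ModelAut} {σ : Equiv.Perm (Fin 6)} (hg : Acts g σ)
    (hh : Acts h σ) {T : ℕ} (hT : Rep T g) : ∃ S ∈ scalarTabs, Rep (comp T S) h := by
  have h1 : Acts (g⁻¹ * h) 1 := by simpa using hg.inv.mul hh
  obtain ⟨S, hS, hS'⟩ := h1.exists_scalar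
  exact ⟨S, hS, by simpa using hT.comp hS'⟩

/-- The tables of the automorphisms that fix the base point and the base line, composed with a given
table. -/
def edgeStabTabs (T : ℕ) : List ℕ :=
  products [cosetTabs 1, cosetTabs 2, cosetTabs 3, cosetTabs 4, scalarTabs] T

theorem products_append (Rs : List (List ℕ)) (R : List ℕ) (T : ℕ) :
    products (Rs ++ [R]) T = (products Rs T).flatMap fun S => R.map (comp S) := by
  induction Rs generalizing T with
  | nil => simp [products, List.map_eq_flatMap]
  | cons R' Rs ih => simp [products, ih, List.flatMap_assoc]

/-- The stabilizer chain starts at `1`, since direction `0` is the base line and hence fixed. What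
it leaves undetermined is a scalar. -/
theorem exists_edgeStabTab {g : ModelAut} (h0 : pt g 0 = 0) (hl : ln g baseLine = baseLine)
    {T₀ : ℕ} {g₀ : ModelAut} (h₀ : Rep T₀ g₀) : ∃ T ∈ edgeStabTabs T₀, Rep T (g₀ * g) := by
  obtain ⟨σ, hσ⟩ := exists_acts h0
  have hσ0 : σ 0 = 0 := by
    have h1 := hσ.ln_eq 0
    exact (congrArg Prod.fst (h1.symm.trans hl) :)
  obtain ⟨h, hh, T, hT, hT'⟩ := exists_acts_of_fixes 4 1 rfl σ (fun d hd => by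
    obtain rfl : d = 0 := Fin.ext (by change (d : ℕ) = 0; omega)
    exact hσ0) h₀
  have h1 : Acts (h⁻¹ * g) 1 := by simpa using hh.inv.mul hσ
  obtain ⟨S, hS, hS'⟩ := h1.exists_scalar
  refine ⟨comp T S, ?_, by simpa [mul_assoc] using hT'.comp hS'⟩
  rw [edgeStabTabs, show [cosetTabs 1, cosetTabs 2, cosetTabs 3, cosetTabs 4, scalarTabs] =
    (List.range' 1 4).map cosetTabs ++ [scalarTabs] from rfl, products_append, List.mem_flatMap]
  exact ⟨T, hT, List.mem_map_of_mem hS⟩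


/-! ### Transport of actions along isomorphisms of graphs -/

theorem _root_.IsEdgeRegular.of_actionIso {G H X Y : Type*} [Group G] [Group H]
    {Γ : SimpleGraph X} {Δ : SimpleGraph Y} {ρ : G →* (Γ ≃g Γ)} {σ : H →* (Δ ≃g Δ)}
    (hρ : IsEdgeRegular ρ) (h : ActionIso ρ σ) : IsEdgeRegular σ := by
  obtain ⟨φ, ψ, h⟩ := h
  have key : ∀ g (e : Γ.edgeSet), (σ (φ g)).mapEdgeSet (ψ.mapEdgeSet e) =
      ψ.mapEdgeSet ((ρ g).mapEdgeSet e) := by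
    rintro g ⟨e, he⟩
    apply Subtype.ext
    change Sym2.map (σ (φ g)) (Sym2.map ψ e) = Sym2.map ψ (Sym2.map (ρ g) e)
    rw [Sym2.map_map, Sym2.map_map]
    congr 1
    funext x
    exact (h g x).symm
  intro e f
  obtain ⟨e, rfl⟩ := ψ.mapEdgeSet.surjective e
  obtain ⟨f, rfl⟩ := ψ.mapEdgeSet.surjective f
  obtain ⟨g, hg, hu⟩ := hρ e f
  refine ⟨φ g, ?_, fun v hv => ?_⟩
  · change (σ (φ g)).mapEdgeSet (ψ.mapEdgeSet e) = _
    rw [key, hg]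
  · obtain ⟨w, rfl⟩ := φ.surjective v
    have hv : (σ (φ w)).mapEdgeSet (ψ.mapEdgeSet e) = ψ.mapEdgeSet f := hv
    rw [key] at hv
    rw [hu w (ψ.mapEdgeSet.injective hv)]

/-- Transport of automorphisms along an isomorphism of graphs. -/
def autCongr {X Y : Type*} {Γ : SimpleGraph X} {Δ : SimpleGraph Y} (ψ : Γ ≃g Δ) :
    (Γ ≃g Γ) ≃* (Δ ≃g Δ) where
  toFun g := (ψ.symm.trans g).trans ψ
  invFun g := (ψ.trans g).trans ψ.symm
  left_inv g := by ext x; simp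
  right_inv g := by ext x; simp
  map_mul' g h := by ext x; simp [RelIso.mul_apply]

theorem actionIso_map {X Y : Type*} {Γ : SimpleGraph X} {Δ : SimpleGraph Y} (ψ : Γ ≃g Δ)
    (G : Subgroup (Γ ≃g Γ)) :
    ActionIso G.subtype (G.map (autCongr ψ).toMonoidHom).subtype :=
  ⟨(autCongr ψ).subgroupMap G, ψ, fun g x => by
    change ψ (g.1 x) = ψ (g.1 (ψ.symm (ψ x)))
    rw [ψ.symm_apply_apply]⟩

/-! ### The stabilizer of a point in a regular group -/

/-- Cauchy's theorem gives `c` of order three and `s` of order two. Then `s` is no power of `c`, so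
the six products are distinct and exhaust the group. The product `s * c` is neither a power of `c`
nor `s`, which leaves two possibilities. The order of the list is the one in which left
multiplications become `permC`, `permS` and `permS'`. -/
theorem exists_generators_of_card_eq_six {B : Type*} [Group B] (h : Nat.card B = 6) :
    ∃ c s : B, Function.Bijective ![1, c, c ^ 2, s, c * s, c ^ 2 * s] ∧ c ^ 3 = 1 ∧ s ^ 2 = 1 ∧
      (s * c = c * s ∨ s * c = c ^ 2 * s) := by
  have : Finite B := Nat.finite_of_card_ne_zero (by omega)
  have : Fact (Nat.Prime 2) := ⟨Nat.prime_two⟩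
  have : Fact (Nat.Prime 3) := ⟨Nat.prime_three⟩
  obtain ⟨c, hc⟩ := exists_prime_orderOf_dvd_card' (G := B) 3 (by rw [h]; norm_num)
  obtain ⟨s, hs⟩ := exists_prime_orderOf_dvd_card' (G := B) 2 (by rw [h]; norm_num)
  have hsc : ∀ k : ℤ, s ≠ c ^ k := by
    rintro k rfl
    have := orderOf_dvd_of_mem_zpowers (Subgroup.zpow_mem_zpowers c k)
    rw [hs, hc] at this
    omega
  have hc3 : c ^ 3 = 1 := hc ▸ pow_orderOf_eq_one c
  have hs2 : s ^ 2 = 1 := hs ▸ pow_orderOf_eq_one s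
  have hc1 : c ≠ 1 := by
    rintro rfl
    simp at hc
  have hc2 : c ^ 2 ≠ 1 := by
    intro h
    have := orderOf_dvd_of_pow_eq_one h
    rw [hc] at this
    omega
  have hinj : Function.Injective ![1, c, c ^ 2, s, c * s, c ^ 2 * s] := by
    have hform : ∀ n : Fin 6, ![1, c, c ^ 2, s, c * s, c ^ 2 * s] n =
        c ^ (n.val % 3) * s ^ (n.val / 3) := by
      intro n
      fin_cases n <;> simp
    have haux : ∀ m n : Fin 6, m.val / 3 < n.val / 3 →
        c ^ (m.val % 3) * s ^ (m.val / 3) ≠ c ^ (n.val % 3) * s ^ (n.val / 3) := by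
      intro m n hmn e
      rw [show m.val / 3 = 0 by omega, show n.val / 3 = 1 by omega, pow_zero, mul_one, pow_one] at e
      refine hsc (-((n.val % 3 : ℕ) : ℤ) + ((m.val % 3 : ℕ) : ℤ)) ?_
      rw [zpow_add, zpow_neg, zpow_natCast, zpow_natCast, e, inv_mul_cancel_left]
    intro m n hmn
    rw [hform, hform] at hmn
    rcases lt_trichotomy (m.val / 3) (n.val / 3) with hlt | heq | hlt
    · exact absurd hmn (haux m n hlt)
    · rw [heq] at hmn
      have := pow_injOn_Iio_orderOf (x := c) (by simp [hc]; omega) (by simp [hc]; omega)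
        (mul_right_cancel hmn)
      exact Fin.ext (by omega)
    · exact absurd hmn.symm (haux n m hlt)
  have hbij : Function.Bijective ![1, c, c ^ 2, s, c * s, c ^ 2 * s] :=
    (Nat.bijective_iff_injective_and_card _).2 ⟨hinj, by simp [h]⟩
  refine ⟨c, s, hbij, hc3, hs2, ?_⟩
  obtain ⟨n, hn⟩ := hbij.2 (s * c)
  have hno : ∀ k : ℤ, s * c ≠ c ^ k := by
    intro k hk
    apply hsc (k - 1)
    rw [zpow_sub_one, ← hk, mul_inv_cancel_right]
  fin_cases n
  · exact absurd hn.symm (by simpa using hno 0)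
  · exact absurd hn.symm (by simpa using hno 1)
  · exact absurd hn.symm (by simpa using hno 2)
  · simp at hn
    exact absurd hn hc1
  · exact Or.inl hn.symm
  · exact Or.inr hn.symm

/-- The permutation of the directions induced by an element of order three. -/
def permC : Equiv.Perm (Fin 6) := ⟨![1, 2, 0, 4, 5, 3], ![2, 0, 1, 5, 3, 4], by decide, by decide⟩

/-- The permutation of the directions induced by an involution that commutes with `permC`. -/
def permS : Equiv.Perm (Fin 6) := ⟨![3, 4, 5, 0, 1, 2], ![3, 4, 5, 0, 1, 2], by decide, by decide⟩

/-- The permutation of the directions induced by an involution that inverts `permC`. -/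
def permS' : Equiv.Perm (Fin 6) := ⟨![3, 5, 4, 0, 2, 1], ![3, 5, 4, 0, 2, 1], by decide, by decide⟩

/-- The table of a lift of `permC`. -/
def tabC : ℕ :=
  18097722859836045523772529865006621121957189918242362093763955610753477849244462463881198197865434883827379284771072

/-- The table of a lift of `permS`. -/
def tabS : ℕ :=
  23348691275190014099185007194660756647469634912466237133857483741322902372872519951879569598341271374873009646901120

/-- The table of a lift of `permS'`. -/
def tabS' : ℕ :=
  23376211387140377711275053019139891685029100973915650565185061322056138189970084240417275857618850509254429953648320

/-- The table of an automorphism of order three that commutes with the automorphisms with tables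
`tabC` and `tabS'` up to scalars. -/
def tabU : ℕ :=
  16223249925465896555548302548217218092120130648241524469646885547976204054879275033265746439836715879196909163791104

theorem tabs_check : (isAutTab tabC && actsTab tabC (fun d => [1, 2, 0, 4, 5, 3].getD d 0) &&
    (isAutTab tabS && actsTab tabS fun d => [3, 4, 5, 0, 1, 2].getD d 0) &&
    (isAutTab tabS' && actsTab tabS' fun d => [3, 5, 4, 0, 2, 1].getD d 0) &&
    isAutTab tabU) = true := by
  decide +kernel

theorem exists_acts_permC : ∃ g, Rep tabC g ∧ Acts g permC := by
  have h := tabs_check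
  simp only [Bool.and_eq_true] at h
  obtain ⟨g, hg⟩ := exists_rep_of_isAutTab h.1.1.1.1
  exact ⟨g, hg, acts_of_actsTab hg (by decide) h.1.1.1.2⟩

theorem exists_acts_permS : ∃ g, Rep tabS g ∧ Acts g permS := by
  have h := tabs_check
  simp only [Bool.and_eq_true] at h
  obtain ⟨g, hg⟩ := exists_rep_of_isAutTab h.1.1.2.1
  exact ⟨g, hg, acts_of_actsTab hg (by decide) h.1.1.2.2⟩

theorem exists_acts_permS' : ∃ g, Rep tabS' g ∧ Acts g permS' := by
  have h := tabs_check
  simp only [Bool.and_eq_true] at h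
  obtain ⟨g, hg⟩ := exists_rep_of_isAutTab h.1.2.1
  exact ⟨g, hg, acts_of_actsTab hg (by decide) h.1.2.2⟩

/-- Tables of automorphisms by which lifts of permutations will be conjugated. -/
def conjTabs : List ℕ :=
  [idTab, tabU, comp tabU tabU].flatMap fun T => scalarTabs.map (comp T)

theorem exists_rep_conjTab {T : ℕ} (hT : T ∈ conjTabs) : ∃ g, Rep T g := by
  obtain ⟨u, hu⟩ := exists_rep_of_isAutTab (T := tabU) (by
    have h := tabs_check
    rw [Bool.and_eq_true] at h
    exact h.2)
  rw [conjTabs, List.mem_flatMap] at hT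
  obtain ⟨S, hS, hT⟩ := hT
  obtain ⟨Z, hZ, rfl⟩ := List.mem_map.1 hT
  obtain ⟨z, hz, -⟩ := exists_acts_one hZ
  have : ∃ g, Rep S g := by
    simp only [List.mem_cons, List.not_mem_nil, or_false] at hS
    rcases hS with rfl | rfl | rfl
    · exact ⟨1, rep_one⟩
    · exact ⟨u, hu⟩
    · exact ⟨u * u, hu.comp hu⟩
  obtain ⟨g, hg⟩ := this
  exact ⟨g * z, hg.comp hz⟩

/-- All pairs of lifts of two permutations whose tables satisfy `rel` are conjugate to the pair with
tables `C` and `S`. -/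
def conjugateCheck (C S : ℕ) (rel : ℕ → ℕ → Bool) : Bool :=
  scalarTabs.all fun z => scalarTabs.all fun w => force (comp C z) fun c => force (comp S w) fun s =>
    !rel c s || conjTabs.any fun t => eqTab (comp t c) (comp C t) && eqTab (comp t s) (comp S t)

/-- A permutation has three lifts, which differ by scalars, so there are nine pairs of lifts. Those
that satisfy the relation between `c` and `s` are conjugate to the chosen pair by one of the nine
elements of `conjTabs`. This removes the ambiguity left after prescribing the permutations. -/
theorem conjugateCheck_permS :
    conjugateCheck tabC tabS (fun c s => eqTab (comp s c) (comp c s)) = true := by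
  decide +kernel

theorem conjugateCheck_permS' :
    conjugateCheck tabC tabS' (fun c s => eqTab (comp s c) (comp (comp c c) s)) = true := by
  decide +kernel

theorem exists_conjugate {C S : ℕ} {rel : ℕ → ℕ → Bool} (h : conjugateCheck C S rel = true)
    {γ δ c s : ModelAut} {σ τ : Equiv.Perm (Fin 6)} (hC : Rep C γ) (hS : Rep S δ) (hγ : Acts γ σ)
    (hδ : Acts δ τ) (hc : Acts c σ) (hs : Acts s τ)
    (hrel : ∀ T T', Rep T c → Rep T' s → rel T T' = true) :
    ∃ t : ModelAut, Rep C (t * c * t⁻¹) ∧ Rep S (t * s * t⁻¹) := by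
  obtain ⟨z, hz, hcz⟩ := hγ.exists_mul_scalar hc hC
  obtain ⟨w, hw, hsw⟩ := hδ.exists_mul_scalar hs hS
  have hr := hrel _ _ hcz hsw
  simp only [conjugateCheck, List.all_eq_true, force_eq, Bool.or_eq_true, List.any_eq_true] at h
  replace h := (h z hz w hw).resolve_left (by rw [hr]; exact Bool.false_ne_true)
  obtain ⟨T, hT, h⟩ := h
  obtain ⟨t, ht⟩ := exists_rep_conjTab hT
  rw [Bool.and_eq_true, eqTab_iff (ht.comp hcz) (hC.comp ht),
    eqTab_iff (ht.comp hsw) (hS.comp ht)] at h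
  refine ⟨t, ?_, ?_⟩
  · rw [h.1, mul_inv_cancel_right]
    exact hC
  · rw [h.2, mul_inv_cancel_right]
    exact hS

/-- By regularity an element that fixes `0` is determined by the image of the base line, and every
line through `0` occurs as such an image. So the stabilizer has order six and permutes these lines
regularly. -/
theorem card_stabPoint {G : Subgroup ModelAut} (hG : IsEdgeRegular G.subtype) :
    Function.Bijective fun b : ↥(G ⊓ stabPoint) => (ln b.1 baseLine).1 := by
  have hline : ∀ b : ↥(G ⊓ stabPoint), ln b.1 baseLine = lineThrough (ln b.1 baseLine).1 0 := by
    intro b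
    have := (modelInc_map_iff b.1 0 _).2 modelInc_base
    rw [show pt b.1 0 = 0 from b.2.2] at this
    exact modelInc_iff.1 this
  constructor
  · intro b b' h
    have hl : ln b.1 baseLine = ln b'.1 baseLine := by
      rw [hline b, hline b']
      exact congrArg (fun x => lineThrough x 0) h
    have h0 : pt b.1 0 = pt b'.1 0 :=
      (show pt b.1 0 = 0 from b.2.2).trans (show pt b'.1 0 = 0 from b'.2.2).symm
    have := hG.eq_of_base (v := ⟨b.1, b.2.1⟩) (w := ⟨b'.1, b'.2.1⟩) h0 hl
    exact Subtype.ext (congrArg Subtype.val this :)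
  · intro d
    obtain ⟨v, ⟨hv0, hvl⟩, -⟩ := (isEdgeRegular_iff _).1 hG 0 baseLine modelInc_base 0
      (lineThrough d 0) (modelInc_lineThrough d 0)
    exact ⟨⟨v.1, v.2, hv0⟩, congrArg Prod.fst hvl⟩

/-- A regular group is conjugate to one in which the stabilizer of the base point is generated by the
automorphisms with tables `tabC` and either `tabS` or `tabS'`. -/
theorem exists_conj_stabPoint {G : Subgroup ModelAut} (hG : IsEdgeRegular G.subtype) :
    ∃ η : ModelAut, ∃ c ∈ G, ∃ s ∈ G, Rep tabC (η * c * η⁻¹) ∧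
      (Rep tabS (η * s * η⁻¹) ∨ Rep tabS' (η * s * η⁻¹)) := by
  have hbij := card_stabPoint hG
  obtain ⟨c, s, hL, hc3, hs2, hsc⟩ := exists_generators_of_card_eq_six
    ((Nat.card_congr (Equiv.ofBijective _ hbij)).trans (by simp))
  set L := ![1, c, c ^ 2, s, c * s, c ^ 2 * s] with hLdef
  -- The lines through `0` are renumbered by the group elements that carry the base line to them. In
  -- this numbering the stabilizer acts by left multiplication, and every renumbering is induced by
  -- some automorphism `h`.
  let e : Equiv.Perm (Fin 6) := (Equiv.ofBijective _ hL).trans (Equiv.ofBijective _ hbij)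
  have he : ∀ n, ln (L n).1 baseLine = lineThrough (e n) 0 := by
    intro n
    have := (modelInc_map_iff (L n).1 0 _).2 modelInc_base
    rw [show pt (L n).1 0 = 0 from (L n).2.2] at this
    exact modelInc_iff.1 this
  obtain ⟨h, hh⟩ := exists_acts_perm e
  have hacts : ∀ (b : ↥(G ⊓ stabPoint)) (σ : Equiv.Perm (Fin 6)), (∀ n, b * L n = L (σ n)) →
      Acts (h⁻¹ * b.1 * h) σ := by
    intro b σ hσ
    refine ⟨?_, fun n => ?_⟩
    · rw [pt_mul, pt_mul, hh.pt_zero, show pt b.1 0 = 0 from b.2.2, hh.inv.pt_zero]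
    · rw [mul_assoc, ln_mul, ln_mul, hh.ln_eq, ← he, ← ln_mul b.1, ← Subgroup.coe_mul, hσ, he, hh.inv.ln_eq]
      simp
  have hc : Acts (h⁻¹ * c.1 * h) permC := hacts c permC fun n => by
    have h2 : c * c = c ^ 2 := (sq c).symm
    have h3 : c * c ^ 2 = 1 := by rw [← hc3, pow_succ' c 2]
    fin_cases n
    · exact mul_one c
    · exact h2
    · exact h3
    · rfl
    · exact (mul_assoc c c s).symm.trans (by rw [h2]; rfl)
    · exact (mul_assoc c (c ^ 2) s).symm.trans (by rw [h3, one_mul]; rfl)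
  have hss : s * s = 1 := by rw [← sq, hs2]
  obtain ⟨γ, hγ, hγ'⟩ := exists_acts_permC
  -- After conjugation with `h` the permutations are the standard ones; a further conjugation with
  -- `t` takes care of the scalars.
  suffices H : ∃ t : ModelAut, Rep tabC (t * (h⁻¹ * c.1 * h) * t⁻¹) ∧
      (Rep tabS (t * (h⁻¹ * s.1 * h) * t⁻¹) ∨ Rep tabS' (t * (h⁻¹ * s.1 * h) * t⁻¹)) by
    obtain ⟨t, h1, h2⟩ := H
    have hconj : ∀ b : ModelAut, t * (h⁻¹ * b * h) * t⁻¹ = (t * h⁻¹) * b * (t * h⁻¹)⁻¹ := by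
      intro b
      group
    rw [hconj] at h1
    rw [hconj] at h2
    exact ⟨t * h⁻¹, c.1, c.2.1, s.1, s.2.1, h1, h2⟩
  rcases hsc with hsc | hsc
  · have hs : Acts (h⁻¹ * s.1 * h) permS := hacts s permS fun n => by
      have hsc2 : s * c ^ 2 = c ^ 2 * s := by
        rw [sq, ← mul_assoc, hsc, mul_assoc, hsc, ← mul_assoc]
      fin_cases n
      · exact mul_one s
      · exact hsc
      · exact hsc2
      · exact hss
      · exact (mul_assoc s c s).symm.trans (by rw [hsc, mul_assoc, hss, mul_one]; rfl)
      · exact (mul_assoc s (c ^ 2) s).symm.trans (by rw [hsc2, mul_assoc, hss, mul_one]; rfl)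
    obtain ⟨δ, hδ, hδ'⟩ := exists_acts_permS
    obtain ⟨t, h1, h2⟩ := exists_conjugate conjugateCheck_permS hγ hδ hγ' hδ' hc hs
      fun T T' hT hT' => by
        rw [eqTab_iff (hT'.comp hT) (hT.comp hT')]
        have := congrArg Subtype.val hsc
        simp only [Subgroup.coe_mul] at this
        calc h⁻¹ * s.1 * h * (h⁻¹ * c.1 * h) = h⁻¹ * (s.1 * c.1) * h := by group
          _ = _ := by rw [this]; group
    exact ⟨t, h1, Or.inl h2⟩
  · have hs : Acts (h⁻¹ * s.1 * h) permS' := hacts s permS' fun n => by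
      have hsc2 : s * c ^ 2 = c * s := by
        rw [sq, ← mul_assoc, hsc, mul_assoc, hsc, ← mul_assoc, ← pow_add, pow_succ, hc3, one_mul]
      fin_cases n
      · exact mul_one s
      · exact hsc
      · exact hsc2
      · exact hss
      · exact (mul_assoc s c s).symm.trans (by rw [hsc, mul_assoc, hss, mul_one]; rfl)
      · exact (mul_assoc s (c ^ 2) s).symm.trans (by rw [hsc2, mul_assoc, hss, mul_one]; rfl)
    obtain ⟨δ, hδ, hδ'⟩ := exists_acts_permS'
    obtain ⟨t, h1, h2⟩ := exists_conjugate conjugateCheck_permS' hγ hδ hγ' hδ' hc hs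
      fun T T' hT hT' => by
        rw [eqTab_iff (hT'.comp hT) ((hT.comp hT).comp hT')]
        have := congrArg Subtype.val hsc
        simp only [Subgroup.coe_mul, SubmonoidClass.coe_pow] at this
        calc h⁻¹ * s.1 * h * (h⁻¹ * c.1 * h) = h⁻¹ * (s.1 * c.1) * h := by group
          _ = _ := by rw [this, sq]; group
    exact ⟨t, h1, Or.inr h2⟩


/-! ### The classification on the model -/

/-- The image of `Lᵢ` is a regular group inside the regular group `H`. An element of `H` agrees on
the base edge with one of the image, hence equals it, so the two groups coincide. -/
theorem actionIso_of_good {H : Subgroup ModelAut} (hH : IsEdgeRegular H.subtype) {i : Fin 11}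
    {y : ℕ → ModelAut} (hy : Good i y) (hmem : ∀ k < 4, y k ∈ H) :
    ActionIso H.subtype (presL i).action := by
  obtain ⟨ρ, hρ, hreg, hiso⟩ := hy.exists_regular
  have hle : ρ.range ≤ H := by
    rw [MonoidHom.range_eq_map, ← closure_gen i, MonoidHom.map_closure, Subgroup.closure_le]
    rintro _ ⟨_, ⟨k, rfl⟩, rfl⟩
    change ρ (gen (presL i) k) ∈ H
    rw [hρ k k.2]
    exact hmem k k.2
  have heq : ρ.range = H := by
    refine le_antisymm hle fun h hh => ?_
    obtain ⟨v, ⟨hv0, hvl⟩, -⟩ := (isEdgeRegular_iff ρ).1 hreg 0 baseLine modelInc_base (pt h 0)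
      (ln h baseLine) ((modelInc_map_iff _ _ _).2 modelInc_base)
    have := hH.eq_of_base (v := ⟨ρ v, hle ⟨v, rfl⟩⟩) (w := ⟨h, hh⟩) hv0 hvl
    exact ⟨v, congrArg Subtype.val this⟩
  rw [← heq]
  exact (actionIso_range ρ hreg.injective).trans hiso

/-! ### Certificates for a choice of generators. -/

/-- The word encoded by the octal digits of a number, without the leading digit. -/
def octalWord : ℕ → ℕ → List ℕ
  | 0, _ => []
  | k + 1, n => bif Nat.ble n 1 then [] else n % 8 :: octalWord k (n / 8)

theorem octalWord_lt (k n : ℕ) : ∀ l ∈ octalWord k n, l < 8 := by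
  induction k generalizing n with
  | zero => simp [octalWord]
  | succ k ih =>
    intro l hl
    rw [octalWord] at hl
    cases h : Nat.ble n 1
    · rw [h, cond_false] at hl
      rcases List.mem_cons.1 hl with rfl | hl
      · exact Nat.mod_lt _ (by norm_num)
      · exact ih _ l hl
    · rw [h, cond_true] at hl
      exact absurd hl List.not_mem_nil

/-- The word `w` in the letters with tables `E` fixes the base point and the base line, but is not the
identity. -/
def nonRegular (E : List ℕ) (w : List ℕ) : Bool :=
  Nat.beq (evalWord E w 0) 0 && Nat.beq (dirOf (evalWord E w 16)) 0 && !isId (evalWord E w)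

/-- In a regular group the identity is the only element that fixes the base edge. -/
theorem nonRegular_eq_false {H : Subgroup ModelAut} (hH : IsEdgeRegular H.subtype) {E : List ℕ}
    {e : ℕ → ModelAut} {w : List ℕ} (he : ∀ l ∈ w, e l ∈ H ∧ Rep (E.getD l 0) (e l)) :
    nonRegular E w = false := by
  rw [← Bool.not_eq_true]
  intro h
  simp only [nonRegular, Bool.and_eq_true, Nat.beq_eq, Bool.not_eq_true'] at h
  obtain ⟨⟨h0, h16⟩, h⟩ := h
  have hpt := pt_prod fun l hl => (he l hl).2
  have hmem : (w.map e).prod ∈ H := H.list_prod_mem fun x hx => by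
    obtain ⟨l, hl, rfl⟩ := List.mem_map.1 hx
    exact (he l hl).1
  have h0' : pt (w.map e).prod 0 = 0 := Fin.ext ((hpt 0).trans h0)
  have hl : ln (w.map e).prod baseLine = baseLine :=
    (ln_baseLine_of_fix h0' 0).2 ((congrArg dirOf (hpt 16)).trans h16)
  have := hH.eq_of_base (v := ⟨_, hmem⟩) (w := 1) (h0'.trans (pt_one 0).symm)
    (hl.trans (ln_one _).symm)
  rw [(eq_one_iff_isId hpt).2 (congrArg Subtype.val this)] at h
  exact Bool.noConfusion h

/-- The test whether four of the letters with tables `E`, given by the hexadecimal digits of `m`, satisfy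
the conditions for the group whose index is the last digit. -/
def goodLetters (E : List ℕ) (m : ℕ) : Bool :=
  Nat.blt (m % 16) 11 && (List.range 4).all (fun k => Nat.blt (m / 16 ^ (k + 1) % 16) 9) &&
  force (E.getD (m / 16 % 16) 0) fun t₀ => force (E.getD (m / 16 ^ 2 % 16) 0) fun t₁ =>
  force (E.getD (m / 16 ^ 3 % 16) 0) fun t₂ => force (E.getD (m / 16 ^ 4 % 16) 0) fun t₃ =>
  force (invTab t₀) fun s₀ => force (invTab t₁) fun s₁ =>
  force (invTab t₂) fun s₂ => force (invTab t₃) fun s₃ =>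
    (invCheck s₀ t₀ && invCheck s₁ t₁ && invCheck s₂ t₂ && invCheck s₃ t₃) &&
      goodTabs (m % 16) [t₀, s₀, t₁, s₁, t₂, s₂, t₃, s₃]

theorem exists_actionIso_of_goodLetters {H : Subgroup ModelAut} (hH : IsEdgeRegular H.subtype)
    {E : List ℕ} {e : ℕ → ModelAut} (he : ∀ l < 9, e l ∈ H ∧ Rep (E.getD l 0) (e l)) {m : ℕ}
    (h : goodLetters E m = true) : ∃ i : Fin 11, ActionIso H.subtype (presL i).action := by
  simp only [goodLetters, force_eq, Bool.and_eq_true, Nat.blt_eq] at h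
  obtain ⟨⟨hi, hx⟩, ⟨⟨⟨h₀, h₁⟩, h₂⟩, h₃⟩, h⟩ := h
  have hx : ∀ k < 4, m / 16 ^ (k + 1) % 16 < 9 := fun k hk => by
    simpa only [Nat.blt_eq] using forall_lt_of_all hx k hk
  have hy := fun k hk => he _ (hx k hk)
  refine ⟨⟨m % 16, hi⟩, actionIso_of_good hH (y := fun k => e (m / 16 ^ (k + 1) % 16)) ?_
    fun k hk => (hy k hk).1⟩
  refine (goodTabs_iff (i := ⟨m % 16, hi⟩) fun l hl => ?_).1 h
  have r₀ := (hy 0 (by norm_num)).2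
  have r₁ := (hy 1 (by norm_num)).2
  have r₂ := (hy 2 (by norm_num)).2
  have r₃ := (hy 3 (by norm_num)).2
  rw [zero_add, pow_one] at r₀
  interval_cases l
  · exact r₀
  · exact r₀.inv h₀
  · exact r₁
  · exact r₁.inv h₁
  · exact r₂
  · exact r₂.inv h₂
  · exact r₃
  · exact r₃.inv h₃

/-- The check of a certificate `n` for the letters with tables `E`: either a word that contradicts
regularity, or letters that generate one of the groups. -/
def certCheck (E : List ℕ) (n : ℕ) : Bool :=
  bif Nat.beq (n % 2) 1 then nonRegular E (octalWord 20 (n / 2)) else goodLetters E (n / 2)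

theorem exists_actionIso_of_certCheck {H : Subgroup ModelAut} (hH : IsEdgeRegular H.subtype)
    {E : List ℕ} {e : ℕ → ModelAut} (he : ∀ l < 9, e l ∈ H ∧ Rep (E.getD l 0) (e l)) {n : ℕ}
    (h : certCheck E n = true) : ∃ i : Fin 11, ActionIso H.subtype (presL i).action := by
  rw [certCheck] at h
  cases hn : Nat.beq (n % 2) 1
  · rw [hn, cond_false] at h
    exact exists_actionIso_of_goodLetters hH he h
  · rw [hn, cond_true, nonRegular_eq_false hH fun l hl =>
      he l ((octalWord_lt _ _ l hl).trans (by norm_num))] at h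
    exact Bool.noConfusion h

/-! ### Candidates for the generators of the stabilizer of the base line. -/

/-- The test whether an automorphism fixes no point of the base line or is the identity. -/
def fixFree (P : ℕ) : Bool := !([0, 16, 32, 48].any fun u => Nat.beq (ap P u) u) || isId (ap P)

/-- The test for an automorphism that stabilizes the base line: a power that fixes a point of the base
line is the identity. -/
def isFreeTab (T : ℕ) : Bool :=
  force (comp T T) fun T₂ => force (comp T₂ T₂) fun T₄ => fixFree T && fixFree T₂ && fixFree T₄

/-- An element that stabilizes the base line and fixes one of its points fixes an edge, hence is
trivial in a regular group. This applies to `g` and also to its powers `g²` and `g⁴`. -/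
theorem isFreeTab_of_regular {H : Subgroup ModelAut} (hH : IsEdgeRegular H.subtype) {T : ℕ}
    {g : ModelAut} (hg : g ∈ H) (hl : ln g baseLine = baseLine) (hT : Rep T g) :
    isFreeTab T = true := by
  have key : ∀ (P : ℕ) (k : ModelAut), k ∈ H → ln k baseLine = baseLine → Rep P k →
      fixFree P = true := by
    intro P k hk hkl hP
    rw [fixFree, Bool.or_eq_true]
    by_cases h : ([0, 16, 32, 48].any fun u => Nat.beq (ap P u) u) = true
    · right
      rw [List.any_eq_true] at h
      obtain ⟨u, hu, h⟩ := h
      have hu64 : u < 64 := by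
        simp only [List.mem_cons, List.not_mem_nil, or_false] at hu
        omega
      have hfix : pt k ⟨u, hu64⟩ = ⟨u, hu64⟩ :=
        Fin.ext ((hP ⟨u, hu64⟩).trans (Nat.eq_of_beq_eq_true h))
      obtain ⟨v, hv, huniq⟩ := (isEdgeRegular_iff _).1 hH ⟨u, hu64⟩ baseLine
        (modelInc_baseLine_iff_mem.2 hu) ⟨u, hu64⟩ baseLine (modelInc_baseLine_iff_mem.2 hu)
      have h1 := (huniq ⟨k, hk⟩ ⟨hfix, hkl⟩).trans (huniq 1 ⟨pt_one _, ln_one _⟩).symm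
      exact (eq_one_iff_isId hP).2 (congrArg Subtype.val h1)
    · left
      rw [Bool.not_eq_true] at h
      rw [h]
      rfl
  have hl2 : ln (g * g) baseLine = baseLine := (stabLine.mul_mem (x := g) (y := g) hl hl :)
  have hl4 : ln (g * g * (g * g)) baseLine = baseLine := by rw [ln_mul, hl2, hl2]
  have h2 := H.mul_mem hg hg
  rw [isFreeTab, force_eq, force_eq, Bool.and_eq_true, Bool.and_eq_true]
  exact ⟨⟨key _ g hg hl hT, key _ _ h2 hl2 (hT.comp hT)⟩,
    key _ _ (H.mul_mem h2 h2) hl4 ((hT.comp hT).comp (hT.comp hT))⟩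

/-- The table of the translation by the point `16` of the base line. -/
def transTab₁ : ℕ :=
  29385220040646928311500619475290425927850379972578224426651117322527416602473999359201102685904944885637045912675408

/-- The table of the translation by the point `32` of the base line. -/
def transTab₂ : ℕ :=
  19378361324102298670286895005160074111241030752317599369075429075153622573646344423390027976952653068280830643546208

/-- The candidates for elements of order four. -/
def cyclicTabs : List ℕ := [
    9362033134185712221288109359217276027576204520417559874478871981499480841481548544126995968592521763881125428401296,
    23150778827041486273317484148409283964373350483845287571405759101054628800806924199526408107599320787111929492874448,
    5638776073088357737566642775067515324286902472114571294716614833317024845061696162565423662845155454009287842800848,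
    28779183139010903836251901627667468089697153994798137838636650796775143714267673648416826035080176588002137393935440,
    3762036794990774071090056483324509652015174182855856471783929938746860554783824440000632561758810792427221286466640,
    26874036335480231767657769658904443371225335043528548589175171438537943830681443331754743050750079362053740392420496,
    27538257262425026839527113773700361109223491510030360742169513652550012136486763522832782697681129567979572999034000,
    32551451748320795825760407537209788900732507984007392133573389687390228607019588037622712847211206190828771193726160,
    14374785388142284377554551094161153764985387883091810388569957835823321877272393482389177938762300799490275152573520,
    15654807563792675765982256136381013654422880470178679150373033174448339779528289481229725593630871739559821074830480,
    36871129178796910786608059704079038569156941042649169768110662924677879575288056866840720664838020889330177295066320,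
    8121109645678387813893916753582509816284905547298441369462853450075605562816718465841652814243187297397289207280720,
    25046308307367662702888222120598532032309668587815949083615334424317528780736674819609279117179856751082900245783760,
    37535793980298608838594517194386996703041242122011834931317555980238085828203516561715284584762397588802253099709520,
    33138254498560405337644322442091384642199376778446269963329647410831337534313795774241560183719530635768526122071120,
    6235197297524002752666001966827218384693924421365380101520443687659042928611407262587538193094500628854044873266320,
    18156523584953050647514532526554930650407818549909406069754585444340278597246730276632686882099199410211030983054480,
    13749512319761764140092138998491631214560960479444575413144457430996010389888663597401190971819890752097779236283600,
    22525506949278474486311328006774550037022870925608826791195924126874706798181982172246641826163847686584107694371920,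
    35043401150719550973018118116657016681209013417602076230134724104923570996224343491512979065115871272795417260922000,
    16251228788263530032243234315010946914108581070555574770533164890188808241061771143470914897691610687818962458453200,
    19378212509707519714814459548643027863033299092192376121344826966921203229837907107774663041457781326241366387799120,
    38757485293131630495208592499991884304641244941344501347543659049404595070392438991775891953734652164627582931506320,
    4348840735847892033446650244568973945646938011289776084080292373631468400052358386985604266794477088486665922880720,
    9303843514814655534390446188826021185027020165189774357978650391874942512712567689582371143366295060417698990212624,
    23180532402960738205479584297793384625333522033420270965348031776391808463113317768479663973824163251333962027599632,
    38659929402953941040973307272952643514741510124375205920651676010641864244933952967143651867409077361817795725199120,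
    4340144192688239159354433754262143384537454453644860582294235221169262062525797292938653300989261753659119932392720,
    18097131218266371497609305666076611858420401160299138417913160701501291510140766096054597469346272968478994974491920,
    13835795242204352187706310715484174387207251080897977098907437929498795638998774904851523618001882898950670844511760,
    20679446681274255099942949644046453133232854652468088026247661968449109251743769327629933844513591974004749590709520,
    31349019080010279138086452764712724977102924230785122193744549587345505531379577125880545361793804362642317527565840,
    16221474771990863816326760177792548828465406020664399035552574194473814168806666837729080722600271612365934483834640,
    19347986656633453972818416966644240733561217097138989715108030334779048019200635823379168717109001330261442309506320,
    21381222066870517666213247727659145487932277411806780285711888433730974385470930014428018426114387322572110082180880,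
    31937162029096236590175341677744654576344130576610381730789294323992363438259659819037662748179389711254251095835920,
    33109860728768409545155636596685263433359020957053403611741028679745118877528518499399474525398357256999000747394320,
    6177923169300972924659482005128968146261238421726390778211178936114212946741162067574299508595034994901552383215120,
    14705564620407679843843387629967288818761022146906693122463269885550386668423774488647027354716900155366213873479632,
    15515043996940742956451781942311684186076586341459046760975382534900603124596105408564018038001401372153347947884880,
    36769238025608690395823003617273154089229941191333382581495249031799131531973448122919862405569125311259683186274640,
    8536299865087744572888578478449633007678226721548555641812971239106154329338246307122960500479310929025742577359504,
    21796609233036850867406958171288620190444417397734081864857459836654064754880987992849829476550942282598993127824016,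
    30457490077040855030569203237910542041840005679380550406746415973000306275414662952642070900042194412667310555181008,
    38586904076697884343115594217686940037361753475150034157523502126258876136175754413204427707216696273230322371129680,
    4899191489024422879466954748366450485394239993132884053310281030858908233370390667758962411636444808796936827853456,
    18340897277997556226053990723793440228674973256955705263104693241075076235061599000527195607555762345517361711722448,
    13581970448113853991200932125403890831933029526675503956071814032596159439144761810341078150743826786365741936144720,
    22636714697381739999237363733074517988260134161218861437989883260018316868027343207422369056596201384427478999363920,
    34502813912760900263600083371390790151163541654702500661823086739685101867341270620356902625075719638866941506771600,
    24696441955468088455307075181164981020213266698669574621114765266631741520487379658040660843118909557250041190985680,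
    37336655623920610385849185738178216200717178438303578419951395579341212586300037057627749181164508905972777981047120,
    24932582921902225747048572136059132556122150029098930563427201310557187216929640314771203896145586626936335803673040,
    37143128522362555460153247336707449252850941092000827467036958966925055673438575305674825356456290631240774586105424,
    33047645707334397862248503748291175364985538903382434936076307848714527972127362713845355058713609378294183013356432,
    6746449587136693023820442223647355754796098269822061126288201906214522370668920770487836699631695178094934229314000,
    20537780794871508637817721979748387184013863389619107875677263978040706949548540221975795495629265304422171067869648,
    31043404371129899713093636566609858990316084812908734441888336968971973304762525123516373004603917351409580496289360,
    16504440209196023196424988623736823811432976296407568981761881823023671821826634858248168545698919117862563185589840,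
    19103177880779420467813107580899494616570570809245403959556509760852730448807621191286902787513705582051728541324176,
    36682386388902411642627553508631100710661810450763392469736964016591224437099080068080558255229853607984453507847056,
    8564411516202224982900935894954354226076445655433663143285932840878944901359721122255456143436300913318952664623568,
    21511196798622100959788691260601191638145786409394306960187584291141266003739912351055446972808483647457351056724880,
    31443778478871950802206635577841430646864582609017218959891242138494249080349771935490074642182176419063944152672720,
    9776190802758275825014975415028972330693914376341004089208704566965968855847462317590585908116497516492422298003920,
    22897564617026446530379652879855383243322173941899165878785802984360878183953213492640666743150944106639315319815760,
    22413594638794979956348200491860584748764051212334830034567798811803484158293146635545759343504363481223561706257232,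
    34766180211521966660780010215719175714435821415218405549550778312870379238975035831999168020369737286695198923873680,
    16590108107101848137186216882600099069879309711539275376343413400888842273064624396111768542642137776947574369869200,
    19132473711097388328593538321212232926054359066654337344052591638186447734600066153969767698156526389183765630378704,
    21239102911722285597618889445954720991731111437597044694251488493650292352296151166739581892636364173293026945842000,
    31602686190531239898631734990456361968703013901827159783008918900303871612263699417541828345099509457156199020420496,
    33075165819178920411817913852346882562099291542424708872711122873325688728589776549044390133352426255348562191147728,
    6688301801181231695149259789263932649139275804438168320035344384179187829046072121895641212096603077509387560467280,
    14637800102898672164569149883684572428854915071419204589920775302763761338232361684480860292203152633754815690628496,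
    15420202581636725610320406262090724464748317578272721483376970899888175295976009639344331883592448441037185671979728,
    20388343580326160634160938305384035521351994226049033653913576305032760894090882375101191450862316661201398406241680,
    31180263855640146269363686705429527952193911523850988979033921130733174546240757899073057665630509315968398521754320,
    9718931206143317019332924086323766308133023758757671594449197732149868451923307784758590496596230001876882849053520,
    22811897159470676256159456781009454176407893931889042196620096553326319108399128813646290143966111386593378232622480,
    6263751474126904817766664048854097191050242881180560537675809325596166377517285349505085350850465656479926188652640,
    13143920110496856632103759679036758031817009480202387844320381919021303784199728141573052061082791332363255329204448,
    4358604223254841738553713153745673769015741418530698850207174778058107460476388282176239729116976165461555873192096,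
    18772324422466274195038177158294942157140812991155238111551273614741818697660477590463469988563647133253463230265440,
    8140490304883097473624431414251704159759288659059002922601339030865471634340490321403113814533418052992019431041248,
    16867177618935602126444045189531917438668994039885648862089794256504618814074247273801387004233549907305066228750496,
    35034080344959128219694365835685530872286562342374577162301623007485443933816809090391228144283376772466349313767520,
    2530877984508014473774423711578359708759179214916154742284060852001804312471186707740731560939130121414906458024160,
    28759799947237228712532177512194934246615505675719732746625769451001023785035735955006173225271328082582816969599200,
    25661667473247610332505142891999892140615457460958403908556805715096058801248830698083739068790846782979781713336480,
    13740340738477278081536611474149524764888298324953620809359115285793518546007116553638925111747675128104717137090720,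
    38141682216580864240562262154441371527790690228799239377456025293238394392143870374223349951228920033333240742426720,
    32541687068038679343499147831610152146891651126584546023111635942870070068382969269522159987233458191389540161034400,
    7515220216485827486608533368755567511067913352920597540028227144849661533655115231833303298490321519388388364007520,
    19359127766868168591728263522892470123436843715089581882082540562056623221186688849492200214014852050209612644100320,
    36255769868426479179334347367686080096199709102866178109513615530821831757938559170969235330080233364789996408412320,
    26883356994457374068462313217690539801054994999636240802669717585936396454701025044591198903745410459324102977665120,
    23756372229216698706615025754110509700753537470224300171328229971643729411609204814255204446979865795517739874789600,
    37554881255706925425652441023164114164010677493201427016713878115627406882916834987087102797895993571895168551233760,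
    5022827386906769621032134291025587489235684648510838838845395269535146701675942161630997778843795203381552525220000,
    23159951601201139109011290879083126888881893866242271393690768604162673970936740667379498818515108607572584350750880,
    29385072419162454281337346304261906349225876082972100879528599507568922251558448324628676516617756369661327026305120,
    15626253533973054153383345187250214900041961962266954515308680237510940213667094507559802370299754061717934785050720,
    34369413306750368460114995645427835657152722692790574092073464216794257229379510295367301403780209824422617458026720,
    6292145243809699930521372346019122211063890296673277608948076151916506846885029692355446663294218681612444882880800,
    13173673686416108564265859828420858692777181029777371238262654594358483446506121710526307927307633796585287863929632,
    15559352619606346313537547186787921651745165903212590868092533479146573123435193339156179343740857676037786589874720,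
    34360716763590715586022779155121005096043239135145658590287407064332050891852949201320350437974994489595071467538720,
    26853760257118507694572361895398938063354788931465801958107862202363789428573309731733918111739885024046707037604640,
    23842655151659286754229197471103052873399828071677701857091210470146514660719316121705537093161857942370631483017760,
    32013509341363725586934125150647129522015744622829503165273115572118612203443768264375421168390420160301296430254880,
    1328445316197497786100468939081295785129595461693884802455220751957081236831175795998564075521728293228452791863840,
    23217225288964913590742801132522934746955818054859528724267856304111014389705548071531789759378767948848996063267360,
    29354846566088388539341303722263119219753794087918714473291802875426767040921177040233182192268976373681402948012320,
    30723591006681505568574938154002507568075115517665551368764144370189889162836524884420219200404039463122002370513440,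
    1916588265283455238189357852113225384370801807519144339499965488603939143711258489155681461907313641840386360133920,
    19271642317179144044050169612188476971403871102452862981086237095098367606625263032264710478145804539614149116857120,
    36198495740203449351327827405987829857767023103227188786204350779277001776068313975955996645580767730837503918361120,
    28521456672383201486459350296079438359691226615037207500705511304580307613304936520387257499181842496952141394957984,
    25820036120883149926568041812612002284388624690985199366570030270808330657458943232354159058147103404042346633428320,
    14099379873597781020416147061025237939845843779077267612744808915687468882701355933019885195282733674126047083602912,
    37628431317219203165987296041094854800875730780615112849215787552565449465941116706819293797179413672499608261973664,
    31162362612526809001218083638414685355128679223742131350878759866552144059812610130180201088045650733371381292531040,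
    1067074910777362603738657339928194836782787356370566566684356925239173413678861856055341869779061049140599011517408,
    15916158290757960932345028448759386318532050757509067865864628489533179707438180038855288070459200316336548517094368,
    33991322941155881472565672311011672278591744052199441260713097344318203369973261067455295708336547552270802512467616,
    26646086489685173543307152025194844866190183276263248640359151589737775675996350262388222701468499583379993385719456,
    23886962572056260961317191995704208930245067876201656561666461768503886972007599634131219170889528818254740621688160,
    37123152342419802210870015912226979105726826678245539544245562179522764834445133116563605411715477007162793843336160,
    5410683616270674122432782471763146716793993745706442878332326630654069212238361179418437726885371813436714972567200,
    32153829076555511170020198126158969860861064651023127517241580775324111674321271830938855528071857939694595499579040,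
    7633756297999650627364417939634249001466425049819823634762929860034120880525871310866187170491463546271399273889120,
    32422522457627415110029930438194509866755684119926537193511992530269711693401248445445887879957174990678029334519712,
    7752713356099063033322701438725102047793722768990843626974899919163922811702774209088096326193157267714063042441824,
    19610822469823125103058783184809493916972374518754709773688519431663704401216766878729516342985865358022355604566624,
    35838581039268151616919159786292577547993602328888618333691018219673817507271791170184169996331797921568799913928160,
    31835276756603106548282886501255601413083154098328921304917034729193834835797195730179932964405604772805933411377056,
    1652989204866407286263090668627511785258866489898750601826277921210840443026724026929643974340783987882868952625760,
    22961336125821140096323978669755857498794638954241484918217267279532609079568455023721425126555464015348805306672608,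
    29408170004721827437929367451199812714882609158771556565151157496760457981670459015077043807659407613940727226867616,
    14155455951375631529399088011227321904549788119594930463675514789180794738525523929482663790646186877060401543606880,
    37656542968333683575999653457599576019273949714500220350688749154338240037962591521951789440136403656792818349237728,
    30399044769715749819867076308868656309555109579094333647094693479667515048184965011919346242608528452927070574047840,
    2351648182381724661039334678213787212495034700021161176400482029463216425246862494551609743991828593633717618468320,
    6354360705989795911201437422862059013394391464214792081513117417030810561998685099274299552111939414464732090638240,
    13511099257407796509891760960236665127864965611149295921458644297961696638375811363668008251470249027578595462705760,
    37318459051575249700103539203381331212528902613473059639857575683078091186501281598346989768684951480936379094167264,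
    5375765045258474233949464317736828509378603092208421709488719265109246377239234735412438990106603923168487380210080,
    23019483471532387820974764664546079368595166325209334663748158685956007398660125867516766651101479858340363216074592,
    29437465835039795298709798191512551024366397416180489949647239374094175267462903977759908718302228421072764315922144,
    30574672820350989402943620611202764626978976961432559145222228282252351125548410491390691226902913798188459009273568,
    2212271024267747471801189092474014763645795578817175942946859852542738750527898320955099314836376093629487476756896,
    19638786236120116047960403773201961630049476878929108883951944389146087519348476448878646843863312065505857964462496,
    35780433253312690288247977351909154442336779863504725527438160697638482965648942521591974508796705820983253245081440,
    28510951531261185985672518728616879033194953410202531786237912660757074715994339749431304283972487640471095670978400,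
    25725194705579132580436666132391042563060355927798874088971618635795902828838847463134472903738150472926184357523168,
    31539211148504169523814480913276607715395898564093946083221344593927481514144570525457230679961014121577828126013280,
    1477364529719186510878918906885560752943158135367234193845455411426082840466592152311495654957463956267019814596320,
    6326840594039432299111391598382206860604880514466978493184443361200974652383544210002895042703812855965267575205600,
    13425431799852026235671564861390736060950685601139172239292937866927137562821726684673631652285416307532658375512480]

/-- The candidates for involutions that map `0` to `16`. -/
def involTabs₁ : List ℕ := [
    29385220040646928311500619475290425927850379972578224426651117322527416602473999359201102685904944885637045912675408,
    7515071810970503014844272611333566329063768651960321752636513232215468196230506013265577754894567020801387655930960,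
    38141830287754737241726468443661078964711740283933290705272469841260394968417853029554920512086138060388495950423120,
    18772177731778439649642373162188165812341361511316456554409013765495894898730576392021866615836920937498673400325200,
    29355438282215003284684616176678239159173298162896517665185056588545558142104377161753841721975014945342429905126672,
    25604679450328097343200932029216728772413560480388688774161487294764122705789598856496739286715352566624817801938704,
    23843838295220511607360752506380837158213127813653270504320821963101720819097910535492966531835221555002996021118480,
    2067271996635218818474659125739915008207525742506539217781005842049188524750975508716699319922751286010292043948368,
    1776831403940445098618729229593548194636613589586714478856132310808160822928252526661792864913704610112496677157520,
    1061306257633945883396906235879830671594055464262913652412816953414230184323855086756354436531559774746444651061200,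
    17104558923108278373017724703639971502523550748530435236588254383611442564705927129287802259191699425197861302496848,
    2960052997398232113575989939879189692321379779769991886098450469960413643255530879377966552129492527434914022005200,
    29410833575976432593285672928915186798723927726888073147370289856640463701859333058085766342571845750111432731947920,
    33959955809136613364147851572589325689138082422332715748854515970274579144200638129396617734662056792987354872638288,
    5370735920998653597002316533533734232995849007443199225721842283791395536908538558455509415534894517929200837770640,
    29438797562501390780393672331423249226652768768438795975373841640059568219034168446489907423462497558839456345805520]

/-- The candidates for involutions that map `0` to `32`. -/
def involTabs₂ : List ℕ := [
    19378361324102298670286895005160074111241030752317599369075429075153622573646344423390027976952653068280830643546208,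
    37535646767693731498146318952953829724141571309095394315628271587684830870445180702741650593863577931362460626724960,
    8121257716852331918057335088031437717667859014926085207978236603127612916111894258741961790153527184891457076865120,
    28779034062502246131214708507801680554085481242994958290635600676313874542219117878570537724894664358924351030831200,
    19348579565670373643470891706547887342563948942635892607609368341171764113276722225942767013022723127986214635997472,
    15597820733783467701987207559086376955804211260128063716585799047390328676961943920685664577763060749268602532809504,
    13836979578675881966147028036250485341603778593392645446745133715727926790270255599681891822882929737646780751989280,
    31765440201288904883282488227092337704200717101210968970855665620557267652605080814346126182723888153439162064547168,
    30864225882660565631400394752208371709681182577825123447169493828821836682725358993520692234512943476038600035202720,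
    30461187243416326192656252000961248958163006042815234261587846442956044055233555151632411436740450208048379784287200,
    26500495918267344135570317267004377550627742996708446934259511143636021288109414937110092089569080137222974238351968,
    32047447476118352646357655462494013207365948768008400854411811987974089503052637346236865921728731393361017380050400,
    19101105634263924354583907908506184291337030006430981377977645212730159085870577171029219925259636802792218394197920,
    4872559019134234673171861443593504132719812263206135860818512335982880808051035241668882964724575856682308219987808,
    34770616906781033906261662298615152519564799585995519834896871773333209407818238623331566415743784951231135970996640,
    19129069620788882541691907311014246719265871047981704205981196996149263603045412559433361006150288611520242008055520]

/-- The automorphisms that differ from the one with table `T₀` by an element that fixes the base point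
and the base line, and that pass the test `isFreeTab`, are among the candidates. -/
def candidateCheck (T₀ : ℕ) (L : List ℕ) : Bool :=
  (edgeStabTabs T₀).all fun T => force T fun T =>
    !isFreeTab T || cyclicTabs.any (Nat.beq T) || L.any (Nat.beq T)

/-- The list `edgeStabTabs` has 5 · 4 · 3 · 2 · 3 = 360 entries. Composing them with a translation
that stabilizes the base line covers the automorphisms that stabilize it and move `0` to `16`,
respectively to `32`; those that survive the test are in the lists above. -/
theorem candidates_check : (isAutTab transTab₁ && isAutTab transTab₂ &&
    (Nat.beq (ap transTab₁ 0) 16 && Nat.beq (ap transTab₁ 16) 0 &&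
      Nat.beq (ap transTab₂ 0) 32 && Nat.beq (ap transTab₂ 16) 48) &&
    candidateCheck transTab₁ involTabs₁ &&
    candidateCheck transTab₂ involTabs₂) = true := by
  decide +kernel

/-- Regularity supplies `a ∈ H` that stabilizes the base line and moves `0` to the same point as
`g₀`. Then `g₀⁻¹ * a` fixes the base edge, so `a` occurs among the tables that were examined. -/
theorem exists_candidate {H : Subgroup ModelAut} (hH : IsEdgeRegular H.subtype) {T₀ : ℕ}
    {g₀ : ModelAut} (h₀ : Rep T₀ g₀) (hl : ln g₀ baseLine = baseLine) {L : List ℕ}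
    (h : candidateCheck T₀ L = true) :
    ∃ a ∈ H, ∃ T, Rep T a ∧ (T ∈ cyclicTabs ∨ T ∈ L) := by
  obtain ⟨⟨a, ha⟩, ⟨ha0, hal⟩, -⟩ := (isEdgeRegular_iff _).1 hH 0 baseLine modelInc_base (pt g₀ 0)
    baseLine (by
      have := (modelInc_map_iff g₀ 0 baseLine).2 modelInc_base
      rwa [hl] at this)
  have ha0 : pt a 0 = pt g₀ 0 := ha0
  have hal : ln a baseLine = baseLine := hal
  have hl' : ln g₀⁻¹ baseLine = baseLine := (stabLine.inv_mem (x := g₀) hl :)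
  obtain ⟨T, hT, hTa⟩ := exists_edgeStabTab (g := g₀⁻¹ * a) (by rw [pt_mul, ha0, pt_inv_pt])
    (by rw [ln_mul, hal, hl']) h₀
  rw [mul_inv_cancel_left] at hTa
  rw [candidateCheck, List.all_eq_true] at h
  have h := h T hT
  rw [force_eq, isFreeTab_of_regular hH ha hal hTa, Bool.not_true, Bool.false_or, Bool.or_eq_true,
    List.any_eq_true, List.any_eq_true] at h
  refine ⟨a, ha, T, hTa, h.imp ?_ ?_⟩ <;>
  · rintro ⟨S, hS, hTS⟩
    rwa [Nat.eq_of_beq_eq_true hTS]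

/-! ### Evaluation of all certificates. -/

/-- A boolean relation holds between the corresponding entries of two lists. -/
def allWith {α β : Type*} (f : α → β → Bool) : List α → List β → Bool
  | [], _ => true
  | _ :: _, [] => false
  | a :: as, b :: bs => f a b && allWith f as bs

theorem exists_of_allWith {α β : Type*} {f : α → β → Bool} {as : List α} {bs : List β}
    (h : allWith f as bs = true) : ∀ a ∈ as, ∃ b, f a b = true := by
  induction as generalizing bs with
  | nil => simp
  | cons a as ih =>
    cases bs with
    | nil => exact Bool.noConfusion h
    | cons b bs =>
      rw [allWith, Bool.and_eq_true] at h
      intro x hx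
      rcases List.mem_cons.1 hx with rfl | hx
      · exact ⟨b, h.1⟩
      · exact ih h.2 x hx

/-- The check of a certificate for the group generated by elements with tables `a`, `b`, `C` and `S`. -/
def pairCheck (C S a b n : ℕ) : Bool :=
  force (comp a b) fun ab => force (comp C C) fun C₂ => force (comp C S) fun CS =>
    force (comp C₂ S) fun C₂S => certCheck [idTab, a, b, ab, C, C₂, S, CS, C₂S] n

/-- The certificates for cyclic stabilizers of the base line and `tabS`. -/
def cyclicCertsS : List ℕ := [
    40472249, 44666537, 56374725, 56374727, 48860841, 48860857, 49385149, 55850471, 2907469163,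
    2907469261, 484552533, 484552533, 64763365, 64763365, 446803799, 399275499, 2639033805,
    396988077, 64239079, 49385149, 3175904461, 57376, 399275499, 480358231, 518106967, 399275243,
    49385129, 40996541, 45715133, 45715113, 44666553, 51656135, 60044743, 44666557, 399275341,
    41520829, 3175904747, 3936464487, 492058069, 491533783, 39947963, 41004605, 48336539,
    48336539, 63714775, 60044757, 60044757, 491533783, 63714775, 55850453, 492058069, 39947963,
    2639033835, 396988075, 413249367, 399275499, 49909435, 480358231, 3175904461, 65568,
    51656167, 395081195, 363433641, 363433661, 40472249, 64239045, 55850439, 44666555, 44666557,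
    60044743, 395081067, 40996541, 3940658789, 3940658789, 365721067, 45715117, 361526763,
    64239077, 399275341, 41520825, 44666537, 40472249, 56374727, 56374725, 48860857, 48860841,
    49385129, 40996541, 2639033805, 3175904619, 60109253, 49909405, 514436949, 64763363,
    365721067, 45715113, 363433645, 2907469261, 45190845, 64239077, 3175904461, 57440, 49909421,
    332166635, 518106965, 518106965, 49385149, 55850471, 446803799, 49909437, 51656135, 44666553,
    44666557, 60044743, 49909437, 3936464727, 3175904589, 2639033835, 491533783, 492058069,
    485076583, 39947963, 48336539, 48336539, 60044757, 63714775, 491533783, 60044757, 55850453,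
    63714775, 39947963, 492058069, 363433643, 2907469291, 365721067, 45715115, 49909421,
    41520827, 3175904461, 65632, 361526763, 45190827, 329879229, 396988073, 64239045, 40472249,
    44666555, 55850439, 60044743, 44666557, 49385149, 64239079, 3940658791, 3175904461,
    480358231, 399275499, 64239079, 395081195, 49909433, 3936464727]

/-- The certificates for elementary abelian stabilizers of the base line and `tabS`. -/
def involCertsS : List (List ℕ) := [
    [57964, 447326039, 3936986967, 514434903, 58472, 514434903, 3936986967, 413771607, 413771607,
    413771607, 3936986967, 447326039, 64369893, 514434903, 447326039, 64368869],
    [49383069, 49383069, 49383069, 49383069, 10403, 10403, 10403, 10403, 10403, 10403, 10403,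
    10403, 10403, 10403, 10403, 10403],
    [399258859, 399258859, 399258859, 399258859, 10403, 10403, 10403, 10403, 10403, 10403, 10403,
    10403, 10403, 10403, 10403, 10403],
    [2639017165, 2639017165, 2639017165, 2639017165, 10403, 10403, 10403, 10403, 10403, 10403,
    10403, 10403, 10403, 10403, 10403, 10403],
    [396986029, 10403, 10403, 10403, 396986029, 10403, 10403, 10403, 10403, 10403, 10403, 10403,
    396986029, 10403, 10403, 396986029],
    [40994461, 10403, 10403, 10403, 10403, 40994461, 10403, 10403, 40994461, 10403, 10403,
    40994461, 10403, 10403, 10403, 10403],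
    [49907389, 10403, 10403, 10403, 10403, 10403, 3940656983, 10403, 10403, 49907387, 10403,
    10403, 10403, 10403, 49907385, 10403],
    [64238805, 10403, 10403, 10403, 10403, 10403, 10403, 492057813, 10403, 10403, 44140203,
    10403, 10403, 60044501, 10403, 10403],
    [60568791, 10403, 10403, 10403, 10403, 64763095, 10403, 10403, 48334523, 10403, 10403,
    56374487, 10403, 10403, 10403, 10403],
    [39945883, 10403, 10403, 10403, 10403, 10403, 39945883, 10403, 10403, 39945883, 10403, 10403,
    10403, 10403, 39945883, 10403],
    [52180197, 10403, 10403, 10403, 10403, 10403, 10403, 60568805, 10403, 10403, 64763109, 10403,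
    10403, 492582117, 10403, 10403],
    [363431595, 10403, 10403, 10403, 10403, 363431593, 10403, 10403, 363431597, 10403, 10403,
    2907452779, 10403, 10403, 10403, 10403],
    [329885373, 10403, 10403, 10403, 329885373, 10403, 10403, 10403, 10403, 10403, 10403, 10403,
    57934, 10403, 10403, 329885373],
    [2907452621, 10403, 10403, 10403, 10403, 10403, 10403, 2907452621, 10403, 10403, 2907452621,
    10403, 10403, 2907452621, 10403, 10403],
    [3175888205, 10403, 10403, 10403, 10403, 10403, 396986029, 10403, 10403, 396986025, 10403,
    10403, 10403, 10403, 396986027, 10403],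
    [484550243, 10403, 10403, 10403, 484550243, 10403, 10403, 10403, 10403, 10403, 10403, 10403,
    57956, 10403, 10403, 484550243]]

/-- The certificates for cyclic stabilizers of the base line and `tabS'`. -/
def cyclicCertsS' : List ℕ := [
    40472249, 44666537, 56374725, 56374727, 48860841, 48860857, 49385149, 55850471, 363433647,
    2907469261, 60569077, 60569077, 64763365, 64763365, 55850487, 49909439, 2639033805,
    396988077, 64239079, 49385149, 3175904461, 3940658791, 49909439, 60044791, 64763383,
    49909407, 49385129, 40996541, 45715133, 45715113, 44666553, 51656135, 60044743, 589872,
    399275341, 41520829, 396988095, 3936464487, 492058069, 491533783, 39947963, 41004605,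
    48336539, 48336539, 63714775, 60044757, 60044757, 491533783, 63714775, 55850453, 492058069,
    39947963, 329879231, 396988075, 51656183, 49909439, 49909435, 60044791, 3175904461,
    3940658791, 51656167, 49385151, 363433641, 363433661, 40472249, 64239045, 55850439, 44666555,
    44666557, 712752, 49385135, 40996541, 3940658789, 3940658789, 45715135, 45715117, 45190847,
    64239077, 399275341, 41520825, 44666537, 40472249, 56374727, 56374725, 48860857, 48860841,
    49385129, 40996541, 2639033805, 396988079, 60569079, 49909405, 64763367, 64763363, 45715135,
    45715113, 363433645, 2907469261, 45190845, 64239077, 3175904461, 3940658791, 49909421,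
    41520831, 64763381, 64763381, 581738, 55850471, 55850487, 49909437, 51656135, 44666553,
    44666557, 712816, 49909437, 492058103, 3175904589, 329879231, 491533783, 492058069, 721002,
    39947963, 48336539, 48336539, 60044757, 63714775, 491533783, 60044757, 55850453, 63714775,
    39947963, 492058069, 363433643, 363433663, 45715135, 45715115, 49909421, 41520827,
    3175904461, 3940658791, 45190847, 45190827, 329879229, 396988073, 64239045, 40472249,
    44666555, 55850439, 60044743, 589936, 49385149, 64239079, 55916019, 3175904461, 60044791,
    49909439, 64239079, 49385151, 49909433, 492058103]

/-- The certificates for elementary abelian stabilizers of the base line and `tabS'`. -/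
def involCertsS' : List (List ℕ) := [
    [574580, 55915767, 492123383, 64304375, 574498, 64304375, 492123383, 51721463, 51721463,
    51721463, 492123383, 55915767, 64368869, 64304375, 55915767, 64369893],
    [49383069, 49383069, 49383069, 49383069, 10403, 10403, 10403, 10403, 10403, 10403, 10403,
    10403, 10403, 10403, 10403, 10403],
    [49907359, 49907359, 49907359, 49907359, 10403, 10403, 10403, 10403, 10403, 10403, 10403,
    10403, 10403, 10403, 10403, 10403],
    [2639017165, 2639017165, 2639017165, 2639017165, 10403, 10403, 10403, 10403, 10403, 10403,
    10403, 10403, 10403, 10403, 10403, 10403],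
    [396986029, 10403, 10403, 10403, 396986029, 10403, 10403, 10403, 10403, 10403, 10403, 10403,
    396986029, 10403, 10403, 396986029],
    [51721431, 10403, 10403, 10403, 10403, 55915735, 10403, 10403, 44672701, 10403, 10403,
    44672703, 10403, 10403, 10403, 10403],
    [49907389, 10403, 10403, 10403, 10403, 10403, 492582135, 10403, 10403, 49907387, 10403,
    10403, 10403, 10403, 49907385, 10403],
    [64238805, 10403, 10403, 10403, 10403, 10403, 10403, 492057813, 10403, 10403, 44140203,
    10403, 10403, 60044501, 10403, 10403],
    [60568791, 10403, 10403, 10403, 10403, 64763095, 10403, 10403, 48334523, 10403, 10403,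
    56374487, 10403, 10403, 10403, 10403],
    [39945883, 10403, 10403, 10403, 10403, 10403, 39945883, 10403, 10403, 39945883, 10403, 10403,
    10403, 10403, 39945883, 10403],
    [52180197, 10403, 10403, 10403, 10403, 10403, 10403, 60568805, 10403, 10403, 64763109, 10403,
    10403, 492582117, 10403, 10403],
    [363431595, 10403, 10403, 10403, 10403, 363431593, 10403, 10403, 363431597, 10403, 10403,
    363431599, 10403, 10403, 10403, 10403],
    [329885373, 10403, 10403, 10403, 329885373, 10403, 10403, 10403, 10403, 10403, 10403, 10403,
    575058, 10403, 10403, 329885373],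
    [2907452621, 10403, 10403, 10403, 10403, 10403, 10403, 2907452621, 10403, 10403, 2907452621,
    10403, 10403, 2907452621, 10403, 10403],
    [52245703, 10403, 10403, 10403, 10403, 10403, 396986029, 10403, 10403, 396986025, 10403,
    10403, 10403, 10403, 396986027, 10403],
    [484550243, 10403, 10403, 10403, 484550243, 10403, 10403, 10403, 10403, 10403, 10403, 10403,
    574022, 10403, 10403, 484550243]]

/-- The check that each pair of candidates, together with the elements with tables `C` and `S`, either
contradicts regularity or generates one of the groups. -/
def classifyCheck (C S : ℕ) (cyclicCerts : List ℕ) (involCerts : List (List ℕ)) : Bool :=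
  -- An element of order four generates the stabilizer of the base line by itself; its square takes
  -- the place of the second letter.
  allWith (fun a n => force (comp a a) fun b => pairCheck C S a b n) cyclicTabs cyclicCerts &&
    allWith (fun a ns => allWith (pairCheck C S a) involTabs₂ ns) involTabs₁ involCerts

/-- This is the case of a cyclic point stabilizer, so the even certificates name groups whose
presentation has a single `b`. Odd certificates code words: the frequent entry `10403`, for example,
stands for `a * b * a * b`, whose value fixes the base edge without being trivial, so this pair of
candidates cannot lie in a regular group. -/
theorem classifyCheck_tabS : classifyCheck tabC tabS cyclicCertsS involCertsS = true := by
  decide +kernel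

theorem classifyCheck_tabS' : classifyCheck tabC tabS' cyclicCertsS' involCertsS' = true := by
  decide +kernel

theorem exists_actionIso_of_pair {H : Subgroup ModelAut} (hH : IsEdgeRegular H.subtype)
    {c s a b : ModelAut} (hc : c ∈ H) (hs : s ∈ H) (ha : a ∈ H) (hb : b ∈ H) {C S A B n : ℕ}
    (hC : Rep C c) (hS : Rep S s) (hA : Rep A a) (hB : Rep B b)
    (h : pairCheck C S A B n = true) :
    ∃ i : Fin 11, ActionIso H.subtype (presL i).action := by
  rw [pairCheck, force_eq, force_eq, force_eq, force_eq] at h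
  refine exists_actionIso_of_certCheck hH
    (e := fun l => [1, a, b, a * b, c, c * c, s, c * s, c * c * s].getD l 1) (fun l hl => ?_) h
  interval_cases l <;> simp only [List.getD_cons_zero, List.getD_cons_succ]
  · exact ⟨H.one_mem, rep_one⟩
  · exact ⟨ha, hA⟩
  · exact ⟨hb, hB⟩
  · exact ⟨H.mul_mem ha hb, hA.comp hB⟩
  · exact ⟨hc, hC⟩
  · exact ⟨H.mul_mem hc hc, hC.comp hC⟩
  · exact ⟨hs, hS⟩
  · exact ⟨H.mul_mem hc hs, hC.comp hS⟩
  · exact ⟨H.mul_mem (H.mul_mem hc hc) hs, (hC.comp hC).comp hS⟩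

/-- The group `H` contains elements that stabilize the base line and move `0` to `16` and to `32`. A
candidate of order four in either place generates the line stabilizer, which has order four, and is
treated alone. Otherwise both are candidates for involutions; being distinct, they generate it
together. -/
theorem exists_actionIso_of_classifyCheck {H : Subgroup ModelAut} (hH : IsEdgeRegular H.subtype)
    {C S : ℕ} {certs : List ℕ} {certs' : List (List ℕ)}
    (h : classifyCheck C S certs certs' = true) {c s : ModelAut}
    (hc : c ∈ H) (hs : s ∈ H) (hC : Rep C c) (hS : Rep S s) :
    ∃ i : Fin 11, ActionIso H.subtype (presL i).action := by
  have hch := candidates_check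
  rw [Bool.and_eq_true, Bool.and_eq_true, Bool.and_eq_true, Bool.and_eq_true, Bool.and_eq_true,
    Bool.and_eq_true, Bool.and_eq_true, Nat.beq_eq, Nat.beq_eq, Nat.beq_eq, Nat.beq_eq] at hch
  obtain ⟨⟨⟨⟨hT₁, hT₂⟩, ⟨⟨e₁0, e₁16⟩, e₂0⟩, e₂16⟩, h₁⟩, h₂⟩ := hch
  obtain ⟨g₁, hg₁⟩ := exists_rep_of_isAutTab hT₁
  obtain ⟨g₂, hg₂⟩ := exists_rep_of_isAutTab hT₂
  have h₁0 : (pt g₁ 0 : ℕ) = 16 := by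
    rw [hg₁ 0]
    exact e₁0
  have h₁16 : (pt g₁ 16 : ℕ) = 0 := by
    rw [hg₁ 16]
    exact e₁16
  have h₂0 : (pt g₂ 0 : ℕ) = 32 := by
    rw [hg₂ 0]
    exact e₂0
  have h₂16 : (pt g₂ 16 : ℕ) = 48 := by
    rw [hg₂ 16]
    exact e₂16
  have hl₁ : ln g₁ baseLine = baseLine := ln_baseLine_iff.2
    ⟨modelInc_baseLine_iff_mem.2 (by simp [h₁0]), modelInc_baseLine_iff_mem.2 (by simp [h₁16])⟩
  have hl₂ : ln g₂ baseLine = baseLine := ln_baseLine_iff.2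
    ⟨modelInc_baseLine_iff_mem.2 (by simp [h₂0]), modelInc_baseLine_iff_mem.2 (by simp [h₂16])⟩
  obtain ⟨a, ha, A, hA, hA'⟩ := exists_candidate hH hg₁ hl₁ h₁
  obtain ⟨b, hb, B, hB, hB'⟩ := exists_candidate hH hg₂ hl₂ h₂
  rw [classifyCheck, Bool.and_eq_true] at h
  have hcyc : ∀ a ∈ H, ∀ A ∈ cyclicTabs, Rep A a →
      ∃ i : Fin 11, ActionIso H.subtype (presL i).action := by
    intro a ha A hA hAa
    obtain ⟨n, hn⟩ := exists_of_allWith h.1 A hA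
    rw [force_eq] at hn
    exact exists_actionIso_of_pair hH hc hs ha (H.mul_mem ha ha) hC hS hAa (hAa.comp hAa) hn
  rcases hA' with hA' | hA'
  · exact hcyc a ha A hA' hA
  rcases hB' with hB' | hB'
  · exact hcyc b hb B hB' hB
  obtain ⟨ns, hns⟩ := exists_of_allWith h.2 A hA'
  obtain ⟨n, hn⟩ := exists_of_allWith hns B hB'
  exact exists_actionIso_of_pair hH hc hs ha hb hC hS hA hB hn

/-- The classification of the groups of automorphisms of the model that are regular on edges. -/
theorem exists_actionIso {G : Subgroup ModelAut} (hG : IsEdgeRegular G.subtype) :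
    ∃ i : Fin 11, ActionIso G.subtype (presL i).action := by
  obtain ⟨η, c, hc, s, hs, hC, hS⟩ := exists_conj_stabPoint hG
  have hiso := actionIso_map η G
  have hH := hG.of_actionIso hiso
  have hc' : η * c * η⁻¹ ∈ G.map (autCongr η).toMonoidHom := ⟨c, hc, rfl⟩
  have hs' : η * s * η⁻¹ ∈ G.map (autCongr η).toMonoidHom := ⟨s, hs, rfl⟩
  obtain ⟨i, hi⟩ : ∃ i : Fin 11, ActionIso (G.map (autCongr η).toMonoidHom).subtype
      (presL i).action := by
    rcases hS with hS | hS
    · exact exists_actionIso_of_classifyCheck hH classifyCheck_tabS hc' hs' hC hS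
    · exact exists_actionIso_of_classifyCheck hH classifyCheck_tabS' hc' hs' hC hS
  exact ⟨i, hiso.trans hi⟩


/-! ### The model and the slanted symplectic quadrangle -/

section Field

variable {F : Type*} [Field F]

/-- The elements of the field with four elements. -/
def gf (ω : F) : ℕ → F
  | 0 => 0
  | 1 => 1
  | 2 => ω
  | _ => ω + 1

/-- Multiplication of the labels of the elements of the field with four elements. -/
def mulLabel (i j : ℕ) : ℕ := [0, 0, 0, 0, 0, 1, 2, 3, 0, 2, 3, 1, 0, 3, 1, 2].getD (4 * i + j) 0

theorem gf_xor [CharP F 2] (ω : F) {i j : ℕ} (hi : i < 4) (hj : j < 4) :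
    gf ω (i ^^^ j) = gf ω i + gf ω j := by
  have h2 : (2 : F) = 0 := CharTwo.two_eq_zero
  interval_cases i <;> interval_cases j <;> simp only [gf, Nat.reduceXor] <;>
    first
      | ring1
      | linear_combination -h2
      | linear_combination -ω * h2
      | linear_combination -(ω + 1) * h2

theorem gf_mulLabel [CharP F 2] {ω : F} (hω : ω ^ 2 = ω + 1) {i j : ℕ} (hi : i < 4) (hj : j < 4) :
    gf ω (mulLabel i j) = gf ω i * gf ω j := by
  have h2 : (2 : F) = 0 := CharTwo.two_eq_zero
  interval_cases i <;> interval_cases j <;> simp [gf, mulLabel] <;>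
    first
      | linear_combination -hω
      | linear_combination -hω - ω * h2
      | linear_combination -hω - (ω + 1) * h2

theorem mulLabel_lt (i j : ℕ) : mulLabel i j < 4 := by
  unfold mulLabel
  rcases lt_or_ge (4 * i + j) 16 with h | h
  · generalize 4 * i + j = n at h
    interval_cases n <;> decide
  · rw [List.getD_eq_default _ _ (by simpa using h)]
    norm_num

theorem gf_injective [CharP F 2] {ω : F} (hω : ω ^ 2 = ω + 1) {i j : ℕ} (hi : i < 4) (hj : j < 4)
    (h : gf ω i = gf ω j) : i = j := by
  have h2 : (2 : F) = 0 := CharTwo.two_eq_zero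
  have h0 : ω ≠ 0 := by
    rintro rfl
    simp at hω
  have h1 : ω + 1 ≠ 0 := fun h => h0 (by
    rw [h] at hω
    exact pow_eq_zero_iff (two_ne_zero) |>.1 hω)
  have hx : gf ω (i ^^^ j) = 0 := by
    rw [gf_xor ω hi hj, h]
    linear_combination gf ω j * h2
  have hlt : i ^^^ j < 4 := Nat.xor_lt_two_pow (n := 2) hi hj
  have key : ∀ n < 4, gf ω n = 0 → n = 0 := by
    intro n hn hn0
    interval_cases n
    · rfl
    · exact absurd hn0 one_ne_zero
    · exact absurd hn0 h0
    · exact absurd hn0 h1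
  exact Nat.xor_eq_zero_iff.1 (key _ hlt hx)

/-- The matrix of a point of the model. -/
def matrixOf (ω : F) (p : ℕ) : Matrix.SpecialLinearGroup (Fin 4) F :=
  slantedMatrix (gf ω (p % 4)) (gf ω (p / 4 % 4))
    (gf ω (p / 16 % 4) + gf ω (p % 4) * gf ω (p / 4 % 4))

theorem slantedMatrix_inj {x y z x' y' z' : F} :
    slantedMatrix x y z = slantedMatrix x' y' z' ↔ x = x' ∧ y = y' ∧ z = z' := by
  constructor
  · intro h
    have hv : ∀ i j, (slantedMatrix x y z).1 i j = (slantedMatrix x' y' z').1 i j := fun i j => by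
      rw [h]
    refine ⟨?_, ?_, ?_⟩
    · simpa [slantedMatrix] using hv 2 3
    · simpa [slantedMatrix] using hv 0 2
    · simpa [slantedMatrix] using hv 0 3
  · rintro ⟨rfl, rfl, rfl⟩
    rfl

theorem xor_mod_four (p q : ℕ) : (p ^^^ q) % 4 = (p % 4) ^^^ (q % 4) := by
  have := Nat.xor_mod_two_pow (a := p) (b := q) (n := 2)
  simpa using this

theorem xor_div_four (p q : ℕ) : (p ^^^ q) / 4 = (p / 4) ^^^ (q / 4) := by
  have := Nat.xor_div_two_pow (a := p) (b := q) (n := 2)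
  simpa using this

theorem xor_div_sixteen (p q : ℕ) : (p ^^^ q) / 16 = (p / 16) ^^^ (q / 16) := by
  have := Nat.xor_div_two_pow (a := p) (b := q) (n := 4)
  simpa using this

/-- In characteristic 2 the term `x y' + y x'` of the product of matrices is exactly what is missing
from `x y + x' y'` to `(x + x') (y + y')`. So the correction `x y` in the last coordinate makes
multiplication additive. -/
theorem matrixOf_mul [CharP F 2] (ω : F) (p q : ℕ) :
    matrixOf ω p * matrixOf ω q = matrixOf ω (p ^^^ q) := by
  have h2 : (2 : F) = 0 := CharTwo.two_eq_zero
  have hm : ∀ n : ℕ, n % 4 < 4 := fun n => Nat.mod_lt _ (by norm_num)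
  rw [matrixOf, matrixOf, matrixOf, slantedMatrix_mul, slantedMatrix_inj, xor_div_four,
    xor_div_sixteen, xor_mod_four, xor_mod_four, xor_mod_four, gf_xor ω (hm _) (hm _),
    gf_xor ω (hm _) (hm _), gf_xor ω (hm _) (hm _)]
  refine ⟨rfl, rfl, ?_⟩
  linear_combination -gf ω (p % 4) * gf ω (q / 4 % 4) * h2

theorem matrixOf_injective [CharP F 2] {ω : F} (hω : ω ^ 2 = ω + 1) {p q : ℕ} (hp : p < 64)
    (hq : q < 64) (h : matrixOf ω p = matrixOf ω q) : p = q := by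
  have hm : ∀ n : ℕ, n % 4 < 4 := fun n => Nat.mod_lt _ (by norm_num)
  obtain ⟨h1, h2, h3⟩ := slantedMatrix_inj.1 h
  rw [h1, h2, add_left_inj] at h3
  have h1 := gf_injective hω (hm _) (hm _) h1
  have h2 := gf_injective hω (hm _) (hm _) h2
  have h3 := gf_injective hω (hm _) (hm _) h3
  omega

/-- The point of the model with given labels of the entries of the matrix. -/
def pointOf (i j k : ℕ) : ℕ := i + 4 * j + 16 * (k ^^^ mulLabel i j)

theorem pointOf_lt {i j k : ℕ} (hi : i < 4) (hj : j < 4) (hk : k < 4) : pointOf i j k < 64 := by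
  have : k ^^^ mulLabel i j < 4 := Nat.xor_lt_two_pow (n := 2) hk (mulLabel_lt i j)
  unfold pointOf
  omega

/-- The product of the labels `i` and `j` enters once through `pointOf` and once through `matrixOf`,
and the two contributions cancel in characteristic 2. -/
theorem matrixOf_pointOf [CharP F 2] {ω : F} (hω : ω ^ 2 = ω + 1) {i j k : ℕ} (hi : i < 4)
    (hj : j < 4) (hk : k < 4) :
    matrixOf ω (pointOf i j k) = slantedMatrix (gf ω i) (gf ω j) (gf ω k) := by
  have h2 : (2 : F) = 0 := CharTwo.two_eq_zero
  have hlt : k ^^^ mulLabel i j < 4 := Nat.xor_lt_two_pow (n := 2) hk (mulLabel_lt i j)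
  rw [matrixOf, show pointOf i j k % 4 = i by unfold pointOf; omega,
    show pointOf i j k / 4 % 4 = j by unfold pointOf; omega,
    show pointOf i j k / 16 % 4 = k ^^^ mulLabel i j by unfold pointOf; omega,
    gf_xor ω hk (mulLabel_lt i j), gf_mulLabel hω hi hj, slantedMatrix_inj]
  refine ⟨rfl, rfl, ?_⟩
  linear_combination gf ω i * gf ω j * h2

/-- The matrices of the points on the line through `0` in direction `d`. -/
def directionSet (ω : F) (d : ℕ) : Set (Matrix.SpecialLinearGroup (Fin 4) F) :=
  {A | ∃ p < 64, (p = 0 ∨ dirOf p = d) ∧ A = matrixOf ω p}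

theorem directionSet_zero_check : (List.range 64).all (fun p =>
    (Nat.beq p 0 || Nat.beq (dirOf p) 0) == (List.range 4).any fun k =>
      Nat.beq (pointOf 0 0 k) p) = true := by
  decide +kernel

/-- The label of the direction of the subgroup `X_[a:b]`. -/
def slopeDir (i j : ℕ) : ℕ := [0, 2, 2, 2, 1, 3, 4, 5, 1, 5, 3, 4, 1, 4, 5, 3].getD (4 * i + j) 0

theorem directionSet_slope_check : (List.range 4).all (fun i => (List.range 4).all fun j =>
    (Nat.beq i 0 && Nat.beq j 0) || (Nat.blt (slopeDir i j) 6 && (List.range 64).all fun p =>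
      (Nat.beq p 0 || Nat.beq (dirOf p) (slopeDir i j)) == (List.range 4).any fun m =>
        Nat.beq (pointOf (mulLabel m i) (mulLabel m j) 0) p)) = true := by
  decide +kernel

theorem slopeDir_surjective : ∀ d < 6, d ≠ 0 → ∃ i < 4, ∃ j < 4, ¬(i = 0 ∧ j = 0) ∧
    slopeDir i j = d := by
  decide

/-- Direction `0` belongs to `X₀`; the other five belong to the five points of the projective line,
which are treated in `directionSet_slope`. -/
theorem directionSet_zero [CharP F 2] {ω : F} (hω : ω ^ 2 = ω + 1)
    (hsurj : ∀ x : F, ∃ i < 4, gf ω i = x) :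
    directionSet ω 0 = slantedX0 F := by
  have h0 : gf ω 0 = 0 := rfl
  ext A
  constructor
  · rintro ⟨p, hp, hd, rfl⟩
    have h := forall_lt_of_all directionSet_zero_check p hp
    rw [beq_iff_eq, show (Nat.beq p 0 || Nat.beq (dirOf p) 0) = true by
      rwa [Bool.or_eq_true, Nat.beq_eq, Nat.beq_eq]] at h
    obtain ⟨k, hk, hkp⟩ := List.any_eq_true.1 h.symm
    rw [← Nat.eq_of_beq_eq_true hkp, matrixOf_pointOf hω (by norm_num) (by norm_num)
      (List.mem_range.1 hk)]
    exact ⟨gf ω k, rfl⟩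
  · rintro ⟨μ, rfl⟩
    obtain ⟨k, hk, rfl⟩ := hsurj μ
    have hlt := pointOf_lt (i := 0) (j := 0) (k := k) (by norm_num) (by norm_num) hk
    refine ⟨pointOf 0 0 k, hlt, ?_,
      (matrixOf_pointOf hω (i := 0) (j := 0) (by norm_num) (by norm_num) hk).symm⟩
    have h := forall_lt_of_all directionSet_zero_check _ hlt
    rw [beq_iff_eq] at h
    have h := h.trans (List.any_eq_true.2 ⟨k, List.mem_range.2 hk, Nat.beq_refl _⟩)
    rwa [Bool.or_eq_true, Nat.beq_eq, Nat.beq_eq] at h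

theorem directionSet_slope [CharP F 2] {ω : F} (hω : ω ^ 2 = ω + 1)
    (hsurj : ∀ x : F, ∃ i < 4, gf ω i = x) {i j : ℕ} (hi : i < 4) (hj : j < 4)
    (hij : ¬(i = 0 ∧ j = 0)) :
    slopeDir i j < 6 ∧ directionSet ω (slopeDir i j) = slantedX (gf ω i) (gf ω j) := by
  have hc := forall_lt_of_all (forall_lt_of_all directionSet_slope_check i hi) j hj
  rw [Bool.or_eq_true, Bool.and_eq_true, Nat.beq_eq, Nat.beq_eq, Bool.and_eq_true] at hc
  have hc := hc.resolve_left hij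
  refine ⟨by simpa only [Nat.blt_eq] using hc.1, ?_⟩
  have hc := hc.2
  have hmat : ∀ m < 4, matrixOf ω (pointOf (mulLabel m i) (mulLabel m j) 0) =
      slantedMatrix (gf ω m * gf ω i) (gf ω m * gf ω j) 0 := by
    intro m hm
    rw [matrixOf_pointOf hω (mulLabel_lt _ _) (mulLabel_lt _ _) (by norm_num), gf_mulLabel hω hm hi,
      gf_mulLabel hω hm hj]
    rfl
  ext A
  constructor
  · rintro ⟨p, hp, hd, rfl⟩
    have h := forall_lt_of_all hc p hp
    rw [beq_iff_eq, show (Nat.beq p 0 || Nat.beq (dirOf p) (slopeDir i j)) = true by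
      rwa [Bool.or_eq_true, Nat.beq_eq, Nat.beq_eq]] at h
    obtain ⟨m, hm, hmp⟩ := List.any_eq_true.1 h.symm
    rw [← Nat.eq_of_beq_eq_true hmp, hmat m (List.mem_range.1 hm)]
    exact ⟨gf ω m, rfl⟩
  · rintro ⟨μ, rfl⟩
    obtain ⟨m, hm, rfl⟩ := hsurj μ
    have hlt := pointOf_lt (mulLabel_lt m i) (mulLabel_lt m j) (k := 0) (by norm_num)
    refine ⟨_, hlt, ?_, (hmat m hm).symm⟩
    have h := forall_lt_of_all hc _ hlt
    rw [beq_iff_eq] at h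
    have h := h.trans (List.any_eq_true.2 ⟨m, List.mem_range.2 hm, Nat.beq_refl _⟩)
    rwa [Bool.or_eq_true, Nat.beq_eq, Nat.beq_eq] at h

/-- The set of matrices of the points on a line. -/
theorem mul_directionSet [CharP F 2] {ω : F} {q : Fin 64} (d : Fin 6) :
    (fun A => matrixOf ω q * A) '' directionSet ω d =
      {A | ∃ p : Fin 64, ModelInc p (lineThrough d q) ∧ A = matrixOf ω p} := by
  have hline : ∀ p : Fin 64, ModelInc p (lineThrough d q) ↔
      ((q : ℕ) ^^^ p = 0 ∨ dirOf ((q : ℕ) ^^^ p) = d) := by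
    intro p
    rw [Nat.xor_eq_zero_iff, ← lineIdx_eq_iff d.2 q.2 p.2]
    exact eq_comm
  ext A
  constructor
  · rintro ⟨_, ⟨r, hr, hd, rfl⟩, rfl⟩
    refine ⟨⟨(q : ℕ) ^^^ r, Nat.xor_lt_two_pow (n := 6) q.2 hr⟩, ?_, matrixOf_mul ω _ _⟩
    rw [hline]
    simpa [← Nat.xor_assoc] using hd
  · rintro ⟨p, hp, rfl⟩
    refine ⟨matrixOf ω ((q : ℕ) ^^^ p),
      ⟨_, Nat.xor_lt_two_pow (n := 6) q.2 p.2, (hline p).1 hp, rfl⟩, ?_⟩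
    change matrixOf ω q * matrixOf ω ((q : ℕ) ^^^ p) = _
    rw [matrixOf_mul, ← Nat.xor_assoc, Nat.xor_self, Nat.zero_xor]

/-- The slanted symplectic quadrangle over the field with four elements is isomorphic to the model. -/
theorem nonempty_model_iso [CharP F 2] {ω : F} (hω : ω ^ 2 = ω + 1)
    (hsurj : ∀ x : F, ∃ i < 4, gf ω i = x) :
    Nonempty (model ≃g slantedQuadrangle F) := by
  have hmem : ∀ p, matrixOf ω p ∈ slantedGroup F := fun p => ⟨_, _, _, rfl⟩
  have hpsurj : ∀ g ∈ slantedGroup F, ∃ q : Fin 64, matrixOf ω q = g := by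
    rintro _ ⟨x, y, z, rfl⟩
    obtain ⟨i, hi, rfl⟩ := hsurj x
    obtain ⟨j, hj, rfl⟩ := hsurj y
    obtain ⟨k, hk, rfl⟩ := hsurj z
    exact ⟨⟨_, pointOf_lt hi hj hk⟩, matrixOf_pointOf hω hi hj hk⟩
  have hpinj : ∀ {p q : Fin 64}, matrixOf ω p = matrixOf ω q → p = q := fun {p q} h =>
    Fin.ext (matrixOf_injective hω p.2 q.2 h)
  let lineSet : Fin 6 × Fin 16 → Set (Matrix.SpecialLinearGroup (Fin 4) F) := fun l =>
    {A | ∃ p : Fin 64, ModelInc p l ∧ A = matrixOf ω p}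
  have hline : ∀ l, IsSlantedLine (lineSet l) := by
    intro l
    obtain ⟨q, -, -, hq, -⟩ := exists_ne_on_line l
    rw [modelInc_iff] at hq
    refine ⟨matrixOf ω q, hmem q, ?_⟩
    have hl : lineSet l = (fun A => matrixOf ω q * A) '' directionSet ω l.1 := by
      rw [mul_directionSet, ← hq]
    by_cases h0 : (l.1 : ℕ) = 0
    · left
      rw [hl, h0, directionSet_zero hω hsurj]
    · right
      obtain ⟨i, hi, j, hj, hij, hd⟩ := slopeDir_surjective l.1 l.1.2 h0
      refine ⟨gf ω i, gf ω j, fun h => hij ?_, ?_⟩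
      · rw [Prod.mk.injEq] at h
        exact ⟨gf_injective hω hi (by norm_num) h.1, gf_injective hω hj (by norm_num) h.2⟩
      · rw [hl, ← hd, (directionSet_slope hω hsurj hi hj hij).2]
  have hlinesurj : ∀ s, IsSlantedLine s → ∃ l, lineSet l = s := by
    rintro s ⟨g, hg, hs⟩
    obtain ⟨q, rfl⟩ := hpsurj g hg
    rcases hs with rfl | ⟨a, b, hab, rfl⟩
    · rw [← directionSet_zero hω hsurj]
      exact ⟨lineThrough 0 q, (mul_directionSet 0).symm⟩
    · obtain ⟨i, hi, rfl⟩ := hsurj a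
      obtain ⟨j, hj, rfl⟩ := hsurj b
      obtain ⟨hd, hX⟩ := directionSet_slope hω hsurj hi hj (by
        rintro ⟨rfl, rfl⟩
        exact hab rfl)
      rw [← hX]
      exact ⟨lineThrough ⟨_, hd⟩ q, (mul_directionSet _).symm⟩
  have hinc : ∀ (p : Fin 64) l, matrixOf ω p ∈ lineSet l ↔ ModelInc p l := by
    intro p l
    constructor
    · rintro ⟨q, hq, h⟩
      rwa [hpinj h]
    · exact fun h => ⟨p, h, rfl⟩
  let P : Fin 64 → slantedGroup F := fun p => ⟨matrixOf ω p, hmem p⟩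
  let L : Fin 6 × Fin 16 →
      {l : Set (Matrix.SpecialLinearGroup (Fin 4) F) // IsSlantedLine l} := fun l => ⟨lineSet l, hline l⟩
  have hP : Function.Bijective P := by
    constructor
    · intro p q h
      exact hpinj (congrArg Subtype.val h)
    · rintro ⟨g, hg⟩
      obtain ⟨q, rfl⟩ := hpsurj g hg
      exact ⟨q, rfl⟩
  have hL : Function.Bijective L := by
    constructor
    · intro l m h
      have h : lineSet l = lineSet m := congrArg Subtype.val h
      obtain ⟨p, q, hpq, hp, hq⟩ := exists_ne_on_line l
      refine modelInc_line_unique hpq hp hq ?_ ?_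
      · rwa [← hinc, ← h, hinc]
      · rwa [← hinc, ← h, hinc]
    · rintro ⟨s, hs⟩
      obtain ⟨l, rfl⟩ := hlinesurj s hs
      exact ⟨l, rfl⟩
  exact ⟨{ toEquiv := Equiv.sumCongr (Equiv.ofBijective P hP) (Equiv.ofBijective L hL)
           map_rel_iff' := by
            rintro (p | l) (q | m)
            · exact Iff.rfl
            · exact hinc p m
            · exact hinc q l
            · exact Iff.rfl }⟩

end Field

theorem nonempty_iso_quadrangleQ : Nonempty (model ≃g quadrangleQ) := by
  classical
  have hcard : Nat.card (GaloisField 2 2) = 4 := GaloisField.card 2 2 (by norm_num)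
  have : Fintype (GaloisField 2 2) := Fintype.ofFinite _
  have hcard' : Fintype.card (GaloisField 2 2) = 4 := by rwa [Nat.card_eq_fintype_card] at hcard
  have h2 : (2 : GaloisField 2 2) = 0 := CharTwo.two_eq_zero
  obtain ⟨ω, h⟩ : ∃ ω : GaloisField 2 2, ω ∉ ({0, 1} : Finset (GaloisField 2 2)) := by
    by_contra! h
    have h1 := Finset.card_le_card (fun x _ => h x : Finset.univ ⊆ _)
    have h3 := Finset.card_le_two (a := (0 : GaloisField 2 2)) (b := 1)
    rw [Finset.card_univ, hcard'] at h1
    omega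
  simp only [Finset.mem_insert, Finset.mem_singleton, not_or] at h
  -- In characteristic 2 the polynomial `X⁴ - X` equals `X (X - 1) (X² - (X + 1))`, so an element
  -- other than `0` and `1` is a root of the last factor.
  have hω : ω ^ 2 = ω + 1 := by
    have h4 : ω ^ 4 = ω := by rw [← hcard', FiniteField.pow_card]
    have h5 : ω * (ω - 1) * (ω ^ 2 - (ω + 1)) = 0 := by
      linear_combination h4 - (ω ^ 3 - ω) * h2
    rcases mul_eq_zero.1 h5 with h5 | h5
    · rcases mul_eq_zero.1 h5 with h5 | h5
      · exact absurd h5 h.1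
      · exact absurd (sub_eq_zero.1 h5) h.2
    · exact sub_eq_zero.1 h5
  refine nonempty_model_iso hω fun x => ?_
  have hbij : Function.Bijective fun i : Fin 4 => gf ω i :=
    (Fintype.bijective_iff_injective_and_card _).2
      ⟨fun i j hij => Fin.ext (gf_injective hω i.2 j.2 hij), by rw [hcard', Fintype.card_fin]⟩
  obtain ⟨i, hi⟩ := hbij.2 x
  exact ⟨i, i.2, hi⟩

end Quadrangle

theorem lemma5p1 :
    (∀ G : Subgroup (quadrangleQ ≃g quadrangleQ), IsEdgeRegular G.subtype →
      ∃ i : Fin 11, ActionIso G.subtype (presL i).action) ∧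
    (∀ i : Fin 11, ∃ G : Subgroup (quadrangleQ ≃g quadrangleQ),
      IsEdgeRegular G.subtype ∧ ActionIso G.subtype (presL i).action) ∧
    (∀ i j : Fin 11, ActionIso (presL i).action (presL j).action → i = j) := by
  obtain ⟨ψ⟩ := Quadrangle.nonempty_iso_quadrangleQ
  refine ⟨fun G hG => ?_, fun i => ?_, Quadrangle.eq_of_actionIso⟩
  · have h := Quadrangle.actionIso_map ψ.symm G
    obtain ⟨i, hi⟩ := Quadrangle.exists_actionIso (hG.of_actionIso h)
    exact ⟨i, h.trans hi⟩
  · obtain ⟨y, -, hy⟩ := Quadrangle.exists_good i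
    obtain ⟨ρ, -, hρ, hiso⟩ := hy.exists_regular
    have h := Quadrangle.actionIso_map ψ ρ.range
    exact ⟨_, hρ.range.of_actionIso h, h.symm.trans ((Quadrangle.actionIso_range ρ hρ.injective).trans hiso)⟩
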